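/- **Proposition 6.1.** Let $d\ge 1$. Use the unitary Fourier transform $\hat f(\xi)=(2\pi)^{-d/2}\int_{\mathbb R^d} f(x)e^{-ix\cdot\xi}\,dx$ and put $$\|f\|_2=\int_{\mathbb R^d}|\xi|^2|\hat f(\xi)|\,d\xi,\qquad \|f\|_{\dot{\mathcal F}^{2,1}_\nu}=\int_{\mathbb R^d}|\xi|^2e^{\nu|\xi|}|\hat f(\xi)|\,d\xi\quad(\nu\ge 0),$$ and let $\dot{\mathcal F}^{0,2}$ be the space of real-valued functions $f$ on $\mathbb R^d$ with $\hat f\in L^2$, i.e. $L^2(\mathbb R^d)$ with its norm. Let $f_2(y)=\sum_{j\ge1}\frac{(j+1)^3}{j!}y^j=(y^3+6y^2+7y+1)e^y-1$, and let $y_*>0$ satisfy $f_2(y_*)\le 1$ (for example $y_*=52/500$; the largest admissible $y_*$ is the positive root of $f_2(y)=1$). For $T>0$, a *solution* on $[0,T]$ of $$\partial_t h=\Delta e^{-\Delta h}\quad\text{in }\mathbb R^d,\qquad h(0)=h_0,$$ is a function $h\in C^0([0,T];\dot{\mathcal F}^{0,2})$ with $h(0)=h_0$ and $\sup_{0\le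 t\le T}\|h(t)\|_2<\infty$ (so $\Delta h(t)$ is a bounded function) which satisfies the equation in the sense of distributions: for all $\varphi\in C_c^\infty(\mathbb R^d)$ and all $t\in[0,T]$, $$\int_{\mathbb R^d} h(t)\varphi\,dx-\int_{\mathbb R^d} h_0\varphi\,dx=\int_0^t\!\int_{\mathbb R^d}e^{-\Delta h(s)}\Delta\varphi\,dx\,ds .$$ There is a number $b=b(\|h_0\|_2)\in(0,1)$, depending (for fixed $d$) only on $\|h_0\|_2$, such that the following holds. For every $h_0\in\dot{\mathcal F}^{0,2}$ with $\|h_0\|_2<y_*$ there is a time $T>0$ for which there exists a unique solution $h$ on $[0,T]$ with initial datum $h_0$, and this solution gains analyticity: with $\nu(t)=bt$, $$\|h(t)\|_{\dot{\mathcal F}^{2,1}_{\nu(t)}}\le\|h_0\|_2\,e^{bT}\qquad\text{for all }t\in[0,T].$$ -/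

import Mathlib

open MeasureTheory FourierTransform InnerProductSpace
open scoped ENNReal ContDiff Laplacian

noncomputable section

namespace ExpPDE

/-- Euclidean space of dimension `d`. -/
abbrev Space (d : ℕ) : Type := EuclideanSpace ℝ (Fin d)

/-- The space of real valued functions whose Fourier transform is square integrable.  By
Plancherel this is the real space `L²(ℝᵈ)`, with the same norm. -/
abbrev F02 (d : ℕ) : Type := Lp ℝ 2 (volume : Measure (Space d))

/-- The unitary Fourier transform `f̂(ξ) = (2π)^(-d/2) ∫ f(x) exp(-i x·ξ) dx` on `L²`,
obtained from Mathlib's transform `𝓕 f (η) = ∫ f(x) exp(-2πi x·η) dx` by `η = ξ / (2π)`.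
It is defined up to null sets. -/
def hat {d : ℕ} (f : F02 d) (ξ : Space d) : ℂ :=
  (((2 * Real.pi) ^ (-(d : ℝ) / 2) : ℝ) : ℂ) *
    (𝓕 (Complex.ofRealCLM.compLp f) : Lp ℂ 2 (volume : Measure (Space d)))
      ((2 * Real.pi)⁻¹ • ξ)

/-- The norm with analytic weight,
`(∫ |ξ|^(s p) exp(p ν |ξ|) |f̂(ξ)|^p dξ)^(1/p)`, with values in `[0, ∞]`. -/
def analyticNorm {d : ℕ} (s p ν : ℝ) (f : F02 d) : ℝ≥0∞ :=
  (∫⁻ ξ : Space d, ENNReal.ofReal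
    (‖ξ‖ ^ (s * p) * Real.exp (p * ν * ‖ξ‖) * ‖hat f ξ‖ ^ p)) ^ (1 / p)

/-- The `s`-norm `‖f‖_s = ∫ |ξ|^s |f̂(ξ)| dξ`, with values in `[0, ∞]`. -/
def sNorm {d : ℕ} (s : ℝ) (f : F02 d) : ℝ≥0∞ :=
  ∫⁻ ξ : Space d, ENNReal.ofReal (‖ξ‖ ^ s * ‖hat f ξ‖)

/-- The function `f₂(y) = (y³ + 6y² + 7y + 1) e^y - 1 = ∑_{j ≥ 1} (j+1)³ y^j / j!`. -/
def fTwo (y : ℝ) : ℝ := (y ^ 3 + 6 * y ^ 2 + 7 * y + 1) * Real.exp y - 1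

/-- Test functions: smooth and compactly supported. -/
def IsTest {d : ℕ} (φ : Space d → ℝ) : Prop :=
  ContDiff ℝ ∞ φ ∧ HasCompactSupport φ

/-- `u` is the Laplacian of `f` in the sense of distributions. -/
def IsWeakLaplacian {d : ℕ} (f u : Space d → ℝ) : Prop :=
  LocallyIntegrable u volume ∧
    ∀ φ : Space d → ℝ, IsTest φ → ∫ x, f x * Δ φ x = ∫ x, u x * φ x

/-- `h` solves `∂ₜ h = Δ exp(-Δ h)` on `[0, T] × ℝᵈ` with `h(0) = h₀`: it is continuous in time
with values in `L²`, the norm `‖h(t)‖₂` stays bounded on `[0, T]` (so that `Δ h` is a bounded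
function and `exp(-Δ h)` makes sense), and the equation, integrated in time, holds in the sense
of distributions. -/
structure IsSolution {d : ℕ} (T : ℝ) (h₀ : F02 d) (h : ℝ → F02 d) : Prop where
  continuousOn : ContinuousOn h (Set.Icc 0 T)
  initial : h 0 = h₀
  bounded : ∃ M : ℝ, ∀ t ∈ Set.Icc 0 T, sNorm 2 (h t) ≤ ENNReal.ofReal M
  equation : ∃ u : ℝ → Space d → ℝ,
    (∀ t ∈ Set.Icc 0 T, IsWeakLaplacian (h t) (u t)) ∧
    ∀ φ : Space d → ℝ, IsTest φ →
      IntervalIntegrable (fun s => ∫ x, Real.exp (-(u s x)) * Δ φ x) volume 0 T ∧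
      ∀ t ∈ Set.Icc 0 T,
        (∫ x, h t x * φ x) - ∫ x, h₀ x * φ x =
          ∫ s in (0 : ℝ)..t, ∫ x, Real.exp (-(u s x)) * Δ φ x

end ExpPDE

end

/-!
Write `k = |ξ|² ĥ`, so that `-Δ h` is the inverse Fourier transform of `k` and `‖h‖₂` is, up to a
factor, the `L¹` norm of `k`. Products of functions are convolutions of their transforms, hence the
equation becomes `∂ₜ k = -|ξ|⁴ (k + N(k))` with `N(k) = ∑_{j ≥ 2} k^{*j} / j!`. The smallness
assumption `f₂(y_*) ≤ 1` forces `y_* ≤ 1/8`, and passing to the normalization of the Fourier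
transform used in Mathlib gains another factor `(2π)^(-d/2) ≤ 1/2`, so that the data have mass at
most `1/16`. With this much room, `b = 1/16` and `T = 1` work for all data.

*Existence.* In mild form the equation reads `k = e^{-t|ξ|⁴} k₀ - ∫₀ᵗ |ξ|⁴ e^{-(t-s)|ξ|⁴} N(k) ds`.
The Duhamel kernel has mass at most one in time at each frequency, and `N` has a small Lipschitz
constant for small `k`, so the right-hand side is a contraction on a ball of `L¹(ℝᵈ; C([0, 1]))`,
where `C([0, 1])` is regarded as a Banach algebra (`exists_mild_solution`). Bounds for the solution
come from comparing its Picard iterates with those of a majorant equation with positive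
coefficients, damped by `(3/4) |ξ|⁴`. The masses of the latter do not grow, because
`|x + y|⁴ ≤ 8 (|x|⁴ + |y|⁴)` bounds the fourth moment of `N(κ)` by `exp (8 ‖κ‖) - 1` times that of
`κ`, and the damping absorbs it (`lintegral_majorant_le`). The remaining quarter of the dissipation
pays for the submultiplicative weight `exp ((1 - t) / 16 + t |ξ| / 16)`, which gives analyticity
(`gevrey_mul_le`). The map `g ↦ ∫₀ᵗ |ξ|⁴ e^{-(t-s)|ξ|⁴} g(s) ds` is bounded on `L²` of time, and
Young's inequality `L¹ * L² ⊆ L²` bounds `N`; hence `k` is square integrable in time and frequency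
(`lintegral_sq_majorantLim_le`), and then `ĥ = k / |ξ|²` is dominated by a function in `L²`
uniformly in time (`sq_mild_solution_le`), which makes `h` continuous with values in `L²`. All
iterates are Hermitian, so `h` is real. Pairing with test functions gives the equation
(`exists_solution`).

*Uniqueness.* If `h` and `g` are solutions with bounded Laplacians `u` and `v`, the difference
`w = h - g` satisfies `∂ₜ w = Δ (e^{-u} - e^{-v})`, so formally
`d/dt ∫ w² = 2 ∫ (e^{-u} - e^{-v}) (u - v) ≤ 0`. As `w` is merely square integrable and
`e^{-u} - e^{-v}` merely bounded, the computation is made for mollifications and with an integrable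
weight whose derivatives are at most `κ` times the weight (`energy_le`). Since `exp` is strictly
monotone on bounded sets, the good sign dominates the quadratic errors of size `κ` in `u - v`
(`dissipation_nonpos`), and only an error of size `κ ‖w‖²` is left. Removing the mollification and
then letting `κ` tend to zero gives `w = 0` (`eq_of_laplacianCurve`).
-/

noncomputable section

namespace ExpPDE

open Set Filter Topology

/-! ### Convolution powers of nonnegative functions -/

section

lemma ennreal_add_sq_le (a b : ℝ≥0∞) : (a + b) ^ 2 ≤ 2 * (a ^ 2 + b ^ 2) := by
  have := ENNReal.rpow_add_le_mul_rpow_add_rpow a b (p := 2) (by norm_num)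
  norm_num at this
  exact_mod_cast this

/-- Cauchy–Schwarz for lower integrals. -/
lemma sq_lintegral_mul_le {α : Type*} [MeasurableSpace α] (μ : Measure α) {f g : α → ℝ≥0∞}
    (hf : AEMeasurable f μ) (hg : AEMeasurable g μ) :
    (∫⁻ a, f a * g a ∂μ) ^ 2 ≤ (∫⁻ a, f a ^ 2 ∂μ) * ∫⁻ a, g a ^ 2 ∂μ := by
  have h := ENNReal.lintegral_mul_le_Lp_mul_Lq μ Real.HolderConjugate.two_two hf hg
  have key : ∀ x : ℝ≥0∞, (x ^ (1 / (2 : ℝ))) ^ 2 = x := fun x => by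
    rw [← ENNReal.rpow_natCast, ← ENNReal.rpow_mul]; norm_num
  calc (∫⁻ a, f a * g a ∂μ) ^ 2
      ≤ ((∫⁻ a, f a ^ (2 : ℝ) ∂μ) ^ (1 / (2 : ℝ)) * (∫⁻ a, g a ^ (2 : ℝ) ∂μ) ^ (1 / (2 : ℝ))) ^ 2 :=
        pow_le_pow_left₀ zero_le h 2
    _ = _ := by
        rw [mul_pow, key, key]
        norm_cast

/-- Cauchy–Schwarz with respect to the measure of density `f`. -/
lemma sq_lintegral_mul_le_weighted {α : Type*} [MeasurableSpace α] (μ : Measure α)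
    {f g : α → ℝ≥0∞} (hf : Measurable f) (hg : Measurable g) :
    (∫⁻ a, f a * g a ∂μ) ^ 2 ≤ (∫⁻ a, f a ∂μ) * ∫⁻ a, f a * g a ^ 2 ∂μ := by
  have h := sq_lintegral_mul_le (μ.withDensity f) (f := fun _ => 1) (g := g) (by fun_prop)
    hg.aemeasurable
  simp only [one_mul, one_pow] at h
  rwa [lintegral_withDensity_eq_lintegral_mul _ hf hg,
    lintegral_withDensity_eq_lintegral_mul _ hf measurable_const,
    lintegral_withDensity_eq_lintegral_mul _ hf (hg.pow_const 2),
    show (f * fun _ => (1 : ℝ≥0∞)) = f by ext; simp] at h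

variable {d : ℕ}

lemma lconvolution_mono {f f' g g' : Space d → ℝ≥0∞} (hf : f ≤ f') (hg : g ≤ g') :
    f ⋆ₗ g ≤ f' ⋆ₗ g' :=
  fun _ => lintegral_mono fun _ => mul_le_mul' (hf _) (hg _)

lemma measurable_lconvolution_param {P : Type*} [MeasurableSpace P] {f g : P → Space d → ℝ≥0∞}
    (hf : Measurable (Function.uncurry f)) (hg : Measurable (Function.uncurry g)) :
    Measurable (Function.uncurry fun p => f p ⋆ₗ g p) := by
  refine Measurable.lintegral_prod_right'
    (f := fun q : (P × Space d) × Space d => f q.1.1 q.2 * g q.1.1 (-q.2 + q.1.2)) ?_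
  exact (hf.comp (by fun_prop : Measurable fun q : (P × Space d) × Space d => (q.1.1, q.2))).mul
    (hg.comp (by fun_prop : Measurable fun q : (P × Space d) × Space d => (q.1.1, -q.2 + q.1.2)))

/-- A subadditivity property of a weight turns into a bound for the weighted integral of a
convolution. -/
lemma lintegral_weight_mul_lconvolution_le {f g W : Space d → ℝ≥0∞} (hf : Measurable f)
    (hg : Measurable g) (hW : Measurable W) {C : ℝ≥0∞}
    (hsub : ∀ x y, W (x + y) ≤ C * (W x + W y)) :
    ∫⁻ x, W x * (f ⋆ₗ g) x ≤
      C * ((∫⁻ x, W x * f x) * (∫⁻ x, g x) + (∫⁻ x, f x) * ∫⁻ x, W x * g x) := by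
  have h1 : ∀ x, W x * (f ⋆ₗ g) x = ∫⁻ y, W x * (f y * g (-y + x)) := fun x => by
    rw [lconvolution_def, lintegral_const_mul _ (by fun_prop)]
  simp_rw [h1]
  rw [lintegral_lintegral_swap (by fun_prop)]
  have h2 : ∀ y, ∫⁻ x, W x * (f y * g (-y + x)) = ∫⁻ x, W (y + x) * (f y * g x) := fun y => by
    rw [← lintegral_add_left_eq_self _ y]; simp
  simp_rw [h2]
  calc ∫⁻ y, ∫⁻ x, W (y + x) * (f y * g x)
      ≤ ∫⁻ y, ∫⁻ x, C * ((W y * f y) * g x + f y * (W x * g x)) := by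
        refine lintegral_mono fun y => lintegral_mono fun x => ?_
        calc W (y + x) * (f y * g x) ≤ C * (W y + W x) * (f y * g x) := by gcongr; exact hsub _ _
          _ = _ := by ring
    _ = ∫⁻ y, C * ((W y * f y) * (∫⁻ x, g x) + f y * ∫⁻ x, W x * g x) := by
        refine lintegral_congr fun y => ?_
        rw [lintegral_const_mul _ (by fun_prop), lintegral_add_left (by fun_prop),
          lintegral_const_mul _ (by fun_prop), lintegral_const_mul _ (by fun_prop)]
    _ = _ := by
        rw [lintegral_const_mul _ (by fun_prop), lintegral_add_left (by fun_prop),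
          lintegral_mul_const _ (by fun_prop), lintegral_mul_const _ (by fun_prop)]

lemma lintegral_lconvolution {f g : Space d → ℝ≥0∞} (hf : Measurable f) (hg : Measurable g) :
    ∫⁻ x, (f ⋆ₗ g) x = (∫⁻ x, f x) * ∫⁻ x, g x := by
  simp_rw [lconvolution_def]
  rw [lintegral_lintegral_swap (by fun_prop)]
  have h2 : ∀ y, ∫⁻ x, f y * g (-y + x) = f y * ∫⁻ x, g x := fun y => by
    rw [lintegral_const_mul _ (by fun_prop), lintegral_add_left_eq_self g (-y)]
  simp_rw [h2]
  rw [lintegral_mul_const _ hf]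

/-- Young's inequality `L¹ * L² ⊆ L²`. -/
lemma lintegral_lconvolution_sq_le {f g : Space d → ℝ≥0∞} (hf : Measurable f)
    (hg : Measurable g) :
    ∫⁻ x, (f ⋆ₗ g) x ^ 2 ≤ (∫⁻ x, f x) ^ 2 * ∫⁻ x, g x ^ 2 := by
  calc ∫⁻ x, (f ⋆ₗ g) x ^ 2
      ≤ ∫⁻ x, (∫⁻ y, f y) * (f ⋆ₗ fun z => g z ^ 2) x :=
        lintegral_mono fun x => sq_lintegral_mul_le_weighted _ hf (by fun_prop)
    _ = _ := by
        rw [lintegral_const_mul _ (measurable_lconvolution _ hf (by fun_prop)),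
          lintegral_lconvolution hf (by fun_prop), sq, mul_assoc]

/-- A submultiplicative weight may be distributed over a convolution. -/
lemma weight_mul_lconvolution_le {f g W : Space d → ℝ≥0∞} (hf : Measurable f) (hg : Measurable g)
    (hsub : ∀ x y, W (x + y) ≤ W x * W y) (x : Space d) :
    W x * (f ⋆ₗ g) x ≤ ((fun y => W y * f y) ⋆ₗ fun y => W y * g y) x := by
  rw [lconvolution_def, lconvolution_def, ← lintegral_const_mul _ (by fun_prop)]
  refine lintegral_mono fun y => ?_
  have := hsub y (-y + x)
  rw [add_neg_cancel_left] at this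
  calc W x * (f y * g (-y + x)) ≤ W y * W (-y + x) * (f y * g (-y + x)) := by gcongr
    _ = _ := by ring

/-- The `(n + 1)`-fold convolution of `f` with itself. -/
def lconvPow (f : Space d → ℝ≥0∞) : ℕ → Space d → ℝ≥0∞
  | 0 => f
  | n + 1 => f ⋆ₗ lconvPow f n

/-- The convolution exponential without its terms of degree `0` and `1`,
`∑_{j ≥ 2} f^{*j} / j!`. -/
def lexpTail (f : Space d → ℝ≥0∞) (x : Space d) : ℝ≥0∞ :=
  ∑' n : ℕ, ((n + 2).factorial : ℝ≥0∞)⁻¹ * lconvPow f (n + 1) x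

lemma measurable_lconvPow_param {P : Type*} [MeasurableSpace P] {f : P → Space d → ℝ≥0∞}
    (hf : Measurable (Function.uncurry f)) (n : ℕ) :
    Measurable (Function.uncurry fun p => lconvPow (f p) n) := by
  induction n with
  | zero => exact hf
  | succ n ih => exact measurable_lconvolution_param hf ih

@[fun_prop]
lemma measurable_lconvPow {f : Space d → ℝ≥0∞} (hf : Measurable f) (n : ℕ) :
    Measurable (lconvPow f n) := by
  induction n with
  | zero => exact hf
  | succ n ih => exact measurable_lconvolution _ hf ih

lemma measurable_lexpTail_param {P : Type*} [MeasurableSpace P] {f : P → Space d → ℝ≥0∞}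
    (hf : Measurable (Function.uncurry f)) :
    Measurable (Function.uncurry fun p => lexpTail (f p)) :=
  Measurable.tsum (fun n => (measurable_lconvPow_param hf (n + 1)).const_mul _)

lemma lconvPow_mono {f g : Space d → ℝ≥0∞} (h : f ≤ g) (n : ℕ) : lconvPow f n ≤ lconvPow g n := by
  induction n with
  | zero => exact h
  | succ n ih => exact lconvolution_mono h ih

lemma lexpTail_mono {f g : Space d → ℝ≥0∞} (h : f ≤ g) : lexpTail f ≤ lexpTail g := fun x =>
  ENNReal.tsum_le_tsum fun n => mul_le_mul_right (lconvPow_mono h (n + 1) x) _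

lemma quasiMeasurePreserving_neg_add (x : Space d) :
    Measure.QuasiMeasurePreserving (fun y : Space d => -y + x) volume volume :=
  ((measurePreserving_add_right volume x).comp
    (Measure.measurePreserving_neg volume)).quasiMeasurePreserving

lemma lconvPow_mono_ae {f g : Space d → ℝ≥0∞} (h : ∀ᵐ x, f x ≤ g x) (n : ℕ) :
    ∀ᵐ x, lconvPow f n x ≤ lconvPow g n x := by
  induction n with
  | zero => exact h
  | succ n ih =>
    refine Eventually.of_forall fun x => lintegral_mono_ae ?_
    filter_upwards [h, (quasiMeasurePreserving_neg_add x).ae ih] with y hy hy2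
    exact mul_le_mul' hy hy2

/-- The terms of degree at least two are integrals, so that the inequality holds everywhere. -/
lemma lexpTail_mono_ae {f g : Space d → ℝ≥0∞} (h : ∀ᵐ x, f x ≤ g x) (x : Space d) :
    lexpTail f x ≤ lexpTail g x := by
  refine ENNReal.tsum_le_tsum fun n => mul_le_mul_right ?_ _
  refine lintegral_mono_ae ?_
  filter_upwards [h, (quasiMeasurePreserving_neg_add x).ae (lconvPow_mono_ae h n)] with y hy hy2
  exact mul_le_mul' hy hy2

lemma lintegral_lconvPow {f : Space d → ℝ≥0∞} (hf : Measurable f) (n : ℕ) :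
    ∫⁻ x, lconvPow f n x = (∫⁻ x, f x) ^ (n + 1) := by
  induction n with
  | zero => simp [lconvPow]
  | succ n ih =>
    rw [lconvPow, lintegral_lconvolution hf (measurable_lconvPow hf n), ih, ← pow_succ']

lemma weight_mul_lconvPow_le {f W : Space d → ℝ≥0∞} (hf : Measurable f)
    (hsub : ∀ x y, W (x + y) ≤ W x * W y) (n : ℕ) (x : Space d) :
    W x * lconvPow f n x ≤ lconvPow (fun y => W y * f y) n x := by
  induction n generalizing x with
  | zero => exact le_rfl
  | succ n ih =>
    refine (weight_mul_lconvolution_le hf (measurable_lconvPow hf n) hsub x).trans ?_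
    exact lconvolution_mono le_rfl (fun y => ih y) x

lemma weight_mul_lexpTail_le {f W : Space d → ℝ≥0∞} (hf : Measurable f)
    (hsub : ∀ x y, W (x + y) ≤ W x * W y) (x : Space d) :
    W x * lexpTail f x ≤ lexpTail (fun y => W y * f y) x := by
  rw [lexpTail, ← ENNReal.tsum_mul_left]
  refine ENNReal.tsum_le_tsum fun n => ?_
  rw [mul_left_comm]
  exact mul_le_mul_right (weight_mul_lconvPow_le hf hsub _ x) _

/-- The bound `|x + y|⁴ ≤ 8 (|x|⁴ + |y|⁴)` costs a factor `8` for each convolution. -/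
lemma lintegral_weight_mul_lconvPow_le {f W : Space d → ℝ≥0∞} (hf : Measurable f)
    (hW : Measurable W) (hsub : ∀ x y, W (x + y) ≤ 8 * (W x + W y)) (n : ℕ) :
    ∫⁻ x, W x * lconvPow f n x ≤
      (n + 1) * (8 * ∫⁻ x, f x) ^ n * ∫⁻ x, W x * f x := by
  induction n with
  | zero => simp [lconvPow]
  | succ n ih =>
    refine (lintegral_weight_mul_lconvolution_le hf (measurable_lconvPow hf n) hW hsub).trans ?_
    rw [lintegral_lconvPow hf]
    set a := ∫⁻ x, W x * f x
    set y := ∫⁻ x, f x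
    calc 8 * (a * y ^ (n + 1) + y * ∫⁻ x, W x * lconvPow f n x)
        ≤ 8 * (8 ^ n * (a * y ^ (n + 1)) + y * ((n + 1) * (8 * y) ^ n * a)) := by
          refine mul_le_mul_right (add_le_add ?_ (mul_le_mul_right ih _)) _
          exact le_mul_of_one_le_left zero_le (one_le_pow₀ (by norm_num))
      _ = _ := by push_cast; ring

lemma tsum_factorial_eq (y : ℝ) (hy : 0 ≤ y) :
    ∑' n : ℕ, ((n + 1).factorial : ℝ≥0∞)⁻¹ * ENNReal.ofReal y ^ (n + 1) =
      ENNReal.ofReal (Real.exp y - 1) := by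
  have hs : Summable fun n : ℕ => y ^ (n + 1) / ((n + 1).factorial : ℝ) :=
    (summable_nat_add_iff 1).2 (Real.summable_pow_div_factorial y)
  have h1 : Real.exp y - 1 = ∑' n : ℕ, y ^ (n + 1) / ((n + 1).factorial : ℝ) := by
    rw [Real.exp_eq_exp_ℝ, NormedSpace.exp_eq_tsum_div]
    beta_reduce
    rw [(Real.summable_pow_div_factorial y).tsum_eq_zero_add]
    simp
  rw [h1, ENNReal.ofReal_tsum_of_nonneg (fun n => by positivity) hs]
  refine tsum_congr fun n => ?_
  rw [ENNReal.ofReal_div_of_pos (by positivity), ENNReal.ofReal_pow hy, ENNReal.ofReal_natCast,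
    div_eq_mul_inv, mul_comm]

/-- The gain of the nonlinear estimate: the weight of order four is absorbed by the smallness of
the mass of `f`. -/
lemma lintegral_weight_mul_lexpTail_le {f W : Space d → ℝ≥0∞} (hf : Measurable f)
    (hW : Measurable W) (hsub : ∀ x y, W (x + y) ≤ 8 * (W x + W y)) {y : ℝ} (hy : 0 ≤ y)
    (hfy : ∫⁻ x, f x ≤ ENNReal.ofReal y) :
    ∫⁻ x, W x * lexpTail f x ≤
      ENNReal.ofReal (Real.exp (8 * y) - 1) * ∫⁻ x, W x * f x := by
  have h1 : ∀ x, W x * lexpTail f x =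
      ∑' n : ℕ, ((n + 2).factorial : ℝ≥0∞)⁻¹ * (W x * lconvPow f (n + 1) x) := fun x => by
    rw [lexpTail, ← ENNReal.tsum_mul_left]
    exact tsum_congr fun n => by ring
  simp_rw [h1]
  rw [lintegral_tsum fun n => by fun_prop, ← tsum_factorial_eq _ (by positivity),
    ← ENNReal.tsum_mul_right]
  refine ENNReal.tsum_le_tsum fun n => ?_
  rw [lintegral_const_mul _ (by fun_prop)]
  calc ((n + 2).factorial : ℝ≥0∞)⁻¹ * ∫⁻ x, W x * lconvPow f (n + 1) x
      ≤ ((n + 2).factorial : ℝ≥0∞)⁻¹ *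
        (((n + 1 : ℕ) + 1) * (8 * ∫⁻ x, f x) ^ (n + 1) * ∫⁻ x, W x * f x) := by
        gcongr; exact lintegral_weight_mul_lconvPow_le hf hW hsub _
    _ ≤ ((n + 2).factorial : ℝ≥0∞)⁻¹ *
        (((n + 1 : ℕ) + 1) * ENNReal.ofReal (8 * y) ^ (n + 1) * ∫⁻ x, W x * f x) := by
        gcongr
        rw [ENNReal.ofReal_mul (by norm_num)]
        gcongr
        norm_num
    _ = _ := by
        have : ((n + 2).factorial : ℝ≥0∞)⁻¹ * (((n + 1 : ℕ) : ℝ≥0∞) + 1) =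
            ((n + 1).factorial : ℝ≥0∞)⁻¹ := by
          rw [Nat.factorial_succ (n + 1)]
          push_cast
          rw [ENNReal.mul_inv (Or.inl (by positivity)) (Or.inl (by finiteness)), mul_right_comm,
            show ((n : ℝ≥0∞) + 1 + 1)⁻¹ * ((n : ℝ≥0∞) + 1 + 1) = 1 from
              ENNReal.inv_mul_cancel (by positivity) (by finiteness), one_mul]
        rw [← this]
        ring

/-- The nonlinearity maps `L²` to itself, with a small constant if `f` has small mass. -/
lemma lintegral_lexpTail_sq_le {f : Space d → ℝ≥0∞} (hf : Measurable f) {y : ℝ} (hy : 0 ≤ y)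
    (hfy : ∫⁻ x, f x ≤ ENNReal.ofReal y) :
    ∫⁻ x, lexpTail f x ^ 2 ≤
      ENNReal.ofReal (Real.exp y - 1) ^ 2 * ∫⁻ x, f x ^ 2 := by
  set g : Space d → ℝ≥0∞ := fun x => ∑' n : ℕ, ((n + 2).factorial : ℝ≥0∞)⁻¹ * lconvPow f n x
    with hg
  have hgm : Measurable g := Measurable.tsum fun n => by fun_prop
  have h1 : lexpTail f = g ⋆ₗ f := by
    rw [lconvolution_comm]
    ext x
    simp only [lexpTail, hg, lconvPow, lconvolution_def]
    simp_rw [← ENNReal.tsum_mul_left]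
    rw [lintegral_tsum fun n => by fun_prop]
    refine tsum_congr fun n => ?_
    rw [← lintegral_const_mul _ (by fun_prop)]
    exact lintegral_congr fun y => by ring
  have h2 : ∫⁻ x, g x ≤ ENNReal.ofReal (Real.exp y - 1) := by
    rw [hg, lintegral_tsum fun n => by fun_prop, ← tsum_factorial_eq _ hy]
    refine ENNReal.tsum_le_tsum fun n => ?_
    rw [lintegral_const_mul _ (by fun_prop), lintegral_lconvPow hf]
    gcongr
    simp
  rw [h1]
  refine (lintegral_lconvolution_sq_le hgm hf).trans ?_
  gcongr

end

/-! ### A monotone majorant for the Picard iteration -/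

section

variable {d : ℕ}

/-- The length `|ξ|` of the unitary frequency `ξ = 2π η`, as a function of the frequency `η` of
Mathlib's Fourier transform. -/
def freq (η : Space d) : ℝ := 2 * Real.pi * ‖η‖

lemma freq_nonneg (η : Space d) : 0 ≤ freq η := by unfold freq; positivity

lemma freq_add_le (x y : Space d) : freq (x + y) ≤ freq x + freq y := by
  unfold freq
  nlinarith [norm_add_le x y, Real.pi_pos]

lemma freq_neg (x : Space d) : freq (-x) = freq x := by simp [freq]

@[fun_prop]
lemma continuous_freq : Continuous (freq : Space d → ℝ) := by unfold freq; fun_prop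

/-- The symbol `|ξ|⁴` of the squared Laplacian. -/
def quartic (η : Space d) : ℝ≥0∞ := ENNReal.ofReal (freq η ^ 4)

@[fun_prop]
lemma measurable_quartic : Measurable (quartic : Space d → ℝ≥0∞) := by
  unfold quartic
  exact ((continuous_freq.pow 4).measurable).ennreal_ofReal

lemma quartic_add_le (x y : Space d) : quartic (x + y) ≤ 8 * (quartic x + quartic y) := by
  unfold quartic
  rw [← ENNReal.ofReal_add (by positivity) (by positivity),
    show (8 : ℝ≥0∞) = ENNReal.ofReal 8 by norm_num, ← ENNReal.ofReal_mul (by norm_num)]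
  refine ENNReal.ofReal_le_ofReal ?_
  calc freq (x + y) ^ 4 ≤ (freq x + freq y) ^ 4 :=
        pow_le_pow_left₀ (freq_nonneg _) (freq_add_le x y) 4
    _ ≤ _ := by
        have := add_pow_le (freq_nonneg x) (freq_nonneg y) 4
        norm_num at this
        linarith

lemma measurable_expKernel (q : ℝ) :
    Measurable fun p : ℝ × ℝ => ENNReal.ofReal (Real.exp (-(q * (p.1 - p.2)))) := by
  fun_prop

/-- The mass of the exponential kernel, as a function of the later time. -/
lemma mul_lintegral_expKernel (q : ℝ) (hq : 0 ≤ q) {r t : ℝ} (h : r ≤ t) :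
    ENNReal.ofReal q * ∫⁻ s in Icc r t, ENNReal.ofReal (Real.exp (-(q * (s - r)))) =
      ENNReal.ofReal (1 - Real.exp (-(q * (t - r)))) := by
  have hc : Continuous fun s => Real.exp (-(q * (s - r))) := by fun_prop
  rw [← ofReal_integral_eq_lintegral_ofReal (hc.integrableOn_Icc)
    (Eventually.of_forall fun _ => (Real.exp_pos _).le), ← ENNReal.ofReal_mul hq,
    integral_Icc_eq_integral_Ioc, ← intervalIntegral.integral_of_le h,
    ← intervalIntegral.integral_const_mul]
  congr 1
  rw [intervalIntegral.integral_eq_sub_of_hasDerivAt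
    (f := fun s => -Real.exp (-(q * (s - r)))) (fun s _ => ?_) (by
      apply Continuous.intervalIntegrable; fun_prop)]
  · simp; ring
  · have : HasDerivAt (fun s => -(q * (s - r))) (-(q * 1)) s :=
      (((hasDerivAt_id s).sub_const r).const_mul q).neg
    convert! this.exp.neg using 1
    ring

/-- The mass of the exponential kernel, as a function of the earlier time. -/
lemma mul_lintegral_expKernel_le_one (q : ℝ) (hq : 0 ≤ q) (t : ℝ) : ENNReal.ofReal q *
    ∫⁻ s in Ioc 0 t, ENNReal.ofReal (Real.exp (-(q * (t - s)))) ≤ 1 := by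
  rcases le_total t 0 with h | h
  · simp [Ioc_eq_empty (not_lt.2 h)]
  · have h0 : ENNReal.ofReal (1 - Real.exp (-(q * (t - 0)))) ≤ 1 :=
      ENNReal.ofReal_le_one.2 (by linarith [Real.exp_pos (-(q * (t - 0)))])
    refine le_of_eq_of_le ?_ ((mul_lintegral_expKernel q hq h).trans_le h0)
    congr 1
    rw [restrict_Ioc_eq_restrict_Icc, ← ofReal_integral_eq_lintegral_ofReal,
      ← ofReal_integral_eq_lintegral_ofReal]
    · congr 1
      rw [integral_Icc_eq_integral_Ioc, integral_Icc_eq_integral_Ioc,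
        ← intervalIntegral.integral_of_le h, ← intervalIntegral.integral_of_le h,
        intervalIntegral.integral_comp_sub_left (fun x => Real.exp (-(q * x)))]
      simp
    · exact Continuous.integrableOn_Icc (by fun_prop)
    · exact Eventually.of_forall fun _ => (Real.exp_pos _).le
    · exact Continuous.integrableOn_Icc (by fun_prop)
    · exact Eventually.of_forall fun _ => (Real.exp_pos _).le

/-- Swapping the order of integration over a triangle. -/
lemma lintegral_triangle_swap {F : ℝ → ℝ → ℝ≥0∞} (hF : Measurable (Function.uncurry F)) (t : ℝ) :
    ∫⁻ s in Ioc 0 t, ∫⁻ r in Ioc 0 s, F s r = ∫⁻ r in Ioc 0 t, ∫⁻ s in Icc r t, F s r := by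
  have h1 : ∀ s ∈ Ioc 0 t, ∫⁻ r in Ioc 0 s, F s r =
      ∫⁻ r in Ioc 0 t, {p : ℝ × ℝ | p.2 ≤ p.1}.indicator (Function.uncurry F) (s, r) := by
    intro s hs
    have : (fun r => {p : ℝ × ℝ | p.2 ≤ p.1}.indicator (Function.uncurry F) (s, r)) =
        (Iic s).indicator (F s) := by
      ext r; simp [indicator, Function.uncurry]
    rw [this, lintegral_indicator measurableSet_Iic, Measure.restrict_restrict measurableSet_Iic,
      inter_comm, Ioc_inter_Iic, min_eq_right hs.2]
  have h2 : ∀ r ∈ Ioc 0 t, ∫⁻ s in Icc r t, F s r =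
      ∫⁻ s in Ioc 0 t, {p : ℝ × ℝ | p.2 ≤ p.1}.indicator (Function.uncurry F) (s, r) := by
    intro r hr
    have : (fun s => {p : ℝ × ℝ | p.2 ≤ p.1}.indicator (Function.uncurry F) (s, r)) =
        (Ici r).indicator (fun s => F s r) := by
      ext s; simp [indicator, Function.uncurry]
    rw [this, lintegral_indicator measurableSet_Ici, Measure.restrict_restrict measurableSet_Ici]
    congr 2
    ext s
    simp only [mem_Icc, mem_inter_iff, mem_Ici, mem_Ioc]
    exact ⟨fun h => ⟨h.1, hr.1.trans_le h.1, h.2⟩, fun h => ⟨h.1, h.2.2⟩⟩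
  rw [setLIntegral_congr_fun measurableSet_Ioc h1, setLIntegral_congr_fun measurableSet_Ioc h2,
    lintegral_lintegral_swap]
  exact (hF.indicator (measurableSet_le measurable_snd measurable_fst)).aemeasurable

/-- The integrated form of `R' = -q R + g`, `R(0) = a`, for the solution given by Duhamel's
formula. -/
lemma duhamel_add_integral_le (q : ℝ) (hq : 0 ≤ q) (a : ℝ≥0∞) {g : ℝ → ℝ≥0∞} (hg : Measurable g)
    {t : ℝ} (ht : 0 ≤ t) {R : ℝ → ℝ≥0∞}
    (hR : ∀ t, R t = ENNReal.ofReal (Real.exp (-(q * t))) * a +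
      ∫⁻ s in Ioc 0 t, ENNReal.ofReal (Real.exp (-(q * (t - s)))) * g s) :
    R t + ENNReal.ofReal q * ∫⁻ s in Ioc 0 t, R s ≤ a + ∫⁻ s in Ioc 0 t, g s := by
  have hF : Measurable (Function.uncurry fun s r : ℝ =>
      ENNReal.ofReal (Real.exp (-(q * (s - r)))) * g r) :=
    (measurable_expKernel q).mul (hg.comp measurable_snd)
  have e1 : ENNReal.ofReal q * ∫⁻ s in Ioc 0 t, R s =
      ENNReal.ofReal (1 - Real.exp (-(q * t))) * a +
        ∫⁻ r in Ioc 0 t, ENNReal.ofReal (1 - Real.exp (-(q * (t - r)))) * g r := by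
    simp_rw [hR]
    rw [lintegral_add_left (by fun_prop), mul_add, lintegral_mul_const _ (by fun_prop),
      lintegral_triangle_swap hF, ← lintegral_const_mul' _ _ ENNReal.ofReal_ne_top]
    congr 1
    · rw [← mul_assoc, restrict_Ioc_eq_restrict_Icc]
      have := mul_lintegral_expKernel q hq ht
      simp only [sub_zero] at this
      rw [this]
    · refine setLIntegral_congr_fun measurableSet_Ioc fun r hr => ?_
      rw [lintegral_mul_const _ (by fun_prop), ← mul_assoc, mul_lintegral_expKernel q hq hr.2]
  rw [e1, hR, add_add_add_comm, ← add_mul, ← lintegral_add_left (by fun_prop)]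
  have e2 : ∀ x : ℝ, 0 ≤ x → ENNReal.ofReal (Real.exp (-(q * x))) +
      ENNReal.ofReal (1 - Real.exp (-(q * x))) = 1 := fun x hx => by
    rw [← ENNReal.ofReal_add (Real.exp_pos _).le]
    · simp
    · simp only [sub_nonneg, Real.exp_le_one_iff]
      nlinarith [mul_nonneg hq hx]
  rw [e2 t ht, one_mul]
  gcongr 1
  refine setLIntegral_mono hg fun r hr => ?_
  rw [← add_mul, e2 _ (by linarith [hr.2]), one_mul]

/-- Convolution in time with an exponential kernel of mass at most one is bounded on `L²`. -/
lemma lintegral_sq_expKernel_le (q : ℝ) (hq : 0 ≤ q) {g : ℝ → ℝ≥0∞} (hg : Measurable g) (T : ℝ) :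
    ∫⁻ t in Ioc 0 T, (ENNReal.ofReal q *
        ∫⁻ s in Ioc 0 t, ENNReal.ofReal (Real.exp (-(q * (t - s)))) * g s) ^ 2 ≤
      ∫⁻ s in Ioc 0 T, g s ^ 2 := by
  have hmass : ∀ r t : ℝ, r ≤ t → ENNReal.ofReal q *
      ∫⁻ s in Icc r t, ENNReal.ofReal (Real.exp (-(q * (s - r)))) ≤ 1 := fun r t h => by
    rw [mul_lintegral_expKernel q hq h]
    exact ENNReal.ofReal_le_one.2 (by linarith [Real.exp_pos (-(q * (t - r)))])
  have hF : Measurable (Function.uncurry fun s r : ℝ =>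
      ENNReal.ofReal (Real.exp (-(q * (s - r)))) * g r ^ 2) :=
    (measurable_expKernel q).mul ((hg.comp measurable_snd).pow_const 2)
  calc ∫⁻ t in Ioc 0 T, (ENNReal.ofReal q *
        ∫⁻ s in Ioc 0 t, ENNReal.ofReal (Real.exp (-(q * (t - s)))) * g s) ^ 2
      ≤ ∫⁻ t in Ioc 0 T, ENNReal.ofReal q *
          ∫⁻ s in Ioc 0 t, ENNReal.ofReal (Real.exp (-(q * (t - s)))) * g s ^ 2 := by
        refine lintegral_mono fun t => ?_
        rw [mul_pow]
        calc _ ≤ ENNReal.ofReal q ^ 2 *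
              ((∫⁻ s in Ioc 0 t, ENNReal.ofReal (Real.exp (-(q * (t - s))))) *
                ∫⁻ s in Ioc 0 t, ENNReal.ofReal (Real.exp (-(q * (t - s)))) * g s ^ 2) := by
              gcongr
              exact sq_lintegral_mul_le_weighted _ (by fun_prop) hg
          _ = (ENNReal.ofReal q *
              ∫⁻ s in Ioc 0 t, ENNReal.ofReal (Real.exp (-(q * (t - s))))) * (ENNReal.ofReal q *
                ∫⁻ s in Ioc 0 t, ENNReal.ofReal (Real.exp (-(q * (t - s)))) * g s ^ 2) := by ring
          _ ≤ 1 * (ENNReal.ofReal q *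
                ∫⁻ s in Ioc 0 t, ENNReal.ofReal (Real.exp (-(q * (t - s)))) * g s ^ 2) := by
              gcongr
              exact mul_lintegral_expKernel_le_one q hq t
          _ = _ := one_mul _
    _ = ∫⁻ r in Ioc 0 T, (ENNReal.ofReal q *
          ∫⁻ s in Icc r T, ENNReal.ofReal (Real.exp (-(q * (s - r))))) * g r ^ 2 := by
        rw [lintegral_const_mul' _ _ ENNReal.ofReal_ne_top, lintegral_triangle_swap hF,
          ← lintegral_const_mul' _ _ ENNReal.ofReal_ne_top]
        refine lintegral_congr fun r => ?_
        rw [lintegral_mul_const _ (by fun_prop), mul_assoc]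
    _ ≤ ∫⁻ r in Ioc 0 T, g r ^ 2 := by
        refine setLIntegral_mono (by fun_prop) fun r hr => ?_
        exact mul_le_of_le_one_left zero_le (hmass r T hr.2)

/-- The Picard iteration, started at zero, for the equation
`∂ₜ κ = -(3/4) |ξ|⁴ κ + |ξ|⁴ (exp_* κ - 1 - κ)`, `κ(0) = a`, which has positive coefficients. -/
def majorant (a : Space d → ℝ≥0∞) : ℕ → ℝ → Space d → ℝ≥0∞
  | 0 => fun _ _ => 0
  | n + 1 => fun t η => ENNReal.ofReal (Real.exp (-(3 / 4 * freq η ^ 4 * t))) * a η +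
      ∫⁻ s in Ioc 0 t, ENNReal.ofReal (Real.exp (-(3 / 4 * freq η ^ 4 * (t - s)))) *
        (quartic η * lexpTail (majorant a n s) η)

variable {a : Space d → ℝ≥0∞}

lemma measurable_majorant (ha : Measurable a) (n : ℕ) :
    Measurable (Function.uncurry (majorant a n)) := by
  induction n with
  | zero => exact measurable_const
  | succ n ih =>
    refine Measurable.add ?_ ?_
    · exact (by fun_prop : Measurable fun p : ℝ × Space d =>
        ENNReal.ofReal (Real.exp (-(3 / 4 * freq p.2 ^ 4 * p.1)))).mul (ha.comp measurable_snd)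
    · have h1 : ∀ p : ℝ × Space d, ∫⁻ s in Ioc 0 p.1,
          ENNReal.ofReal (Real.exp (-(3 / 4 * freq p.2 ^ 4 * (p.1 - s)))) *
            (quartic p.2 * lexpTail (majorant a n s) p.2) =
          ∫⁻ s, {q : (ℝ × Space d) × ℝ | 0 < q.2 ∧ q.2 ≤ q.1.1}.indicator
            (fun q => ENNReal.ofReal (Real.exp (-(3 / 4 * freq q.1.2 ^ 4 * (q.1.1 - q.2)))) *
              (quartic q.1.2 * lexpTail (majorant a n q.2) q.1.2)) (p, s) := fun p => by
        rw [← lintegral_indicator measurableSet_Ioc]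
        rfl
      change Measurable fun p : ℝ × Space d => ∫⁻ s in Ioc 0 p.1,
          ENNReal.ofReal (Real.exp (-(3 / 4 * freq p.2 ^ 4 * (p.1 - s)))) *
            (quartic p.2 * lexpTail (majorant a n s) p.2)
      simp_rw [h1]
      refine Measurable.lintegral_prod_right' (Measurable.indicator ?_ ?_)
      · have h2 : Measurable fun q : (ℝ × Space d) × ℝ =>
            lexpTail (majorant a n q.2) q.1.2 :=
          (measurable_lexpTail_param ih).comp
            (by fun_prop : Measurable fun q : (ℝ × Space d) × ℝ => (q.2, q.1.2))
        fun_prop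
      · exact (measurableSet_lt measurable_const measurable_snd).inter
          (measurableSet_le measurable_snd (by fun_prop))

lemma measurable_majorant_left (ha : Measurable a) (n : ℕ) (η : Space d) :
    Measurable fun t => majorant a n t η :=
  (measurable_majorant ha n).comp (measurable_id.prodMk measurable_const)

lemma measurable_majorant_right (ha : Measurable a) (n : ℕ) (t : ℝ) :
    Measurable (majorant a n t) :=
  (measurable_majorant ha n).comp (measurable_const.prodMk measurable_id)

lemma measurable_lexpTail_majorant (ha : Measurable a) (n : ℕ) :
    Measurable (Function.uncurry fun s => lexpTail (majorant a n s)) :=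
  measurable_lexpTail_param (measurable_majorant ha n)

lemma measurable_quartic_mul_majorant (ha : Measurable a) (n : ℕ) :
    Measurable fun p : Space d × ℝ => quartic p.1 * majorant a n p.2 p.1 := by
  have h := (measurable_majorant ha n).comp
    (measurable_snd.prodMk measurable_fst : Measurable fun p : Space d × ℝ => (p.2, p.1))
  exact (measurable_quartic.comp measurable_fst).mul h

lemma measurable_quartic_mul_lexpTail_majorant (ha : Measurable a) (n : ℕ) :
    Measurable fun p : Space d × ℝ => quartic p.1 * lexpTail (majorant a n p.2) p.1 := by
  have h := (measurable_lexpTail_majorant ha n).comp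
    (measurable_snd.prodMk measurable_fst : Measurable fun p : Space d × ℝ => (p.2, p.1))
  exact (measurable_quartic.comp measurable_fst).mul h

lemma majorant_le_succ (a : Space d → ℝ≥0∞) (n : ℕ) : majorant a n ≤ majorant a (n + 1) := by
  induction n with
  | zero => exact fun _ _ => zero_le
  | succ n ih =>
    intro t η
    refine add_le_add_right (lintegral_mono fun s => ?_) _
    gcongr
    exact lexpTail_mono (ih s) η

lemma monotone_majorant (a : Space d → ℝ≥0∞) : Monotone (majorant a) :=
  monotone_nat_of_le_succ (majorant_le_succ a)

lemma majorant_energy (ha : Measurable a) (n : ℕ) (η : Space d) {t : ℝ} (ht : 0 ≤ t) :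
    majorant a (n + 1) t η +
        ENNReal.ofReal (3 / 4) * (∫⁻ s in Ioc 0 t, quartic η * majorant a (n + 1) s η) ≤
      a η + ∫⁻ s in Ioc 0 t, quartic η * lexpTail (majorant a n s) η := by
  have h := duhamel_add_integral_le (3 / 4 * freq η ^ 4) (by positivity) (a η)
    (g := fun s => quartic η * lexpTail (majorant a n s) η)
    ((measurable_lexpTail_majorant ha n).comp
      (measurable_id.prodMk measurable_const) |>.const_mul _) ht
    (R := fun t => majorant a (n + 1) t η) (fun t => rfl)
  rwa [ENNReal.ofReal_mul (by norm_num), mul_assoc,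
    ← lintegral_const_mul' _ _ ENNReal.ofReal_ne_top] at h

/-- As long as the mass of the data is small, the masses of the iterates do not exceed the mass of
the data: the dissipation of an iterate absorbs the nonlinear contribution of the previous one,
because the iterates increase. -/
lemma lintegral_majorant_le (ha : Measurable a) {Y : ℝ} (hY : 0 ≤ Y)
    (hsmall : Real.exp (8 * Y) - 1 ≤ 3 / 4) (haY : ∫⁻ η, a η ≤ ENNReal.ofReal Y) (n : ℕ) :
    ∀ t, 0 ≤ t → ∫⁻ η, majorant a n t η ≤ ENNReal.ofReal Y ∧
      ∫⁻ η, ∫⁻ s in Ioc 0 t, quartic η * majorant a n s η < ⊤ := by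
  induction n with
  | zero => intro t _; simp only [majorant]; simp
  | succ n ih =>
    intro t ht
    have hD : ∀ k, ∫⁻ η, ∫⁻ s in Ioc 0 t, quartic η * majorant a k s η =
        ∫⁻ s in Ioc 0 t, ∫⁻ η, quartic η * majorant a k s η := fun k => by
      exact lintegral_lintegral_swap (measurable_quartic_mul_majorant ha k).aemeasurable
    have hmeas : Measurable fun η => ENNReal.ofReal (3 / 4) *
        ∫⁻ s in Ioc 0 t, quartic η * majorant a (n + 1) s η :=
      (measurable_quartic_mul_majorant ha (n + 1)).lintegral_prod_right'.const_mul _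
    have key : (∫⁻ η, majorant a (n + 1) t η) + ENNReal.ofReal (3 / 4) *
          (∫⁻ η, ∫⁻ s in Ioc 0 t, quartic η * majorant a (n + 1) s η) ≤
        ENNReal.ofReal Y + ENNReal.ofReal (3 / 4) *
          ∫⁻ η, ∫⁻ s in Ioc 0 t, quartic η * majorant a n s η := by
      rw [← lintegral_const_mul' _ _ ENNReal.ofReal_ne_top, ← lintegral_add_right _ hmeas]
      calc _ ≤ ∫⁻ η, (a η + ∫⁻ s in Ioc 0 t, quartic η * lexpTail (majorant a n s) η) :=
            lintegral_mono fun η => majorant_energy ha n η ht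
        _ = (∫⁻ η, a η) + ∫⁻ s in Ioc 0 t, ∫⁻ η, quartic η * lexpTail (majorant a n s) η := by
            rw [lintegral_add_left ha, lintegral_lintegral_swap
              (measurable_quartic_mul_lexpTail_majorant ha n).aemeasurable]
        _ ≤ ENNReal.ofReal Y + ∫⁻ s in Ioc 0 t, ENNReal.ofReal (3 / 4) *
              ∫⁻ η, quartic η * majorant a n s η := by
            refine add_le_add haY (setLIntegral_mono' measurableSet_Ioc fun s hs => ?_)
            refine (lintegral_weight_mul_lexpTail_le (measurable_majorant_right ha n s)
              measurable_quartic quartic_add_le hY (ih s hs.1.le).1).trans ?_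
            gcongr
        _ = _ := by rw [lintegral_const_mul' _ _ ENNReal.ofReal_ne_top, hD]
    have hfin : ∫⁻ η, ∫⁻ s in Ioc 0 t, quartic η * majorant a (n + 1) s η < ⊤ := by
      have h1 : ENNReal.ofReal (3 / 4) *
          (∫⁻ η, ∫⁻ s in Ioc 0 t, quartic η * majorant a (n + 1) s η) < ⊤ :=
        lt_of_le_of_lt (le_add_self.trans key) (ENNReal.add_lt_top.2 ⟨ENNReal.ofReal_lt_top,
          ENNReal.mul_lt_top ENNReal.ofReal_lt_top (ih t ht).2⟩)
      refine ENNReal.lt_top_of_mul_ne_top_right h1.ne ?_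
      simp
    refine ⟨?_, hfin⟩
    have hle : ENNReal.ofReal (3 / 4) * (∫⁻ η, ∫⁻ s in Ioc 0 t, quartic η * majorant a n s η) ≤
        ENNReal.ofReal (3 / 4) *
          ∫⁻ η, ∫⁻ s in Ioc 0 t, quartic η * majorant a (n + 1) s η := by
      gcongr with η s
      exact majorant_le_succ a n s η
    exact (ENNReal.add_le_add_iff_right (ENNReal.mul_lt_top ENNReal.ofReal_lt_top hfin).ne).1
      (key.trans (add_le_add_right hle _))

/-- The iterates are bounded in `L²` of space and time if the data are of the form `|ξ|² f` with
`f` in `L²`. -/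
lemma lintegral_sq_majorant_le (ha : Measurable a) {Y : ℝ} (hY : 0 ≤ Y)
    (hsmall : Real.exp (8 * Y) - 1 ≤ 3 / 4) (haY : ∫⁻ η, a η ≤ ENNReal.ofReal Y)
    {f : Space d → ℝ≥0∞} (haf : ∀ η, a η ^ 2 ≤ quartic η * f η ^ 2)
    (T : ℝ) (n : ℕ) :
    ∫⁻ η, ∫⁻ s in Ioc 0 T, majorant a n s η ^ 2 ≤ 8 * ∫⁻ η, f η ^ 2 := by
  induction n with
  | zero => simp [majorant]
  | succ n ih =>
    have hgm : ∀ η, Measurable fun s => lexpTail (majorant a n s) η := fun η =>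
      (measurable_lexpTail_majorant ha n).comp (measurable_id.prodMk measurable_const)
    set A : Space d → ℝ → ℝ≥0∞ := fun η t =>
      ENNReal.ofReal (Real.exp (-(3 / 4 * freq η ^ 4 * t))) * a η with hA
    set B : Space d → ℝ → ℝ≥0∞ := fun η t =>
      ∫⁻ s in Ioc 0 t, ENNReal.ofReal (Real.exp (-(3 / 4 * freq η ^ 4 * (t - s)))) *
        (quartic η * lexpTail (majorant a n s) η) with hB
    have hq : ∀ η : Space d, quartic η = ENNReal.ofReal (4 / 3) *
        ENNReal.ofReal (3 / 4 * freq η ^ 4) := fun η => by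
      rw [← ENNReal.ofReal_mul (by norm_num), quartic]; congr 1; ring
    have h1 : ∀ η, ∫⁻ t in Ioc 0 T, A η t ^ 2 ≤ ENNReal.ofReal (4 / 3) * f η ^ 2 := fun η => by
      rcases le_total T 0 with hT | hT
      · simp [Ioc_eq_empty (not_lt.2 hT)]
      calc ∫⁻ t in Ioc 0 T, A η t ^ 2
          ≤ ∫⁻ t in Ioc 0 T, ENNReal.ofReal (Real.exp (-(3 / 4 * freq η ^ 4 * t))) *
              (quartic η * f η ^ 2) := by
            refine setLIntegral_mono' measurableSet_Ioc fun t ht => ?_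
            rw [hA, mul_pow]
            refine mul_le_mul' ?_ (haf η)
            refine pow_le_of_le_one zero_le ?_ two_ne_zero
            rw [ENNReal.ofReal_le_one, Real.exp_le_one_iff]
            have := ht.1
            have : 0 ≤ 3 / 4 * freq η ^ 4 * t := by positivity
            linarith
        _ = ENNReal.ofReal (4 / 3) * (ENNReal.ofReal (3 / 4 * freq η ^ 4) *
              ∫⁻ t in Icc 0 T, ENNReal.ofReal (Real.exp (-(3 / 4 * freq η ^ 4 * (t - 0))))) *
                f η ^ 2 := by
            rw [lintegral_mul_const _ (by fun_prop), hq, restrict_Ioc_eq_restrict_Icc]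
            simp only [sub_zero]
            ring
        _ ≤ ENNReal.ofReal (4 / 3) * 1 * f η ^ 2 := by
            gcongr
            rw [mul_lintegral_expKernel _ (by positivity) hT]
            exact ENNReal.ofReal_le_one.2
              (by linarith [Real.exp_pos (-(3 / 4 * freq η ^ 4 * (T - 0)))])
        _ = _ := by rw [mul_one]
    have h2 : ∀ η, ∫⁻ t in Ioc 0 T, B η t ^ 2 ≤ ENNReal.ofReal (4 / 3) ^ 2 *
        ∫⁻ s in Ioc 0 T, lexpTail (majorant a n s) η ^ 2 := fun η => by
      have h3 : ∀ t, B η t = ENNReal.ofReal (4 / 3) * (ENNReal.ofReal (3 / 4 * freq η ^ 4) *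
          ∫⁻ s in Ioc 0 t, ENNReal.ofReal (Real.exp (-(3 / 4 * freq η ^ 4 * (t - s)))) *
            lexpTail (majorant a n s) η) := fun t => by
        rw [← mul_assoc, ← hq, ← lintegral_const_mul' _ _ (by simp [quartic])]
        exact lintegral_congr fun s => by ring
      simp_rw [h3, mul_pow (ENNReal.ofReal (4 / 3))]
      rw [lintegral_const_mul' _ _ (by finiteness)]
      exact mul_le_mul_right
        (lintegral_sq_expKernel_le (3 / 4 * freq η ^ 4) (by positivity) (hgm η) T) _
    have h4 : ∫⁻ η, ∫⁻ s in Ioc 0 T, lexpTail (majorant a n s) η ^ 2 ≤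
        ENNReal.ofReal (1 / 8) ^ 2 * (8 * ∫⁻ η, f η ^ 2) := by
      rw [lintegral_lintegral_swap (((measurable_lexpTail_majorant ha n).comp
        measurable_swap).pow_const 2).aemeasurable]
      calc ∫⁻ s in Ioc 0 T, ∫⁻ η, lexpTail (majorant a n s) η ^ 2
          ≤ ∫⁻ s in Ioc 0 T, ENNReal.ofReal (1 / 8) ^ 2 * ∫⁻ η, majorant a n s η ^ 2 := by
            refine setLIntegral_mono' measurableSet_Ioc fun s hs => ?_
            refine (lintegral_lexpTail_sq_le (measurable_majorant_right ha n s) hY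
              (lintegral_majorant_le ha hY hsmall haY n s hs.1.le).1).trans ?_
            gcongr
            -- `exp (8 Y) ≤ 7 / 4 < (9 / 8) ^ 8`
            by_contra! hcon
            have h9 : (9 / 8 : ℝ) ^ 8 < Real.exp Y ^ 8 :=
              pow_lt_pow_left₀ (by linarith) (by norm_num) (by norm_num)
            rw [← Real.exp_nat_mul] at h9
            push_cast at h9
            norm_num at h9
            linarith
        _ ≤ _ := by
            rw [lintegral_const_mul' _ _ (by finiteness)]
            gcongr
            refine le_of_eq_of_le ?_ ih
            rw [lintegral_lintegral_swap (((measurable_majorant ha n)).pow_const 2).aemeasurable]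
    have hmA : Measurable fun η => ∫⁻ t in Ioc 0 T, A η t ^ 2 := by
      refine Measurable.lintegral_prod_right' (f := fun p : Space d × ℝ => A p.1 p.2 ^ 2) ?_
      fun_prop
    have hmA' : ∀ η, Measurable (A η) := fun η => by fun_prop
    calc ∫⁻ η, ∫⁻ s in Ioc 0 T, majorant a (n + 1) s η ^ 2
        ≤ ∫⁻ η, ∫⁻ s in Ioc 0 T, (2 * A η s ^ 2 + 2 * B η s ^ 2) := by
          gcongr with η s
          change (A η s + B η s) ^ 2 ≤ _
          rw [← mul_add]
          exact ennreal_add_sq_le _ _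
      _ = 2 * (∫⁻ η, ∫⁻ s in Ioc 0 T, A η s ^ 2) + 2 * ∫⁻ η, ∫⁻ s in Ioc 0 T, B η s ^ 2 := by
          rw [← lintegral_const_mul' _ _ (by norm_num), ← lintegral_const_mul' _ _ (by norm_num),
            ← lintegral_add_left (hmA.const_mul _)]
          refine lintegral_congr fun η => ?_
          rw [lintegral_add_left (((hmA' η).pow_const 2).const_mul _),
            lintegral_const_mul' _ _ (by norm_num), lintegral_const_mul' _ _ (by norm_num)]
      _ ≤ 2 * (ENNReal.ofReal (4 / 3) * ∫⁻ η, f η ^ 2) + 2 * (ENNReal.ofReal (4 / 3) ^ 2 *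
            (ENNReal.ofReal (1 / 8) ^ 2 * (8 * ∫⁻ η, f η ^ 2))) := by
          gcongr
          · rw [← lintegral_const_mul' _ _ (by finiteness)]
            exact lintegral_mono h1
          · refine le_trans ?_ (mul_le_mul_right h4 _)
            rw [← lintegral_const_mul' _ _ (by finiteness)]
            exact lintegral_mono h2
      _ ≤ 8 * ∫⁻ η, f η ^ 2 := by
          generalize ∫⁻ η, f η ^ 2 = I
          have e : 2 * (ENNReal.ofReal (4 / 3) * I) + 2 * (ENNReal.ofReal (4 / 3) ^ 2 *
              (ENNReal.ofReal (1 / 8) ^ 2 * (8 * I))) = ENNReal.ofReal (28 / 9) * I := by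
            rw [show (8 : ℝ≥0∞) = ENNReal.ofReal 8 by norm_num,
              show (2 : ℝ≥0∞) = ENNReal.ofReal 2 by norm_num,
              ← ENNReal.ofReal_pow (by norm_num), ← ENNReal.ofReal_pow (by norm_num)]
            simp_rw [← mul_assoc]
            rw [← add_mul, ← ENNReal.ofReal_mul (by norm_num), ← ENNReal.ofReal_mul (by norm_num),
              ← ENNReal.ofReal_mul (by norm_num), ← ENNReal.ofReal_mul (by norm_num),
              ← ENNReal.ofReal_add (by norm_num) (by norm_num)]
            norm_num
          rw [e, show (8 : ℝ≥0∞) = ENNReal.ofReal 8 by norm_num]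
          gcongr
          norm_num

/-- The limit of the increasing sequence of majorants. -/
def majorantLim (a : Space d → ℝ≥0∞) (t : ℝ) (η : Space d) : ℝ≥0∞ := ⨆ n, majorant a n t η

lemma lintegral_majorantLim_le (ha : Measurable a) {Y : ℝ} (hY : 0 ≤ Y)
    (hsmall : Real.exp (8 * Y) - 1 ≤ 3 / 4) (haY : ∫⁻ η, a η ≤ ENNReal.ofReal Y) {t : ℝ}
    (ht : 0 ≤ t) : ∫⁻ η, majorantLim a t η ≤ ENNReal.ofReal Y := by
  simp only [majorantLim]
  rw [lintegral_iSup (fun n => measurable_majorant_right ha n t)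
    fun i j hij => monotone_majorant a hij t]
  exact iSup_le fun n => (lintegral_majorant_le ha hY hsmall haY n t ht).1

lemma lintegral_sq_majorantLim_le (ha : Measurable a) {Y : ℝ} (hY : 0 ≤ Y)
    (hsmall : Real.exp (8 * Y) - 1 ≤ 3 / 4) (haY : ∫⁻ η, a η ≤ ENNReal.ofReal Y)
    {f : Space d → ℝ≥0∞} (haf : ∀ η, a η ^ 2 ≤ quartic η * f η ^ 2) (T : ℝ) :
    ∫⁻ η, ∫⁻ s in Ioc 0 T, majorantLim a s η ^ 2 ≤ 8 * ∫⁻ η, f η ^ 2 := by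
  have h1 : ∀ η s, majorantLim a s η ^ 2 = ⨆ n, majorant a n s η ^ 2 := fun η s => by
    rw [majorantLim, ENNReal.iSup_pow]
  have hm : ∀ n, Measurable fun p : Space d × ℝ => majorant a n p.2 p.1 ^ 2 := fun n => by
    have h := (measurable_majorant ha n).comp
      (measurable_snd.prodMk measurable_fst : Measurable fun p : Space d × ℝ => (p.2, p.1))
    exact h.pow_const 2
  have hmono : ∀ η s, Monotone fun n => majorant a n s η ^ 2 := fun η s i j hij =>
    pow_le_pow_left₀ zero_le (monotone_majorant a hij s η) 2
  simp_rw [h1]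
  have h2 : ∀ η, ∫⁻ s in Ioc 0 T, ⨆ n, majorant a n s η ^ 2 =
      ⨆ n, ∫⁻ s in Ioc 0 T, majorant a n s η ^ 2 := fun η =>
    lintegral_iSup (fun n => (measurable_majorant_left ha n η).pow_const 2)
      fun i j hij s => hmono η s hij
  simp_rw [h2]
  rw [lintegral_iSup (fun n => (hm n).lintegral_prod_right')
    fun i j hij η => lintegral_mono fun s => hmono η s hij]
  exact iSup_le fun n => lintegral_sq_majorant_le ha hY hsmall haY haf T n

end

/-! ### The convolution algebra of integrable functions -/

section

open scoped Convolution

variable {d : ℕ}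

/-- A closed pointwise constraint passes to limits in `L¹`. -/
lemma ae_mem_of_tendsto_Lp {α F : Type*} [MeasurableSpace α] {μ : Measure α}
    [NormedAddCommGroup F] {f : ℕ → Lp F 1 μ} {g : Lp F 1 μ} (h : Tendsto f atTop (𝓝 g))
    {C : α → Set F} (hC : ∀ x, IsClosed (C x)) (hf : ∀ n, ∀ᵐ x ∂μ, f n x ∈ C x) :
    ∀ᵐ x ∂μ, g x ∈ C x := by
  obtain ⟨ns, -, hns⟩ := (tendstoInMeasure_of_tendsto_Lp h).exists_seq_tendsto_ae
  filter_upwards [hns, ae_all_iff.2 hf] with x hx hx'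
  exact (hC x).mem_of_tendsto hx (Eventually.of_forall fun i => hx' _)

lemma ofReal_norm_L1 {α F : Type*} [MeasurableSpace α] {μ : Measure α}
    [NormedAddCommGroup F] (f : Lp F 1 μ) : ENNReal.ofReal ‖f‖ = ∫⁻ x, ‖f x‖ₑ ∂μ := by
  rw [L1.norm_def, ENNReal.ofReal_toReal]
  exact ((L1.integrable_coeFn f).2).ne

section Algebra

variable {R : Type*} [NormedRing R] [NormedAlgebra ℂ R]

lemma enorm_convolution_le (f g : Space d → R) (x : Space d) :
    ‖(f ⋆[ContinuousLinearMap.mul ℂ R] g) x‖ₑ ≤ ((fun y => ‖f y‖ₑ) ⋆ₗ fun y => ‖g y‖ₑ) x := by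
  refine (enorm_integral_le_lintegral_enorm _).trans (lintegral_mono fun y => ?_)
  rw [show -y + x = x - y by abel]
  exact ENNReal.coe_le_coe.2 (nnnorm_mul_le (f y) (g (x - y)))

lemma integrable_convolution_mul (f g : Lp R 1 (volume : Measure (Space d))) :
    Integrable (f ⋆[ContinuousLinearMap.mul ℂ R] g) :=
  (L1.integrable_coeFn f).integrable_convolution _ (L1.integrable_coeFn g)

lemma ae_convolutionExistsAt (f g : Lp R 1 (volume : Measure (Space d))) :
    ∀ᵐ x, ConvolutionExistsAt f g x (ContinuousLinearMap.mul ℂ R) volume :=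
  (L1.integrable_coeFn f).ae_convolution_exists _ (L1.integrable_coeFn g)

lemma norm_inv_factorial_smul (n : ℕ) (f : Lp R 1 (volume : Measure (Space d))) :
    ‖((n.factorial : ℂ)⁻¹) • f‖ = ‖f‖ / n.factorial := by
  rw [norm_smul, norm_inv, Complex.norm_natCast, div_eq_inv_mul]

lemma norm_toL1_convolution_le (f g : Lp R 1 (volume : Measure (Space d))) :
    ‖(integrable_convolution_mul f g).toL1 _‖ ≤ ‖f‖ * ‖g‖ := by
  have hm : ∀ f : Lp R 1 (volume : Measure (Space d)), Measurable fun x => ‖f x‖ₑ := fun f =>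
    (Lp.stronglyMeasurable f).enorm
  rw [← ENNReal.ofReal_le_ofReal_iff (by positivity),
    ENNReal.ofReal_mul (norm_nonneg _), ofReal_norm_L1, ofReal_norm_L1 f, ofReal_norm_L1 g,
    ← lintegral_lconvolution (hm f) (hm g)]
  refine lintegral_mono_ae ?_
  filter_upwards [(integrable_convolution_mul f g).coeFn_toL1] with x hx
  rw [hx]
  exact enorm_convolution_le _ _ x

/-- Convolution, as a bounded bilinear map on integrable functions with values in a Banach
algebra. -/
def convL1 : Lp R 1 (volume : Measure (Space d)) →L[ℂ] Lp R 1 (volume : Measure (Space d)) →L[ℂ]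
    Lp R 1 (volume : Measure (Space d)) :=
  LinearMap.mkContinuous₂
    (LinearMap.mk₂ ℂ (fun f g => (integrable_convolution_mul f g).toL1 _)
      (fun f f' g => by
        rw [← Integrable.toL1_add, Integrable.toL1_eq_toL1_iff]
        have h : ⇑(f + f') ⋆[ContinuousLinearMap.mul ℂ R] ⇑g =
            (⇑f + ⇑f') ⋆[ContinuousLinearMap.mul ℂ R] ⇑g :=
          convolution_congr _ (Lp.coeFn_add f f') (ae_eq_refl _)
        rw [h]
        filter_upwards [ae_convolutionExistsAt f g, ae_convolutionExistsAt f' g] with x h1 h2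
        exact h1.add_distrib h2)
      (fun c f g => by
        rw [← Integrable.toL1_smul, Integrable.toL1_eq_toL1_iff]
        have h : ⇑(c • f) ⋆[ContinuousLinearMap.mul ℂ R] ⇑g =
            (c • ⇑f) ⋆[ContinuousLinearMap.mul ℂ R] ⇑g :=
          convolution_congr _ (Lp.coeFn_smul c f) (ae_eq_refl _)
        rw [h, smul_convolution]
        rfl)
      (fun f g g' => by
        rw [← Integrable.toL1_add, Integrable.toL1_eq_toL1_iff]
        have h : ⇑f ⋆[ContinuousLinearMap.mul ℂ R] ⇑(g + g') =
            ⇑f ⋆[ContinuousLinearMap.mul ℂ R] (⇑g + ⇑g') :=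
          convolution_congr _ (ae_eq_refl _) (Lp.coeFn_add g g')
        rw [h]
        filter_upwards [ae_convolutionExistsAt f g, ae_convolutionExistsAt f g'] with x h1 h2
        exact h1.distrib_add h2)
      (fun c f g => by
        rw [← Integrable.toL1_smul, Integrable.toL1_eq_toL1_iff]
        have h : ⇑f ⋆[ContinuousLinearMap.mul ℂ R] ⇑(c • g) =
            ⇑f ⋆[ContinuousLinearMap.mul ℂ R] (c • ⇑g) :=
          convolution_congr _ (ae_eq_refl _) (Lp.coeFn_smul c g)
        rw [h, convolution_smul]
        rfl)) 1 (fun f g => by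
      rw [one_mul]; exact norm_toL1_convolution_le f g)

lemma coeFn_convL1 (f g : Lp R 1 (volume : Measure (Space d))) :
    convL1 f g =ᵐ[volume] f ⋆[ContinuousLinearMap.mul ℂ R] g :=
  (integrable_convolution_mul f g).coeFn_toL1

lemma norm_convL1_le (f g : Lp R 1 (volume : Measure (Space d))) :
    ‖convL1 f g‖ ≤ ‖f‖ * ‖g‖ :=
  norm_toL1_convolution_le f g

/-- The `(n + 1)`-fold convolution of an integrable function with itself. -/
def convPow (k : Lp R 1 (volume : Measure (Space d))) : ℕ → Lp R 1 (volume : Measure (Space d))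
  | 0 => k
  | n + 1 => convL1 k (convPow k n)

/-- The convolution exponential without its terms of degree `0` and `1`. -/
def convExpTail (k : Lp R 1 (volume : Measure (Space d))) : Lp R 1 (volume : Measure (Space d)) :=
  ∑' n : ℕ, ((n + 2).factorial : ℂ)⁻¹ • convPow k (n + 1)

lemma norm_convPow_le (k : Lp R 1 (volume : Measure (Space d))) (n : ℕ) :
    ‖convPow k n‖ ≤ ‖k‖ ^ (n + 1) := by
  induction n with
  | zero => simp [convPow]
  | succ n ih =>
    calc ‖convPow k (n + 1)‖ ≤ ‖k‖ * ‖convPow k n‖ := norm_convL1_le _ _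
      _ ≤ ‖k‖ * ‖k‖ ^ (n + 1) := by gcongr
      _ = _ := by ring

lemma convPow_zero_left (n : ℕ) : convPow (0 : Lp R 1 (volume : Measure (Space d))) n = 0 := by
  induction n with
  | zero => rfl
  | succ n ih => simp [convPow]

lemma norm_convPow_sub_le {k l : Lp R 1 (volume : Measure (Space d))} {ρ : ℝ} (hk : ‖k‖ ≤ ρ)
    (hl : ‖l‖ ≤ ρ) (n : ℕ) : ‖convPow k n - convPow l n‖ ≤ (n + 1) * ρ ^ n * ‖k - l‖ := by
  have hρ : 0 ≤ ρ := (norm_nonneg k).trans hk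
  induction n with
  | zero => simp [convPow]
  | succ n ih =>
    have e : convPow k (n + 1) - convPow l (n + 1) =
        convL1 k (convPow k n - convPow l n) + convL1 (k - l) (convPow l n) := by
      simp [convPow]
    rw [e]
    calc _ ≤ ‖k‖ * ‖convPow k n - convPow l n‖ + ‖k - l‖ * ‖convPow l n‖ :=
          (norm_add_le _ _).trans (add_le_add (norm_convL1_le _ _) (norm_convL1_le _ _))
      _ ≤ ρ * ((n + 1) * ρ ^ n * ‖k - l‖) + ‖k - l‖ * ρ ^ (n + 1) := by
          gcongr
          exact (norm_convPow_le l n).trans (by gcongr)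
      _ = _ := by push_cast; ring

lemma convExpTail_zero : convExpTail (0 : Lp R 1 (volume : Measure (Space d))) = 0 := by
  simp [convExpTail, convPow_zero_left]

variable [CompleteSpace R]

lemma summable_convExpTail (k : Lp R 1 (volume : Measure (Space d))) :
    Summable fun n : ℕ => ((n + 2).factorial : ℂ)⁻¹ • convPow k (n + 1) := by
  refine Summable.of_norm_bounded
    ((summable_nat_add_iff 2).2 (Real.summable_pow_div_factorial ‖k‖)) fun n => ?_
  rw [norm_inv_factorial_smul]
  gcongr
  exact norm_convPow_le k (n + 1)

lemma norm_convExpTail_sub_le {k l : Lp R 1 (volume : Measure (Space d))} {ρ : ℝ} (hk : ‖k‖ ≤ ρ)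
    (hl : ‖l‖ ≤ ρ) : ‖convExpTail k - convExpTail l‖ ≤ (Real.exp ρ - 1) * ‖k - l‖ := by
  have hρ : 0 ≤ ρ := (norm_nonneg k).trans hk
  have hs : HasSum (fun n : ℕ => ρ ^ (n + 1) / ((n + 1).factorial : ℝ)) (Real.exp ρ - 1) := by
    have h := NormedSpace.expSeries_div_hasSum_exp (𝔸 := ℝ) ρ
    rw [← Real.exp_eq_exp_ℝ] at h
    simpa using (hasSum_nat_add_iff' 1).2 h
  rw [convExpTail, convExpTail, ← (summable_convExpTail k).tsum_sub (summable_convExpTail l)]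
  refine tsum_of_norm_bounded (hs.mul_right _) fun n => ?_
  rw [← smul_sub, norm_inv_factorial_smul]
  calc ‖convPow k (n + 1) - convPow l (n + 1)‖ / (n + 2).factorial
      ≤ (((n + 1 : ℕ) + 1) * ρ ^ (n + 1) * ‖k - l‖) / (n + 2).factorial := by
        gcongr; exact norm_convPow_sub_le hk hl (n + 1)
    _ = _ := by
        rw [Nat.factorial_succ (n + 1)]
        push_cast
        field_simp

end Algebra

section Eval

variable {K : Type*} [TopologicalSpace K] [CompactSpace K]

/-- Convolution powers of functions with values in `C(K, ℂ)` are bounded, separately at each point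
of `K`, by the convolution powers of the absolute values. -/
lemma ae_enorm_convPow_apply_le (k : Lp C(K, ℂ) 1 (volume : Measure (Space d))) (n : ℕ) :
    ∀ᵐ x, ∀ t : K, ‖convPow k n x t‖ₑ ≤ lconvPow (fun y => ‖k y t‖ₑ) n x := by
  induction n with
  | zero => exact Eventually.of_forall fun x t => le_rfl
  | succ n ih =>
    filter_upwards [coeFn_convL1 k (convPow k n), ae_convolutionExistsAt k (convPow k n)]
      with x hx hex t
    rw [convPow, hx, lconvPow]
    have e : (k ⋆[ContinuousLinearMap.mul ℂ C(K, ℂ)] convPow k n) x t =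
        ∫ y, k y t * convPow k n (x - y) t :=
      ((ContinuousMap.evalCLM ℂ t).integral_comp_comm hex).symm
    rw [e]
    refine (enorm_integral_le_lintegral_enorm _).trans (lintegral_mono_ae ?_)
    filter_upwards [(quasiMeasurePreserving_neg_add x).ae ih] with y hy
    rw [enorm_mul, show x - y = -y + x by abel]
    gcongr
    exact hy t

lemma ae_enorm_convExpTail_apply_le (k : Lp C(K, ℂ) 1 (volume : Measure (Space d))) :
    ∀ᵐ x, ∀ t : K, ‖convExpTail k x t‖ₑ ≤ lexpTail (fun y => ‖k y t‖ₑ) x := by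
  refine ae_mem_of_tendsto_Lp (summable_convExpTail k).hasSum.tendsto_sum_nat
    (C := fun x => {g : C(K, ℂ) | ∀ t, ‖g t‖ₑ ≤ lexpTail (fun y => ‖k y t‖ₑ) x})
    (fun x => ?_) fun N => ?_
  · rw [ofPred_forall]
    exact isClosed_iInter fun t => isClosed_le (by fun_prop) continuous_const
  · have h1 := Lp.coeFn_finsetSum (Finset.range N)
      (fun n : ℕ => ((n + 2).factorial : ℂ)⁻¹ • convPow k (n + 1))
    have h2 := ae_all_iff.2 fun n : ℕ =>
      Lp.coeFn_smul ((n + 2).factorial : ℂ)⁻¹ (convPow k (n + 1))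
    have h3 := ae_all_iff.2 fun n : ℕ => ae_enorm_convPow_apply_le k (n + 1)
    filter_upwards [h1, h2, h3] with x e1 e2 e3 t
    rw [e1]
    simp only [Finset.sum_apply, ContinuousMap.sum_apply]
    refine (enorm_sum_le _ _).trans ?_
    refine le_trans (Finset.sum_le_sum fun n _ => ?_) (ENNReal.sum_le_tsum (Finset.range N))
    rw [e2 n]
    simp only [Pi.smul_apply, ContinuousMap.smul_apply, smul_eq_mul, enorm_mul]
    gcongr
    · rw [enorm_inv (Nat.cast_ne_zero.2 (Nat.factorial_ne_zero _))]
      simp [enorm_eq_nnnorm]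
    · exact e3 n t

end Eval

end

/-! ### The integral equation and its fixed point -/

section

open scoped unitInterval

variable {d : ℕ}

/-- Continuous functions of time on `[0, 1]`. -/
abbrev Path : Type := C(I, ℂ)

/-- Extension of a function on `[0, 1]` to the real line, constant outside `[0, 1]`. -/
def Path.ext (g : Path) (s : ℝ) : ℂ := g (projIcc 0 1 zero_le_one s)

lemma Path.continuous_ext (g : Path) : Continuous g.ext :=
  g.continuous.comp continuous_projIcc

lemma Path.continuous_ext₂ : Continuous fun p : Path × ℝ => p.1.ext p.2 :=
  continuous_fst.eval ((continuous_projIcc (h := zero_le_one)).comp continuous_snd)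

lemma Path.ext_coe (g : Path) (t : I) : g.ext t = g t := by
  simp [Path.ext]

lemma Path.norm_ext_le (g : Path) (s : ℝ) : ‖g.ext s‖ ≤ ‖g‖ := g.norm_coe_le_norm _

/-- The path `t ↦ exp (-a t)`. -/
def decay (a : ℝ) : Path := ⟨fun t => Complex.exp (-(a * t)), by fun_prop⟩

lemma continuous_decay : Continuous decay :=
  ContinuousMap.continuous_of_continuous_uncurry _ (by
    simp only [Function.uncurry_def, decay, ContinuousMap.coe_mk]; fun_prop)

lemma norm_decay_le {a : ℝ} (ha : 0 ≤ a) : ‖decay a‖ ≤ 1 := by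
  refine (ContinuousMap.norm_le _ zero_le_one).2 fun t => ?_
  simp only [decay, ContinuousMap.coe_mk, Complex.norm_exp]
  simp only [Complex.neg_re, Complex.mul_re, Complex.ofReal_re, Complex.ofReal_im, mul_zero,
    sub_zero, Real.exp_le_one_iff, Left.neg_nonpos_iff]
  exact mul_nonneg ha t.2.1

/-- The solution `t ↦ ∫₀ᵗ a exp(-a (t - s)) g(s) ds` of `y' = -a y + a g`, `y(0) = 0`. -/
def duhamel (a : ℝ) (g : Path) : Path where
  toFun t := ∫ s in (0 : ℝ)..t, (a * Real.exp (-(a * (t - s))) : ℝ) * g.ext s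
  continuous_toFun := by
    have h : Continuous (Function.uncurry fun (t : I) (s : ℝ) =>
        ((a * Real.exp (-(a * (t - s))) : ℝ) : ℂ) * g.ext s) := by
      have := g.continuous_ext
      simp only [Function.uncurry_def]
      fun_prop
    exact intervalIntegral.continuous_parametric_intervalIntegral_of_continuous h (by fun_prop)

lemma continuous_duhamel : Continuous fun p : ℝ × Path => duhamel p.1 p.2 := by
  refine ContinuousMap.continuous_of_continuous_uncurry _ ?_
  have h : Continuous (Function.uncurry fun (q : (ℝ × Path) × I) (s : ℝ) =>
      ((q.1.1 * Real.exp (-(q.1.1 * (q.2 - s))) : ℝ) : ℂ) * q.1.2.ext s) := by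
    have h2 : Continuous fun r : ((ℝ × Path) × I) × ℝ => r.1.1.2.ext r.2 :=
      Path.continuous_ext₂.comp (by fun_prop : Continuous fun r : ((ℝ × Path) × I) × ℝ =>
        (r.1.1.2, r.2))
    simp only [Function.uncurry_def]
    fun_prop
  exact intervalIntegral.continuous_parametric_intervalIntegral_of_continuous h (by fun_prop)

lemma intervalIntegrable_duhamel (a : ℝ) (g : Path) (t x y : ℝ) :
    IntervalIntegrable (fun s => ((a * Real.exp (-(a * (t - s))) : ℝ) : ℂ) * g.ext s)
      volume x y := by
  have := g.continuous_ext
  exact Continuous.intervalIntegrable (by fun_prop) _ _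

lemma duhamel_sub (a : ℝ) (g g' : Path) : duhamel a (g - g') = duhamel a g - duhamel a g' := by
  ext t
  simp only [duhamel, ContinuousMap.coe_mk, ContinuousMap.sub_apply]
  rw [← intervalIntegral.integral_sub (intervalIntegrable_duhamel ..)
    (intervalIntegrable_duhamel ..)]
  congr 1
  ext s
  simp [Path.ext, mul_sub]

lemma enorm_duhamel_le {a : ℝ} (ha : 0 ≤ a) (g : Path) (t : I) :
    ‖duhamel a g t‖ₑ ≤ ∫⁻ s in Ioc 0 (t : ℝ),
      ENNReal.ofReal (Real.exp (-(a * (t - s)))) * (ENNReal.ofReal a * ‖g.ext s‖ₑ) := by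
  simp only [duhamel, ContinuousMap.coe_mk]
  rw [intervalIntegral.integral_of_le t.2.1]
  refine (enorm_integral_le_lintegral_enorm _).trans (le_of_eq (lintegral_congr fun s => ?_))
  rw [enorm_mul, ← mul_assoc, mul_comm (ENNReal.ofReal _) (ENNReal.ofReal a),
    ← ENNReal.ofReal_mul ha]
  congr 1
  rw [← ofReal_norm, Complex.norm_real, Real.norm_of_nonneg (by positivity)]

lemma norm_duhamel_le {a : ℝ} (ha : 0 ≤ a) (g : Path) : ‖duhamel a g‖ ≤ ‖g‖ := by
  refine (ContinuousMap.norm_le _ (norm_nonneg _)).2 fun t => ?_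
  have h0 : (0 : ℝ) ≤ t := t.2.1
  calc ‖duhamel a g t‖ ≤ ∫ s in (0 : ℝ)..t, a * Real.exp (-(a * (t - s))) * ‖g‖ := by
        refine intervalIntegral.norm_integral_le_of_norm_le h0 ?_
          (Continuous.intervalIntegrable (by fun_prop) _ _)
        refine Eventually.of_forall fun s _ => ?_
        rw [norm_mul, Complex.norm_real, Real.norm_of_nonneg (by positivity)]
        gcongr
        exact g.norm_ext_le s
    _ = (1 - Real.exp (-(a * t))) * ‖g‖ := by
        rw [intervalIntegral.integral_mul_const]
        congr 1
        rw [intervalIntegral.integral_eq_sub_of_hasDerivAt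
          (f := fun s => Real.exp (-(a * (t - s)))) (fun s _ => ?_)
          (Continuous.intervalIntegrable (by fun_prop) _ _)]
        · simp
        · have : HasDerivAt (fun s : ℝ => -(a * (t - s))) (-(a * (-1))) s :=
            (((hasDerivAt_id s).const_sub (t : ℝ)).const_mul a).neg
          convert! this.exp using 1
          ring
    _ ≤ 1 * ‖g‖ := by
        gcongr
        linarith [Real.exp_pos (-(a * t))]
    _ = ‖g‖ := one_mul _

/-- The function `y = e^{-a·} c - duhamel a g` solves `y' = -a (y + g)`, `y(0) = c`. -/
lemma decay_sub_duhamel_integral (a : ℝ) (c : ℂ) (g : Path) (t : I) :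
    c * decay a t - duhamel a g t =
      c - a * ∫ s in (0 : ℝ)..t, ((c • decay a - duhamel a g : Path) + g).ext s := by
  set y : ℝ → ℂ := fun t => Complex.exp (-(a * t)) *
    (c - ∫ s in (0 : ℝ)..t, a * Complex.exp (a * s) * g.ext s) with hy
  have hg := g.continuous_ext
  have hyI : ∀ t : I, c * decay a t - duhamel a g t = y t := fun t => by
    simp only [hy, decay, duhamel, ContinuousMap.coe_mk, mul_sub]
    rw [mul_comm c, ← intervalIntegral.integral_const_mul]
    congr 2
    ext s
    push_cast
    rw [show -((a : ℂ) * t - a * s) = -(a * t) + a * s by ring, Complex.exp_add]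
    ring
  have hd : ∀ t, HasDerivAt y (-(a * (y t + g.ext t))) t := fun t => by
    have h1 : HasDerivAt (fun t : ℝ => ∫ s in (0 : ℝ)..t, a * Complex.exp (a * s) * g.ext s)
        (a * Complex.exp (a * t) * g.ext t) t :=
      intervalIntegral.integral_hasDerivAt_right
        (Continuous.intervalIntegrable (by fun_prop) _ _)
        (Continuous.stronglyMeasurableAtFilter (by fun_prop) _ _)
        (Continuous.continuousAt (by fun_prop))
    have h2 : HasDerivAt (fun t : ℝ => Complex.exp (-((a : ℂ) * t)))
        (Complex.exp (-((a : ℂ) * t)) * (-(a * 1))) t :=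
      ((((Complex.ofRealCLM.hasDerivAt (x := t)).const_mul (a : ℂ)).neg).cexp)
    convert! h2.mul ((hasDerivAt_const t c).sub h1) using 1
    simp only [hy, Pi.sub_apply]
    have h3 : Complex.exp (-((a : ℂ) * t)) * Complex.exp (a * t) = 1 := by
      rw [← Complex.exp_add]; simp
    linear_combination (a * g.ext t) * h3
  have hyc : Continuous y := continuous_iff_continuousAt.2 fun t => (hd t).continuousAt
  have hint := intervalIntegral.integral_eq_sub_of_hasDerivAt (a := 0) (b := (t : ℝ))
    (fun s _ => hd s) (Continuous.intervalIntegrable (by fun_prop) _ _)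
  have h0 : y 0 = c := by simp [hy]
  have key : (a : ℂ) * ∫ s in (0 : ℝ)..t, ((c • decay a - duhamel a g : Path) + g).ext s =
      -∫ s in (0 : ℝ)..t, -(a * (y s + g.ext s)) := by
    rw [intervalIntegral.integral_neg, neg_neg, intervalIntegral.integral_const_mul]
    congr 1
    refine intervalIntegral.integral_congr fun s hs => ?_
    rw [uIcc_of_le t.2.1] at hs
    have hs' : s ∈ Icc (0 : ℝ) 1 := ⟨hs.1, hs.2.trans t.2.2⟩
    have := hyI ⟨s, hs'⟩
    simp only at this
    simp only [Path.ext, projIcc_of_mem _ hs', ContinuousMap.add_apply, ContinuousMap.sub_apply,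
      ContinuousMap.smul_apply, smul_eq_mul, this]
  rw [hyI t, key, hint, h0]
  ring

/-- The free evolution of the initial datum. -/
def freeEvol (k₀ : Lp ℂ 1 (volume : Measure (Space d))) :
    Lp Path 1 (volume : Measure (Space d)) :=
  Integrable.toL1 (fun η => k₀ η • decay (freq η ^ 4)) (by
    refine (L1.integrable_coeFn k₀).norm.mono' ?_ (Eventually.of_forall fun η => ?_)
    · exact (Lp.aestronglyMeasurable k₀).smul
        (continuous_decay.comp (continuous_freq.pow 4)).aestronglyMeasurable
    · rw [norm_smul]
      exact mul_le_of_le_one_right (norm_nonneg _) (norm_decay_le (by positivity)))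

lemma aestronglyMeasurable_duhamel {q : Space d → ℝ} (hq : Continuous q) {f : Space d → Path}
    (hf : AEStronglyMeasurable f volume) :
    AEStronglyMeasurable (fun η => duhamel (q η) (f η)) volume := by
  have h : AEStronglyMeasurable (fun η : Space d => (q η, f η)) volume :=
    AEStronglyMeasurable.prodMk hq.aestronglyMeasurable hf
  exact continuous_duhamel.comp_aestronglyMeasurable h

lemma integrable_duhamelL1 (f : Lp Path 1 (volume : Measure (Space d))) :
    Integrable fun η => duhamel (freq η ^ 4) (f η) :=
  Integrable.mono' (L1.integrable_coeFn f).norm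
    (aestronglyMeasurable_duhamel (q := fun η => freq η ^ 4) (by fun_prop)
      (Lp.aestronglyMeasurable f))
    (Eventually.of_forall fun η => norm_duhamel_le (pow_nonneg (freq_nonneg η) 4) (f η))

/-- The Duhamel operator of the squared Laplacian on functions of frequency and time. -/
def duhamelL1 (f : Lp Path 1 (volume : Measure (Space d))) :
    Lp Path 1 (volume : Measure (Space d)) := (integrable_duhamelL1 f).toL1 _

lemma coeFn_freeEvol (k₀ : Lp ℂ 1 (volume : Measure (Space d))) :
    freeEvol k₀ =ᵐ[volume] fun η => k₀ η • decay (freq η ^ 4) := Integrable.coeFn_toL1 _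

lemma coeFn_duhamelL1 (f : Lp Path 1 (volume : Measure (Space d))) :
    duhamelL1 f =ᵐ[volume] fun η => duhamel (freq η ^ 4) (f η) := Integrable.coeFn_toL1 _

lemma norm_freeEvol_le (k₀ : Lp ℂ 1 (volume : Measure (Space d))) : ‖freeEvol k₀‖ ≤ ‖k₀‖ := by
  refine Lp.norm_le_norm_of_ae_le ?_
  filter_upwards [coeFn_freeEvol k₀] with η hη
  rw [hη, norm_smul]
  exact mul_le_of_le_one_right (norm_nonneg _) (norm_decay_le (by positivity))

lemma norm_duhamelL1_sub_le (f g : Lp Path 1 (volume : Measure (Space d))) :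
    ‖duhamelL1 f - duhamelL1 g‖ ≤ ‖f - g‖ := by
  refine Lp.norm_le_norm_of_ae_le ?_
  filter_upwards [coeFn_duhamelL1 f, coeFn_duhamelL1 g, Lp.coeFn_sub f g,
    Lp.coeFn_sub (duhamelL1 f) (duhamelL1 g)] with η h1 h2 h3 h4
  rw [h4, h3, Pi.sub_apply, Pi.sub_apply, h1, h2, ← duhamel_sub]
  exact norm_duhamel_le (by positivity) _

/-- The map whose fixed points are the mild solutions of `∂ₜ k = -|ξ|⁴ (exp_* k - 1)`. -/
def mildMap (k₀ : Lp ℂ 1 (volume : Measure (Space d)))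
    (k : Lp Path 1 (volume : Measure (Space d))) : Lp Path 1 (volume : Measure (Space d)) :=
  freeEvol k₀ - duhamelL1 (convExpTail k)

lemma exp_half_sub_one_le : Real.exp (1 / 2) - 1 ≤ 3 / 4 := by
  have h : Real.exp (1 / 2) ^ 2 = Real.exp 1 := by rw [← Real.exp_nat_mul]; norm_num
  have := Real.exp_one_lt_d9
  nlinarith [Real.exp_pos (1 / 2)]

lemma norm_mildMap_sub_le (k₀ : Lp ℂ 1 (volume : Measure (Space d)))
    {k l : Lp Path 1 (volume : Measure (Space d))} (hk : ‖k‖ ≤ 1 / 2) (hl : ‖l‖ ≤ 1 / 2) :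
    ‖mildMap k₀ k - mildMap k₀ l‖ ≤ 3 / 4 * ‖k - l‖ := by
  have e : mildMap k₀ k - mildMap k₀ l =
      duhamelL1 (convExpTail l) - duhamelL1 (convExpTail k) := by simp [mildMap]
  rw [e]
  refine (norm_duhamelL1_sub_le _ _).trans ?_
  rw [norm_sub_rev]
  refine (norm_convExpTail_sub_le hk hl).trans ?_
  gcongr
  exact exp_half_sub_one_le

lemma norm_mildMap_le {k₀ : Lp ℂ 1 (volume : Measure (Space d))} (hk₀ : ‖k₀‖ ≤ 1 / 8)
    {k : Lp Path 1 (volume : Measure (Space d))} (hk : ‖k‖ ≤ 1 / 2) :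
    ‖mildMap k₀ k‖ ≤ 1 / 2 := by
  have h0 : mildMap k₀ 0 = freeEvol k₀ := by
    have h1 : duhamelL1 (0 : Lp Path 1 (volume : Measure (Space d))) = 0 := by
      refine (Lp.eq_zero_iff_ae_eq_zero).2 ?_
      filter_upwards [coeFn_duhamelL1 (0 : Lp Path 1 (volume : Measure (Space d))),
        Lp.coeFn_zero Path 1 (volume : Measure (Space d))] with η h1 hη
      rw [h1, hη]
      have := duhamel_sub (freq η ^ 4) 0 0
      simpa using this
    rw [mildMap, convExpTail_zero, h1, sub_zero]
  have h1 := norm_mildMap_sub_le k₀ hk (l := 0) (by simp)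
  rw [h0, sub_zero] at h1
  have h2 := norm_freeEvol_le k₀
  have h3 := norm_le_norm_add_norm_sub' (mildMap k₀ k) (freeEvol k₀)
  linarith

/-- Small data have a mild solution, which is the limit of the Picard iterates. On the ball of
radius `1 / 2` the nonlinearity has the Lipschitz constant `exp (1 / 2) - 1 ≤ 3 / 4`. -/
lemma exists_mild_solution {k₀ : Lp ℂ 1 (volume : Measure (Space d))} (hk₀ : ‖k₀‖ ≤ 1 / 8) :
    ∃ k : Lp Path 1 (volume : Measure (Space d)), ‖k‖ ≤ 1 / 2 ∧ mildMap k₀ k = k ∧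
      Tendsto (fun n => (mildMap k₀)^[n] 0) atTop (𝓝 k) := by
  set s : Set (Lp Path 1 (volume : Measure (Space d))) := Metric.closedBall 0 (1 / 2)
  have hms : MapsTo (mildMap k₀) s s := fun k hk => by
    simp only [s, mem_closedBall_zero_iff] at hk ⊢
    exact norm_mildMap_le hk₀ hk
  have hc : ContractingWith (3 / 4) (hms.restrict (mildMap k₀) s s) := by
    refine ⟨by norm_num [← NNReal.coe_lt_coe], LipschitzWith.of_dist_le_mul fun x y => ?_⟩
    have hx := x.2
    have hy := y.2
    simp only [s, mem_closedBall_zero_iff] at hx hy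
    have := norm_mildMap_sub_le k₀ hx hy
    rw [Subtype.dist_eq, Subtype.dist_eq, dist_eq_norm, dist_eq_norm]
    simpa using this
  obtain ⟨k, hks, hk, hlim, -⟩ :=
    hc.exists_fixedPoint' (x := 0) Metric.isClosed_closedBall.isComplete hms
    (by simp [s]) (edist_ne_top _ _)
  exact ⟨k, by simpa [s] using hks, hk, hlim⟩

end

/-! ### Analytic and square integrable bounds for the mild solution -/

section

open scoped unitInterval

variable {d : ℕ}

/-- The weight `exp ((1 - t) / 16 + t |ξ| / 16)`. It is submultiplicative in the frequency for
`t ≤ 1`, and its growth in time is absorbed by a quarter of the dissipation. -/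
def gevrey (t : ℝ) (η : Space d) : ℝ≥0∞ :=
  ENNReal.ofReal (Real.exp ((1 - t) / 16 + t * freq η / 16))

lemma gevrey_add_le {t : ℝ} (h0 : 0 ≤ t) (h1 : t ≤ 1) (x y : Space d) :
    gevrey t (x + y) ≤ gevrey t x * gevrey t y := by
  unfold gevrey
  rw [← ENNReal.ofReal_mul (Real.exp_pos _).le, ← Real.exp_add]
  refine ENNReal.ofReal_le_ofReal (Real.exp_le_exp.2 ?_)
  nlinarith [freq_add_le x y]

lemma freq_le (η : Space d) : freq η - 1 ≤ freq η ^ 4 := by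
  have h := freq_nonneg η
  nlinarith [sq_nonneg (freq η ^ 2 - 1), sq_nonneg (freq η - 1)]

lemma gevrey_mul_exp_le {s t : ℝ} (hst : s ≤ t) (η : Space d) :
    gevrey t η * ENNReal.ofReal (Real.exp (-(freq η ^ 4 * (t - s)))) ≤
      ENNReal.ofReal (Real.exp (-(3 / 4 * freq η ^ 4 * (t - s)))) * gevrey s η := by
  unfold gevrey
  rw [← ENNReal.ofReal_mul (Real.exp_pos _).le, ← ENNReal.ofReal_mul (Real.exp_pos _).le,
    ← Real.exp_add, ← Real.exp_add]
  refine ENNReal.ofReal_le_ofReal (Real.exp_le_exp.2 ?_)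
  have h1 := mul_le_mul_of_nonneg_right (freq_le η) (sub_nonneg.2 hst)
  have h2 : 0 ≤ freq η ^ 4 * (t - s) := mul_nonneg (by positivity) (sub_nonneg.2 hst)
  linarith

lemma gevrey_zero (η : Space d) : gevrey 0 η = ENNReal.ofReal (Real.exp (1 / 16)) := by
  simp [gevrey]

lemma one_le_gevrey {t : ℝ} (h0 : 0 ≤ t) (h1 : t ≤ 1) (η : Space d) : 1 ≤ gevrey t η := by
  rw [gevrey, ENNReal.one_le_ofReal, Real.one_le_exp_iff]
  have := mul_nonneg h0 (freq_nonneg η)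
  linarith

lemma measurable_enorm_ext (k : Lp Path 1 (volume : Measure (Space d))) :
    Measurable fun p : Space d × ℝ => ‖(k p.1).ext p.2‖ₑ := by
  have h : StronglyMeasurable fun p : Space d × ℝ => (k p.1, p.2) :=
    ((Lp.stronglyMeasurable k).comp_measurable measurable_fst).prodMk
      measurable_snd.stronglyMeasurable
  exact (Path.continuous_ext₂.comp_stronglyMeasurable h).enorm

lemma measurable_enorm_ext_left (k : Lp Path 1 (volume : Measure (Space d))) (s : ℝ) :
    Measurable fun η : Space d => ‖(k η).ext s‖ₑ :=
  (measurable_enorm_ext k).comp (measurable_id.prodMk measurable_const)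

variable {k₀ : Lp ℂ 1 (volume : Measure (Space d))} {a : Space d → ℝ≥0∞}

/-- The Picard iterates are dominated by the majorants, with the analytic weight. -/
lemma gevrey_mul_iterate_le
    (hk₀ : ∀ᵐ η, ENNReal.ofReal (Real.exp (1 / 16)) * ‖k₀ η‖ₑ ≤ a η) (n : ℕ) :
    ∀ᵐ η, ∀ t : I, gevrey t η * ‖((mildMap k₀)^[n] 0) η t‖ₑ ≤ majorant a n t η := by
  induction n with
  | zero =>
    exact Eventually.of_forall fun η t => by simp
  | succ n ih =>
    set kn := (mildMap k₀)^[n] 0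
    filter_upwards [hk₀, coeFn_freeEvol k₀, coeFn_duhamelL1 (convExpTail kn),
      Lp.coeFn_sub (freeEvol k₀) (duhamelL1 (convExpTail kn)),
      ae_enorm_convExpTail_apply_le kn] with η h0 h1 h2 h3 h4 t
    rw [Function.iterate_succ_apply', mildMap, h3, Pi.sub_apply, h1, h2,
      ContinuousMap.sub_apply, ContinuousMap.smul_apply, smul_eq_mul]
    refine (mul_le_mul_right (enorm_sub_le) _).trans ?_
    rw [mul_add]
    refine add_le_add ?_ ?_
    · have hd : ‖decay (freq η ^ 4) t‖ₑ =
          ENNReal.ofReal (Real.exp (-(freq η ^ 4 * ((t : ℝ) - 0)))) := by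
        rw [← ofReal_norm]
        simp only [decay, ContinuousMap.coe_mk]
        rw [show -(((freq η ^ 4 : ℝ) : ℂ) * ((t : ℝ) : ℂ)) =
          ((-(freq η ^ 4 * ((t : ℝ) - 0)) : ℝ) : ℂ) by push_cast; ring, ← Complex.ofReal_exp,
          Complex.norm_real, Real.norm_of_nonneg (Real.exp_pos _).le]
      calc gevrey t η * ‖k₀ η * decay (freq η ^ 4) t‖ₑ
          = (gevrey t η * ENNReal.ofReal (Real.exp (-(freq η ^ 4 * ((t : ℝ) - 0))))) *
              ‖k₀ η‖ₑ := by rw [enorm_mul, hd]; ring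
        _ ≤ (ENNReal.ofReal (Real.exp (-(3 / 4 * freq η ^ 4 * ((t : ℝ) - 0)))) * gevrey 0 η) *
              ‖k₀ η‖ₑ := by
            gcongr ?_ * _
            exact gevrey_mul_exp_le t.2.1 η
        _ ≤ _ := by
            rw [gevrey_zero, mul_assoc, sub_zero]
            gcongr
    · refine (mul_le_mul_right (enorm_duhamel_le (by positivity) _ _) _).trans ?_
      rw [← lintegral_const_mul' _ _ (by simp [gevrey])]
      refine setLIntegral_mono' measurableSet_Ioc fun s hs => ?_
      have hs0 : 0 ≤ s := hs.1.le
      have hs1 : s ≤ 1 := hs.2.trans t.2.2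
      have hsI : s ∈ I := ⟨hs0, hs1⟩
      have key : gevrey s η * ‖(convExpTail kn η).ext s‖ₑ ≤ lexpTail (majorant a n s) η := by
        simp only [Path.ext, projIcc_of_mem _ hsI]
        refine (mul_le_mul_right (h4 ⟨s, hsI⟩) _).trans ?_
        have hm := measurable_enorm_ext_left kn s
        simp only [Path.ext, projIcc_of_mem _ hsI] at hm
        refine (weight_mul_lexpTail_le hm (gevrey_add_le hs0 hs1) η).trans ?_
        refine lexpTail_mono_ae ?_ η
        filter_upwards [ih] with y hy
        exact hy ⟨s, hsI⟩
      calc gevrey t η * (ENNReal.ofReal (Real.exp (-(freq η ^ 4 * (t - s)))) *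
            (ENNReal.ofReal (freq η ^ 4) * ‖(convExpTail kn η).ext s‖ₑ))
          = (gevrey t η * ENNReal.ofReal (Real.exp (-(freq η ^ 4 * (t - s))))) *
            (quartic η * ‖(convExpTail kn η).ext s‖ₑ) := by rw [quartic]; ring
        _ ≤ (ENNReal.ofReal (Real.exp (-(3 / 4 * freq η ^ 4 * (t - s)))) * gevrey s η) *
            (quartic η * ‖(convExpTail kn η).ext s‖ₑ) := by
            gcongr ?_ * _
            exact gevrey_mul_exp_le hs.2 η
        _ = ENNReal.ofReal (Real.exp (-(3 / 4 * freq η ^ 4 * (t - s)))) *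
            (quartic η * (gevrey s η * ‖(convExpTail kn η).ext s‖ₑ)) := by ring
        _ ≤ _ := by gcongr

lemma gevrey_mul_le {k : Lp Path 1 (volume : Measure (Space d))}
    (hk₀ : ∀ᵐ η, ENNReal.ofReal (Real.exp (1 / 16)) * ‖k₀ η‖ₑ ≤ a η)
    (hk : Tendsto (fun n => (mildMap k₀)^[n] 0) atTop (𝓝 k)) :
    ∀ᵐ η, ∀ t : I, gevrey t η * ‖k η t‖ₑ ≤ majorantLim a t η := by
  refine ae_mem_of_tendsto_Lp hk
    (C := fun η => {g : Path | ∀ t : I, gevrey t η * ‖g t‖ₑ ≤ majorantLim a t η})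
    (fun η => ?_) fun n => ?_
  · rw [ofPred_forall]
    refine isClosed_iInter fun t => isClosed_le ?_ continuous_const
    exact (ENNReal.continuous_const_mul (by simp [gevrey])).comp (by fun_prop)
  · filter_upwards [gevrey_mul_iterate_le hk₀ n] with η hη t
    exact (hη t).trans (le_iSup (fun n => majorant a n t η) n)

/-- The nonlinearity of a function which is small in `L¹` at each time and square integrable in
frequency and time is square integrable. -/
lemma lintegral_sq_convExpTail_lt_top {k : Lp Path 1 (volume : Measure (Space d))} {Y : ℝ}
    (hY : 0 ≤ Y) (hkY : ∀ t : I, ∫⁻ η, ‖k η t‖ₑ ≤ ENNReal.ofReal Y)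
    (hk2 : ∫⁻ η, ∫⁻ s in Ioc 0 1, ‖(k η).ext s‖ₑ ^ 2 < ⊤) :
    ∫⁻ η, ∫⁻ s in Ioc 0 1, ‖(convExpTail k η).ext s‖ₑ ^ 2 < ⊤ := by
  have hm := measurable_enorm_ext k
  have hm2 := measurable_lexpTail_param (f := fun s η => ‖(k η).ext s‖ₑ)
    (hm.comp measurable_swap)
  calc ∫⁻ η, ∫⁻ s in Ioc 0 1, ‖(convExpTail k η).ext s‖ₑ ^ 2
      ≤ ∫⁻ η, ∫⁻ s in Ioc 0 1, lexpTail (fun η => ‖(k η).ext s‖ₑ) η ^ 2 := by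
        refine lintegral_mono_ae ?_
        filter_upwards [ae_enorm_convExpTail_apply_le k] with η hη
        refine lintegral_mono fun s => ?_
        gcongr
        exact hη _
    _ = ∫⁻ s in Ioc 0 1, ∫⁻ η, lexpTail (fun η => ‖(k η).ext s‖ₑ) η ^ 2 :=
        lintegral_lintegral_swap ((hm2.comp measurable_swap).pow_const 2).aemeasurable
    _ ≤ ∫⁻ s in Ioc 0 1, ENNReal.ofReal (Real.exp Y - 1) ^ 2 * ∫⁻ η, ‖(k η).ext s‖ₑ ^ 2 :=
        lintegral_mono fun s => lintegral_lexpTail_sq_le (measurable_enorm_ext_left k s) hY (hkY _)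
    _ = ENNReal.ofReal (Real.exp Y - 1) ^ 2 * ∫⁻ η, ∫⁻ s in Ioc 0 1, ‖(k η).ext s‖ₑ ^ 2 := by
        rw [lintegral_const_mul' _ _ (by finiteness), lintegral_lintegral_swap]
        exact ((hm.comp measurable_swap).pow_const 2).aemeasurable
    _ < ⊤ := ENNReal.mul_lt_top (by finiteness) hk2

/-- A mild solution divided by `|ξ|²` is dominated, uniformly in time, by a square integrable
function of the frequency. -/
lemma sq_mild_solution_le {k : Lp Path 1 (volume : Measure (Space d))} (hk : mildMap k₀ k = k)
    {f : Space d → ℝ≥0∞} (hf : ∀ᵐ η, ‖k₀ η‖ₑ ≤ ENNReal.ofReal (freq η ^ 2) * f η) :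
    ∀ᵐ η, ∀ t : I, ‖k η t‖ₑ ^ 2 ≤ quartic η *
      (2 * f η ^ 2 + 2 * ∫⁻ s in Ioc 0 1, ‖(convExpTail k η).ext s‖ₑ ^ 2) := by
  have h3 := Lp.coeFn_sub (freeEvol k₀) (duhamelL1 (convExpTail k))
  rw [← mildMap, hk] at h3
  filter_upwards [hf, coeFn_freeEvol k₀, coeFn_duhamelL1 (convExpTail k), h3] with η h0 h1 h2 h3 t
  set g := convExpTail k η
  have hgc : Measurable fun s => ‖g.ext s‖ₑ := g.continuous_ext.measurable.enorm
  have e1 : ‖k₀ η * decay (freq η ^ 4) t‖ₑ ^ 2 ≤ quartic η * f η ^ 2 := by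
    have hd : ‖decay (freq η ^ 4) t‖ₑ ≤ 1 := by
      rw [← ofReal_norm, ENNReal.ofReal_le_one]
      exact ((decay _).norm_coe_le_norm t).trans (norm_decay_le (by positivity))
    calc ‖k₀ η * decay (freq η ^ 4) t‖ₑ ^ 2 ≤ (ENNReal.ofReal (freq η ^ 2) * f η * 1) ^ 2 := by
          rw [enorm_mul]; gcongr
      _ = _ := by
          rw [mul_one, mul_pow, ← ENNReal.ofReal_pow (by positivity), quartic]
          ring_nf
  have e2 : ‖duhamel (freq η ^ 4) g t‖ₑ ^ 2 ≤
      quartic η * ∫⁻ s in Ioc 0 1, ‖g.ext s‖ₑ ^ 2 := by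
    calc ‖duhamel (freq η ^ 4) g t‖ₑ ^ 2
        ≤ (∫⁻ s in Ioc 0 (t : ℝ), ENNReal.ofReal (Real.exp (-(freq η ^ 4 * (t - s)))) *
            (ENNReal.ofReal (freq η ^ 4) * ‖g.ext s‖ₑ)) ^ 2 := by
          gcongr; exact enorm_duhamel_le (by positivity) _ _
      _ ≤ (∫⁻ s in Ioc 0 (t : ℝ), ENNReal.ofReal (Real.exp (-(freq η ^ 4 * (t - s)))) ^ 2) *
            ∫⁻ s in Ioc 0 (t : ℝ), (ENNReal.ofReal (freq η ^ 4) * ‖g.ext s‖ₑ) ^ 2 :=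
          sq_lintegral_mul_le _ (by fun_prop) (hgc.const_mul _).aemeasurable
      _ ≤ (∫⁻ s in Ioc 0 (t : ℝ), ENNReal.ofReal (Real.exp (-(freq η ^ 4 * (t - s)))) ^ 2) *
            (quartic η ^ 2 * ∫⁻ s in Ioc 0 1, ‖g.ext s‖ₑ ^ 2) := by
          simp_rw [mul_pow]
          rw [lintegral_const_mul' _ _ (by finiteness), quartic]
          gcongr
          exact t.2.2
      _ = quartic η * (∫⁻ s in Ioc 0 1, ‖g.ext s‖ₑ ^ 2) * (quartic η *
            ∫⁻ s in Ioc 0 (t : ℝ), ENNReal.ofReal (Real.exp (-(freq η ^ 4 * (t - s)))) ^ 2) := by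
          ring
      _ ≤ quartic η * (∫⁻ s in Ioc 0 1, ‖g.ext s‖ₑ ^ 2) * 1 := by
          gcongr
          refine le_trans ?_ (mul_lintegral_expKernel_le_one (freq η ^ 4) (by positivity) t)
          rw [quartic]
          refine mul_le_mul_right (setLIntegral_mono' measurableSet_Ioc fun s hs => ?_) _
          refine pow_le_of_le_one zero_le ?_ two_ne_zero
          rw [ENNReal.ofReal_le_one, Real.exp_le_one_iff, Left.neg_nonpos_iff]
          exact mul_nonneg (by positivity) (sub_nonneg.2 hs.2)
      _ = _ := mul_one _
  rw [h3, Pi.sub_apply, h1, h2, ContinuousMap.sub_apply, ContinuousMap.smul_apply, smul_eq_mul]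
  calc ‖k₀ η * decay (freq η ^ 4) t - duhamel (freq η ^ 4) g t‖ₑ ^ 2
      ≤ (‖k₀ η * decay (freq η ^ 4) t‖ₑ + ‖duhamel (freq η ^ 4) g t‖ₑ) ^ 2 := by
        gcongr; exact enorm_sub_le
    _ ≤ 2 * (‖k₀ η * decay (freq η ^ 4) t‖ₑ ^ 2 + ‖duhamel (freq η ^ 4) g t‖ₑ ^ 2) := by
        exact ennreal_add_sq_le _ _
    _ ≤ 2 * (quartic η * f η ^ 2 + quartic η * ∫⁻ s in Ioc 0 1, ‖g.ext s‖ₑ ^ 2) := by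
        exact mul_le_mul_right (add_le_add e1 e2) _
    _ = _ := by ring

end

/-! ### Partial derivatives of smooth functions -/

section

variable {d : ℕ}

/-- The partial derivative in the direction of the `i`-th basis vector. -/
def pderiv (i : Fin d) (f : Space d → ℝ) (x : Space d) : ℝ :=
  fderiv ℝ f x (EuclideanSpace.single i 1)

variable {f g : Space d → ℝ} {i : Fin d}

lemma contDiff_pderiv (hf : ContDiff ℝ ∞ f) : ContDiff ℝ ∞ (pderiv i f) :=
  (hf.fderiv_right (m := ∞) le_rfl).clm_apply contDiff_const

lemma differentiable_of_smooth (hf : ContDiff ℝ ∞ f) : Differentiable ℝ f :=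
  hf.differentiable (by simp)

lemma hasCompactSupport_pderiv (hf : HasCompactSupport f) : HasCompactSupport (pderiv i f) :=
  hf.fderiv_apply ℝ _

lemma IsTest.pderiv (hf : IsTest f) : IsTest (pderiv i f) :=
  ⟨contDiff_pderiv hf.1, hasCompactSupport_pderiv hf.2⟩

lemma pderiv_mul (hf : ContDiff ℝ ∞ f) (hg : ContDiff ℝ ∞ g) :
    pderiv i (fun x => f x * g x) = fun x => f x * pderiv i g x + pderiv i f x * g x := by
  ext x
  have h := fderiv_mul (differentiable_of_smooth hf x) (differentiable_of_smooth hg x)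
  have h' := congrArg (fun L => L (EuclideanSpace.single i 1)) h
  simp only [_root_.add_apply, _root_.smul_apply, smul_eq_mul] at h'
  simp only [pderiv]
  rw [mul_comm (fderiv ℝ f x _)]
  exact h'

lemma pderiv_add (hf : ContDiff ℝ ∞ f) (hg : ContDiff ℝ ∞ g) :
    pderiv i (fun x => f x + g x) = fun x => pderiv i f x + pderiv i g x := by
  ext x
  have h := fderiv_add (differentiable_of_smooth hf x) (differentiable_of_smooth hg x)
  have h' := congrArg (fun L => L (EuclideanSpace.single i 1)) h
  simp only [_root_.add_apply] at h'
  exact h'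

lemma laplacian_eq_sum_pderiv (hf : ContDiff ℝ ∞ f) :
    Δ f = fun x => ∑ i, pderiv i (pderiv i f) x := by
  rw [laplacian_eq_iteratedFDeriv_orthonormalBasis f (EuclideanSpace.basisFun (Fin d) ℝ)]
  ext x
  refine Finset.sum_congr rfl fun i _ => ?_
  have h1 : DifferentiableAt ℝ (fderiv ℝ f) x :=
    ((hf.fderiv_right (m := ∞) le_rfl).differentiable (by simp)) x
  rw [iteratedFDeriv_two_apply]
  simp only [pderiv, EuclideanSpace.basisFun_apply, Matrix.cons_val_zero, Matrix.cons_val_one]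
  change _ = (fderiv ℝ (fun y => fderiv ℝ f y (EuclideanSpace.single i 1)) x) _
  rw [fderiv_clm_apply h1 (differentiableAt_const _)]
  simp

lemma contDiff_laplacian (hf : ContDiff ℝ ∞ f) : ContDiff ℝ ∞ (Δ f) := by
  rw [laplacian_eq_sum_pderiv hf]
  exact ContDiff.sum fun i _ => contDiff_pderiv (contDiff_pderiv hf)

lemma IsTest.laplacian (hf : IsTest f) : IsTest (Δ f) := by
  refine ⟨contDiff_laplacian hf.1, ?_⟩
  refine hf.2.mono' fun x hx => ?_
  by_contra hx'
  refine hx ?_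
  rw [laplacian_eq_sum_pderiv hf.1]
  refine Finset.sum_eq_zero fun i _ => ?_
  refine image_eq_zero_of_notMem_tsupport fun h => hx' ?_
  exact (tsupport_fderiv_apply_subset ℝ _).trans (tsupport_fderiv_apply_subset ℝ _) h

end

/-! ### Fourier transform: pairings, conjugation, Laplacians -/

section

open scoped unitInterval SchwartzMap Convolution

variable {d : ℕ}

lemma integral_fourier_L2_mul (f : Lp ℂ 2 (volume : Measure (Space d))) (ψ : 𝓢(Space d, ℂ)) :
    ∫ x, (𝓕 f : Lp ℂ 2 (volume : Measure (Space d))) x * ψ x = ∫ x, f x * 𝓕 ψ x := by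
  have h := congrArg (fun T : TemperedDistribution (Space d) ℂ => T ψ)
    (Lp.fourier_toTemperedDistribution_eq f)
  simp only [TemperedDistribution.fourier_apply, Lp.toTemperedDistribution_apply,
    smul_eq_mul] at h
  simpa only [mul_comm] using h.symm

lemma integral_fourierInv_L2_mul (F : Lp ℂ 2 (volume : Measure (Space d)))
    (ψ : 𝓢(Space d, ℂ)) :
    ∫ x, (𝓕⁻ F : Lp ℂ 2 (volume : Measure (Space d))) x * ψ x = ∫ x, F x * 𝓕⁻ ψ x := by
  have h := integral_fourier_L2_mul (𝓕⁻ F) (𝓕⁻ ψ)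
  rw [fourier_fourierInv_eq, fourier_fourierInv_eq] at h
  exact h.symm

lemma integral_fourierInv_mul {k g : Space d → ℂ} (hk : Integrable k) (hg : Integrable g) :
    ∫ x, 𝓕⁻ k x * g x = ∫ x, k x * 𝓕⁻ g x := by
  have h := VectorFourier.integral_fourierIntegral_smul_eq_flip (L := innerₗ (Space d))
    Real.continuous_fourierChar continuous_inner hk hg.comp_neg
  have h1 : ∫ x, 𝓕⁻ k x * g x = ∫ x, 𝓕 k x * g (-x) := by
    rw [← integral_neg_eq_self]
    simp [Real.fourierInv_eq_fourier_neg]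
  rw [h1]
  refine h.trans (integral_congr_ae (Eventually.of_forall fun x => ?_))
  simp only [smul_eq_mul]
  congr 1
  rw [Real.fourierInv_eq_fourier_comp_neg, flip_innerₗ]
  rfl

/-- Test functions as complex valued Schwartz functions. -/
def IsTest.toSchwartz {φ : Space d → ℝ} (hφ : IsTest φ) : 𝓢(Space d, ℂ) :=
  HasCompactSupport.toSchwartzMap (f := fun x => (φ x : ℂ))
    (hφ.2.comp_left (g := Complex.ofReal) Complex.ofReal_zero)
    (Complex.ofRealCLM.contDiff.comp hφ.1)

lemma IsTest.toSchwartz_apply {φ : Space d → ℝ} (hφ : IsTest φ) (x : Space d) :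
    hφ.toSchwartz x = φ x := rfl

lemma IsTest.laplacian_toSchwartz_apply {φ : Space d → ℝ} (hφ : IsTest φ) (x : Space d) :
    (Δ hφ.toSchwartz) x = ((Δ φ x : ℝ) : ℂ) := by
  rw [SchwartzMap.laplacian_apply]
  have h2 : ContDiffAt ℝ 2 φ x := (contDiff_infty.1 hφ.1 2).contDiffAt
  exact h2.laplacian_CLM_comp_left (l := Complex.ofRealCLM)

lemma fourierInv_laplacian (ψ : 𝓢(Space d, ℂ)) (η : Space d) :
    𝓕⁻ (Δ ψ) η = -(freq η : ℂ) ^ 2 * 𝓕⁻ ψ η := by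
  have hT : Function.HasTemperateGrowth (fun x : Space d => ‖x‖ ^ 2) := by fun_prop
  have h : 𝓕 (Δ ψ) = -(2 * Real.pi) ^ 2 • SchwartzMap.smulLeftCLM ℂ (fun x : Space d => ‖x‖ ^ 2)
      (𝓕 ψ) := by
    rw [SchwartzMap.laplacian_eq_fourierMultiplierCLM, FourierTransform.fourier_smul,
      SchwartzMap.fourierMultiplierCLM_apply, fourier_fourierInv_eq]
  have h1 : ∀ φ : 𝓢(Space d, ℂ), 𝓕⁻ φ η = 𝓕 φ (-η) := fun φ => by
    rw [SchwartzMap.fourierInv_coe, Real.fourierInv_eq_fourier_neg, SchwartzMap.fourier_coe]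
  rw [h1, h1, h, _root_.smul_apply, SchwartzMap.smulLeftCLM_apply_apply hT]
  simp only [norm_neg, freq, Complex.real_smul, neg_smul]
  push_cast
  ring

lemma integral_laplacian_eq_zero {φ : Space d → ℝ} (hφ : IsTest φ) : ∫ x, Δ φ x = 0 := by
  have h := fourierInv_laplacian hφ.toSchwartz 0
  rw [SchwartzMap.fourierInv_coe, Real.fourierInv_eq'] at h
  simp only [freq, norm_zero, mul_zero, Complex.ofReal_zero, inner_zero_right] at h
  simp only [hφ.laplacian_toSchwartz_apply, zero_mul, Complex.exp_zero, one_smul] at h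
  rw [integral_complex_ofReal] at h
  simpa using h

lemma fourierInv_neg_of_real {g : Space d → ℂ} (hg : ∀ x, star (g x) = g x) (η : Space d) :
    𝓕⁻ g (-η) = star (𝓕⁻ g η) := by
  rw [Real.fourierInv_eq', Real.fourierInv_eq', Complex.star_def, ← integral_conj]
  congr 1 with x
  have := hg x
  rw [Complex.star_def] at this
  simp [this, ← Complex.exp_conj, map_ofNat]

/-! ### Hermitian functions -/

/-- Hermitian symmetry up to null sets, which characterizes the Fourier transforms of real
functions. -/
def HermitianAE {R : Type*} [Star R] (f : Space d → R) : Prop := ∀ᵐ x, f (-x) = star (f x)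

lemma ae_comp_neg {p : Space d → Prop} (h : ∀ᵐ x, p x) : ∀ᵐ x, p (-x) :=
  (Measure.measurePreserving_neg (volume : Measure (Space d))).quasiMeasurePreserving.ae h

lemma HermitianAE.congr {R : Type*} [Star R] {f g : Space d → R} (hf : HermitianAE f)
    (h : f =ᵐ[volume] g) : HermitianAE g := by
  filter_upwards [hf, h, ae_comp_neg h] with x h1 h2 h3
  rw [← h3, h1, h2]

lemma HermitianAE.sub {f g : Lp Path 1 (volume : Measure (Space d))}
    (hf : HermitianAE f) (hg : HermitianAE g) : HermitianAE (f - g : Lp Path 1 volume) := by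
  have h := Lp.coeFn_sub f g
  filter_upwards [hf, hg, h, ae_comp_neg h] with x h1 h2 h3 h4
  rw [h3, h4, Pi.sub_apply, Pi.sub_apply, h1, h2, star_sub]

lemma HermitianAE.add {f g : Lp Path 1 (volume : Measure (Space d))}
    (hf : HermitianAE f) (hg : HermitianAE g) : HermitianAE (f + g : Lp Path 1 volume) := by
  have h := Lp.coeFn_add f g
  filter_upwards [hf, hg, h, ae_comp_neg h] with x h1 h2 h3 h4
  rw [h3, h4, Pi.add_apply, Pi.add_apply, h1, h2, star_add]

lemma hermitianAE_zero : HermitianAE (0 : Lp Path 1 (volume : Measure (Space d))) := by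
  have h := Lp.coeFn_zero Path 1 (volume : Measure (Space d))
  filter_upwards [h, ae_comp_neg h] with x h1 h2
  rw [h1, h2]
  simp

lemma hermitianAE_of_tendsto {f : ℕ → Lp Path 1 (volume : Measure (Space d))}
    {g : Lp Path 1 (volume : Measure (Space d))} (h : Tendsto f atTop (𝓝 g))
    (hf : ∀ n, HermitianAE (f n)) : HermitianAE g := by
  obtain ⟨ns, -, hns⟩ := (tendstoInMeasure_of_tendsto_Lp h).exists_seq_tendsto_ae
  filter_upwards [hns, ae_comp_neg hns, ae_all_iff.2 fun n => hf (ns n)] with x h1 h2 h3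
  refine tendsto_nhds_unique h2 ?_
  simp only [h3]
  exact (continuous_star.tendsto _).comp h1

lemma hermitianAE_convolution {f g : Space d → Path} (hf : HermitianAE f) (hg : HermitianAE g) :
    HermitianAE (f ⋆[ContinuousLinearMap.mul ℂ Path] g) := by
  refine Eventually.of_forall fun x => ?_
  have hg' : ∀ᵐ y, g (-(x - y)) = star (g (x - y)) :=
    (quasiMeasurePreserving_sub_left_of_right_invariant volume x).ae hg
  rw [convolution_def, convolution_def, ← integral_neg_eq_self]
  have h := (starL' ℝ : Path ≃L[ℝ] Path).integral_comp_comm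
    (fun y => ContinuousLinearMap.mul ℂ Path (f y) (g (x - y))) (μ := volume)
  refine Eq.trans ?_ h
  refine integral_congr_ae ?_
  filter_upwards [hf, hg'] with y h1 h2
  simp only [ContinuousLinearMap.mul_apply']
  rw [h1, show -x - -y = -(x - y) by abel, h2]
  exact (star_mul' (f y) (g (x - y))).symm

lemma hermitianAE_convPow {k : Lp Path 1 (volume : Measure (Space d))} (hk : HermitianAE k)
    (n : ℕ) : HermitianAE (convPow k n) := by
  induction n with
  | zero => exact hk
  | succ n ih => exact (hermitianAE_convolution hk ih).congr (coeFn_convL1 k (convPow k n)).symm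

lemma hermitianAE_convExpTail {k : Lp Path 1 (volume : Measure (Space d))}
    (hk : HermitianAE k) : HermitianAE (convExpTail k) := by
  refine hermitianAE_of_tendsto (summable_convExpTail k).hasSum.tendsto_sum_nat fun N => ?_
  induction N with
  | zero =>
    simp only [Finset.range_zero, Finset.sum_empty]
    exact hermitianAE_zero
  | succ N ih =>
    rw [Finset.sum_range_succ]
    have h1 : HermitianAE (((N + 2).factorial : ℂ)⁻¹ • convPow k (N + 1) :
        Lp Path 1 (volume : Measure (Space d))) := by
      have h := Lp.coeFn_smul ((N + 2).factorial : ℂ)⁻¹ (convPow k (N + 1))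
      filter_upwards [hermitianAE_convPow hk (N + 1), h, ae_comp_neg h] with x hx h2 h3
      rw [h3, h2, Pi.smul_apply, Pi.smul_apply, hx, star_smul]
      simp
    exact ih.add h1

lemma star_duhamel (a : ℝ) (g : Path) : duhamel a (star g) = star (duhamel a g) := by
  ext t
  simp only [duhamel, ContinuousMap.coe_mk, ContinuousMap.star_apply, Complex.star_def]
  rw [← intervalIntegral.intervalIntegral_conj]
  simp [Path.ext, ← Complex.exp_conj]

lemma hermitianAE_smul_decay {q : Space d → ℝ} (hq : ∀ x, q (-x) = q x) {c : Space d → ℂ}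
    (hc : HermitianAE c) : HermitianAE fun x => c x • decay (q x) := by
  filter_upwards [hc] with x hx
  ext t
  simp [hx, hq, decay, ← Complex.exp_conj]

lemma hermitianAE_duhamel {q : Space d → ℝ} (hq : ∀ x, q (-x) = q x) {g : Space d → Path}
    (hg : HermitianAE g) : HermitianAE fun x => duhamel (q x) (g x) := by
  filter_upwards [hg] with x hx
  rw [hx, hq, star_duhamel]

lemma hermitianAE_mildMap {k₀ : Lp ℂ 1 (volume : Measure (Space d))}
    {k : Lp Path 1 (volume : Measure (Space d))} (hk₀ : HermitianAE k₀) (hk : HermitianAE k) :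
    HermitianAE (mildMap k₀ k) := by
  have hq : ∀ x : Space d, freq (-x) ^ 4 = freq x ^ 4 := fun x => by rw [freq_neg]
  have h1 : HermitianAE (freeEvol k₀) :=
    (hermitianAE_smul_decay hq hk₀).congr (coeFn_freeEvol k₀).symm
  have h2 : HermitianAE (duhamelL1 (convExpTail k)) :=
    (hermitianAE_duhamel hq (hermitianAE_convExpTail hk)).congr
      (coeFn_duhamelL1 (convExpTail k)).symm
  exact h1.sub h2

lemma hermitianAE_of_tendsto_iterate {k₀ : Lp ℂ 1 (volume : Measure (Space d))}
    {k : Lp Path 1 (volume : Measure (Space d))} (hk₀ : HermitianAE k₀)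
    (hk : Tendsto (fun n => (mildMap k₀)^[n] 0) atTop (𝓝 k)) : HermitianAE k := by
  refine hermitianAE_of_tendsto hk fun n => ?_
  induction n with
  | zero => exact hermitianAE_zero
  | succ n ih =>
    rw [Function.iterate_succ_apply']
    exact hermitianAE_mildMap hk₀ ih

/-- The inverse Fourier transform of a Hermitian function is real. -/
lemma star_fourierInv {k : Space d → ℂ} (hk : HermitianAE k) (x : Space d) :
    star (𝓕⁻ k x) = 𝓕⁻ k x := by
  rw [Real.fourierInv_eq', Complex.star_def, ← integral_conj, ← integral_neg_eq_self]
  refine integral_congr_ae ?_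
  filter_upwards [hk] with y hy
  simp [hy, ← Complex.exp_conj, map_ofNat]

lemma locallyIntegrable_L2 {E : Type*} [NormedAddCommGroup E]
    (f : Lp E 2 (volume : Measure (Space d))) : LocallyIntegrable f :=
  (Lp.memLp f).locallyIntegrable one_le_two

/-- The inverse Fourier transform on `L²` of a Hermitian function is real. -/
lemma im_fourierInv_L2 {F : Lp ℂ 2 (volume : Measure (Space d))} (hF : HermitianAE F) :
    ∀ᵐ x, ((𝓕⁻ F : Lp ℂ 2 (volume : Measure (Space d))) x).im = 0 := by
  set f : Lp ℂ 2 (volume : Measure (Space d)) := 𝓕⁻ F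
  have hf : LocallyIntegrable fun x => (f x).im := fun x => by
    obtain ⟨s, hs, h⟩ := locallyIntegrable_L2 f x
    exact ⟨s, hs, h.im⟩
  refine ae_eq_zero_of_integral_contDiff_smul_eq_zero hf fun φ h1 h2 => ?_
  have hφ : IsTest φ := ⟨h1, h2⟩
  have h := integral_fourierInv_L2_mul F hφ.toSchwartz
  have hr : star (∫ x, F x * 𝓕⁻ hφ.toSchwartz x) = ∫ x, F x * 𝓕⁻ hφ.toSchwartz x := by
    rw [Complex.star_def, ← integral_conj, ← integral_neg_eq_self]
    refine integral_congr_ae ?_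
    filter_upwards [hF] with y hy
    rw [SchwartzMap.fourierInv_coe, fourierInv_neg_of_real
      (fun x => by simp [hφ.toSchwartz_apply]), hy]
    simp
  have hi : Integrable fun x => f x * hφ.toSchwartz x :=
    (Lp.memLp f).integrable_mul (hφ.toSchwartz.memLp 2)
  rw [← h] at hr
  have h3 := Complex.conj_eq_iff_im.1 hr
  have h4 := integral_im hi
  simp only [RCLike.im_to_complex] at h4
  rw [h3] at h4
  rw [← h4]
  congr 1 with x
  simp [hφ.toSchwartz_apply, mul_comm]

end

/-! ### Real functions and their Laplacians -/

section

open scoped unitInterval SchwartzMap Convolution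

variable {d : ℕ}

/-- The `L²` Fourier transform of a real valued function. -/
abbrev fourierR (f : F02 d) : Lp ℂ 2 (volume : Measure (Space d)) :=
  𝓕 (Complex.ofRealCLM.compLp f)

lemma integral_ofReal_mul_test (f : F02 d) (g : Space d → ℝ) :
    ∫ x, (Complex.ofRealCLM.compLp f : Lp ℂ 2 (volume : Measure (Space d))) x * (g x : ℂ) =
      ((∫ x, f x * g x : ℝ) : ℂ) := by
  rw [← integral_complex_ofReal]
  refine integral_congr_ae ?_
  filter_upwards [Complex.ofRealCLM.coeFn_compLp f] with x hx
  rw [hx]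
  simp

/-- The Fourier transform of a real function is Hermitian. -/
lemma hermitianAE_fourierR (f : F02 d) : HermitianAE (fourierR f) := by
  have hL := locallyIntegrable_L2 (fourierR f)
  have h1 : LocallyIntegrable fun x => fourierR f (-x) := by
    have h := (Lp.memLp (fourierR f)).comp_measurePreserving
      (Measure.measurePreserving_neg (volume : Measure (Space d)))
    exact h.locallyIntegrable one_le_two
  have h2 : LocallyIntegrable fun x => star (fourierR f x) :=
    (Lp.memLp (fourierR f)).star.locallyIntegrable one_le_two
  refine ae_eq_of_integral_contDiff_smul_eq h1 h2 fun φ hφ1 hφ2 => ?_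
  have hφ : IsTest φ := ⟨hφ1, hφ2⟩
  have hφ' : IsTest fun x => φ (-x) :=
    ⟨hφ1.comp contDiff_neg, hφ2.comp_homeomorph (Homeomorph.neg _)⟩
  have e1 : ∫ x, φ x • fourierR f (-x) = ∫ x, fourierR f x * hφ'.toSchwartz x := by
    rw [← integral_neg_eq_self]
    refine integral_congr_ae (Eventually.of_forall fun x => ?_)
    simp [hφ'.toSchwartz_apply, mul_comm]
  have e2 : ∫ x, φ x • star (fourierR f x) = star (∫ x, fourierR f x * hφ.toSchwartz x) := by
    rw [Complex.star_def, ← integral_conj]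
    refine integral_congr_ae (Eventually.of_forall fun x => ?_)
    simp [hφ.toSchwartz_apply, mul_comm]
  rw [e1, e2, integral_fourier_L2_mul, integral_fourier_L2_mul, Complex.star_def,
    ← integral_conj]
  refine integral_congr_ae ?_
  filter_upwards [Complex.ofRealCLM.coeFn_compLp f] with x hx
  have h3 := fourierInv_neg_of_real (g := hφ.toSchwartz)
    (fun x => by simp [hφ.toSchwartz_apply]) (-x)
  rw [neg_neg, Real.fourierInv_eq_fourier_neg _ (-x), neg_neg,
    Real.fourierInv_eq_fourier_comp_neg] at h3
  rw [hx, SchwartzMap.fourier_coe, SchwartzMap.fourier_coe, map_mul]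
  simp only [Complex.ofRealCLM_apply, Complex.conj_ofReal]
  rw [← Complex.star_def, ← h3]
  rfl

/-- A function whose Fourier transform has an integrable second moment has a bounded and
continuous Laplacian. -/
lemma isWeakLaplacian_of_fourier {f : F02 d} {k : Space d → ℂ} (hk : Integrable k)
    (hfk : ∀ᵐ η, k η = (freq η : ℂ) ^ 2 * fourierR f η) :
    IsWeakLaplacian f fun x => -(𝓕⁻ k x).re := by
  have hcont : Continuous (𝓕⁻ k) := by
    have := (Real.Lp.fourierTransformInv (hk.toL1 k)).continuous
    rw [Real.Lp.coe_fourierTransformInv] at this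
    exact this.congr fun x => Real.fourierInv_congr_ae hk.coeFn_toL1 x
  refine ⟨(Complex.continuous_re.comp hcont).neg.locallyIntegrable, fun φ hφ => ?_⟩
  have h1 := integral_ofReal_mul_test f (Δ φ)
  have h2 := integral_fourierInv_L2_mul (fourierR f) (Δ hφ.toSchwartz)
  rw [fourierInv_fourier_eq] at h2
  simp only [hφ.laplacian_toSchwartz_apply] at h2
  have h3 : ∫ x, fourierR f x * 𝓕⁻ (Δ hφ.toSchwartz) x = -∫ x, k x * 𝓕⁻ hφ.toSchwartz x := by
    rw [← integral_neg]
    refine integral_congr_ae ?_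
    filter_upwards [hfk] with x hx
    rw [fourierInv_laplacian, hx]
    ring
  have h4 := integral_fourierInv_mul hk hφ.toSchwartz.integrable
  rw [SchwartzMap.fourierInv_coe hφ.toSchwartz, ← h4] at h3
  rw [h1, h3] at h2
  have hi : Integrable fun x => 𝓕⁻ k x * hφ.toSchwartz x :=
    (hφ.toSchwartz.continuous.mul hcont).integrable_of_hasCompactSupport
      ((hφ.2.comp_left (g := Complex.ofReal) Complex.ofReal_zero).mul_right) |>.congr
      (Eventually.of_forall fun x => mul_comm _ _)
  have h5 := congrArg Complex.re h2
  rw [Complex.ofReal_re, Complex.neg_re] at h5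
  rw [h5]
  have h6 := integral_re hi
  simp only [RCLike.re_to_complex] at h6
  rw [← h6, ← integral_neg]
  simp [hφ.toSchwartz_apply]

/-! ### The exponential of a Fourier transform -/

/-- The inverse Fourier transform of a path valued function at the point `x`. -/
def evalInv (x : Space d) : Lp Path 1 (volume : Measure (Space d)) →L[ℂ] Path :=
  (BoundedContinuousFunction.evalCLM ℂ x).comp (Real.Lp.fourierTransformInvCLM (Space d) Path)

lemma evalInv_apply (x : Space d) (k : Lp Path 1 (volume : Measure (Space d))) :
    evalInv x k = 𝓕⁻ (k : Space d → Path) x := by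
  simp [evalInv]

lemma evalInv_convL1 (x : Space d) (k l : Lp Path 1 (volume : Measure (Space d))) :
    evalInv x (convL1 k l) = evalInv x k * evalInv x l := by
  simp only [evalInv_apply]
  rw [Real.fourierInv_congr_ae (coeFn_convL1 k l) x]
  simp only [Real.fourierInv_eq_fourier_neg]
  exact Real.fourier_mul_convolution_eq (L1.integrable_coeFn k) (L1.integrable_coeFn l) _

lemma evalInv_convPow (x : Space d) (k : Lp Path 1 (volume : Measure (Space d))) (n : ℕ) :
    evalInv x (convPow k n) = evalInv x k ^ (n + 1) := by
  induction n with
  | zero => simp [convPow]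
  | succ n ih => rw [convPow, evalInv_convL1, ih, pow_succ' _ (n + 1)]

/-- The inverse Fourier transform turns the convolution exponential into the exponential. -/
lemma evalInv_add_convExpTail (x : Space d) (k : Lp Path 1 (volume : Measure (Space d)))
    (t : I) : evalInv x (k + convExpTail k) t = Complex.exp (evalInv x k t) - 1 := by
  have h1 := ((summable_convExpTail k).hasSum.mapL (evalInv x)).mapL
    (ContinuousMap.evalCLM ℂ t : Path →L[ℂ] ℂ)
  simp only [map_smul, evalInv_convPow] at h1
  set z := evalInv x k t with hz
  have h2 : HasSum (fun n : ℕ => z ^ n / (n.factorial : ℂ)) (Complex.exp z) := by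
    have := NormedSpace.expSeries_div_hasSum_exp (𝔸 := ℂ) z
    rwa [← Complex.exp_eq_exp_ℂ] at this
  have h3 := (hasSum_nat_add_iff' 2).2 h2
  have h4 : HasSum (fun n : ℕ => z ^ (n + 2) / ((n + 2).factorial : ℂ))
      (evalInv x (convExpTail k) t) := by
    convert h1 using 2 with n
    swap
    · rfl
    simp only [smul_eq_mul, ContinuousMap.evalCLM_apply, ContinuousMap.pow_apply, hz]
    rw [div_eq_inv_mul]
  have h5 := h4.unique h3
  rw [map_add, ContinuousMap.add_apply, h5, ← hz]
  simp only [Finset.sum_range_succ, Finset.range_zero, Finset.sum_empty, pow_zero, pow_one,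
    Nat.factorial, Nat.cast_one, div_one, mul_one, zero_add]
  ring

lemma evalInv_apply_apply (x : Space d) (k : Lp Path 1 (volume : Measure (Space d))) (t : I) :
    evalInv x k t = 𝓕⁻ (fun η => k η t) x := by
  rw [evalInv_apply, Real.fourierInv_eq_fourier_neg, Real.fourierInv_eq_fourier_neg,
    Real.fourier_eq, Real.fourier_eq]
  have h := (ContinuousMap.evalCLM ℂ t : Path →L[ℂ] ℂ).integral_comp_comm
    ((Real.fourierIntegral_convergent_iff (-x)).2 (L1.integrable_coeFn k))
  exact h.symm

/-! ### Fourier norms in the two normalizations -/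

/-- The change of variables between the two normalizations of the Fourier transform. -/
lemma lintegral_mul_enorm_hat (f : F02 d) (w : Space d → ℝ≥0∞) (hw : Measurable w) :
    ∫⁻ ξ, w ξ * ‖hat f ξ‖ₑ = ENNReal.ofReal ((2 * Real.pi) ^ ((d : ℝ) / 2)) *
      ∫⁻ η, w ((2 * Real.pi) • η) * ‖fourierR f η‖ₑ := by
  have hpi : (0 : ℝ) < 2 * Real.pi := by positivity
  have hm : Measurable fun η => w ((2 * Real.pi) • η) * ‖fourierR f η‖ₑ :=
    (hw.comp (measurable_const_smul _)).mul (Lp.stronglyMeasurable (fourierR f)).enorm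
  have h1 := Measure.map_addHaar_smul (volume : Measure (Space d)) (inv_ne_zero hpi.ne')
  have h2 : ∫⁻ ξ : Space d, w ((2 * Real.pi) • ((2 * Real.pi)⁻¹ • ξ)) *
      ‖fourierR f ((2 * Real.pi)⁻¹ • ξ)‖ₑ = ENNReal.ofReal ((2 * Real.pi) ^ (d : ℝ)) *
        ∫⁻ η, w ((2 * Real.pi) • η) * ‖fourierR f η‖ₑ := by
    rw [← lintegral_map hm (measurable_const_smul ((2 * Real.pi)⁻¹ : ℝ)), h1,
      lintegral_smul_measure]
    simp only [finrank_euclideanSpace, Fintype.card_fin, smul_eq_mul, inv_pow, inv_inv]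
    rw [abs_of_pos (by positivity), Real.rpow_natCast]
  have h3 : ∀ ξ, w ξ * ‖hat f ξ‖ₑ = ENNReal.ofReal ((2 * Real.pi) ^ (-(d : ℝ) / 2)) *
      (w ((2 * Real.pi) • ((2 * Real.pi)⁻¹ • ξ)) * ‖fourierR f ((2 * Real.pi)⁻¹ • ξ)‖ₑ) := by
    intro ξ
    rw [smul_smul, mul_inv_cancel₀ hpi.ne', one_smul, hat, enorm_mul, mul_left_comm]
    congr 1
    rw [← ofReal_norm, Complex.norm_real, Real.norm_of_nonneg (by positivity)]
  simp only [h3]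
  rw [lintegral_const_mul' _ _ ENNReal.ofReal_ne_top, h2, ← mul_assoc,
    ← ENNReal.ofReal_mul (by positivity), ← Real.rpow_add hpi]
  congr 3
  ring

/-- The second moment of the Fourier transform with the analytic weight `exp (ν |ξ|)`. The transform
is Mathlib's, so that `analyticNorm` and `sNorm` are `(2π)^(d/2)` times this moment.-/
def moment (ν : ℝ) (f : F02 d) : ℝ≥0∞ :=
  ∫⁻ η, ENNReal.ofReal (freq η ^ 2 * Real.exp (ν * freq η)) * ‖fourierR f η‖ₑ

lemma analyticNorm_eq (ν : ℝ) (f : F02 d) : analyticNorm 2 1 ν f =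
    ENNReal.ofReal ((2 * Real.pi) ^ ((d : ℝ) / 2)) * moment ν f := by
  have h := lintegral_mul_enorm_hat f
    (fun ξ => ENNReal.ofReal (‖ξ‖ ^ 2 * Real.exp (ν * ‖ξ‖))) (by fun_prop)
  rw [analyticNorm, moment]
  simp only [div_one, ENNReal.rpow_one, mul_one, one_mul, Real.rpow_one]
  have e : ∀ ξ : Space d, ENNReal.ofReal (‖ξ‖ ^ (2 : ℝ) * Real.exp (ν * ‖ξ‖) * ‖hat f ξ‖) =
      ENNReal.ofReal (‖ξ‖ ^ 2 * Real.exp (ν * ‖ξ‖)) * ‖hat f ξ‖ₑ := fun ξ => by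
    rw [ENNReal.ofReal_mul (by positivity), ofReal_norm]
    norm_num
  simp only [e]
  rw [h]
  congr 2
  ext η
  simp [norm_smul, freq, abs_of_pos Real.pi_pos]

lemma sNorm_eq_analyticNorm (f : F02 d) : sNorm 2 f = analyticNorm 2 1 0 f := by
  simp [sNorm, analyticNorm]

lemma sNorm_eq (f : F02 d) : sNorm 2 f =
    ENNReal.ofReal ((2 * Real.pi) ^ ((d : ℝ) / 2)) * moment 0 f := by
  rw [sNorm_eq_analyticNorm, analyticNorm_eq]

lemma two_le_rpow (hd : 1 ≤ d) : 2 ≤ (2 * Real.pi) ^ ((d : ℝ) / 2) := by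
  have hpi := Real.pi_gt_three
  have h1 : (1 : ℝ) ≤ d := by exact_mod_cast hd
  calc (2 : ℝ) = ((2 : ℝ) ^ 2) ^ (1 / 2 : ℝ) := by
        rw [← Real.sqrt_eq_rpow, Real.sqrt_sq (by norm_num)]
    _ ≤ (2 * Real.pi) ^ (1 / 2 : ℝ) := by
        refine Real.rpow_le_rpow (by norm_num) (by nlinarith) (by norm_num)
    _ ≤ _ := Real.rpow_le_rpow_of_exponent_le (by nlinarith) (by linarith)

lemma eight_mul_le_fTwo {y : ℝ} (hy : 0 ≤ y) : 8 * y ≤ fTwo y := by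
  have h := Real.add_one_le_exp y
  have h2 : 0 ≤ y ^ 3 + 6 * y ^ 2 + 7 * y + 1 := by positivity
  have h3 := mul_le_mul_of_nonneg_left h h2
  rw [fTwo]
  nlinarith [pow_nonneg hy 3, pow_nonneg hy 2, pow_nonneg hy 4]

/-- The smallness assumption of the theorem gives a factor of smallness in dimension `d ≥ 1`. -/
lemma moment_le_of_sNorm_lt (hd : 1 ≤ d) {y : ℝ} (hy : 0 < y) (hfy : fTwo y ≤ 1) {f : F02 d}
    (hf : sNorm 2 f < ENNReal.ofReal y) : moment 0 f ≤ ENNReal.ofReal (1 / 16) := by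
  have h8 := eight_mul_le_fTwo hy.le
  have h1 : 2 * moment 0 f ≤ ENNReal.ofReal (1 / 8) := by
    calc 2 * moment 0 f
        ≤ ENNReal.ofReal ((2 * Real.pi) ^ ((d : ℝ) / 2)) * moment 0 f := by
          gcongr
          rw [← ENNReal.ofReal_ofNat]
          exact ENNReal.ofReal_le_ofReal (two_le_rpow hd)
      _ ≤ ENNReal.ofReal y := (sNorm_eq f ▸ hf).le
      _ ≤ _ := ENNReal.ofReal_le_ofReal (by linarith)
  have h2 : ENNReal.ofReal (1 / 8) = 2 * ENNReal.ofReal (1 / 16) := by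
    rw [← ENNReal.ofReal_ofNat, ← ENNReal.ofReal_mul (by norm_num)]
    norm_num
  rw [h2] at h1
  exact (ENNReal.mul_le_mul_iff_right (by norm_num) (by norm_num)).1 h1

end

/-! ### Regularity of the mild solution -/

section

open scoped unitInterval SchwartzMap Convolution

variable {d : ℕ}

lemma memLp_two_of_sq_le {α : Type*} [MeasurableSpace α] {μ : Measure α} {v : α → ℂ}
    (hv : AEStronglyMeasurable v μ) {G : α → ℝ≥0∞} (hG : ∫⁻ x, G x ∂μ < ⊤)
    (h : ∀ᵐ x ∂μ, ‖v x‖ₑ ^ 2 ≤ G x) : MemLp v 2 μ := by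
  refine ⟨hv, ?_⟩
  rw [eLpNorm_lt_top_iff_lintegral_rpow_enorm_lt_top (by norm_num) (by norm_num)]
  refine (lintegral_mono_ae ?_).trans_lt hG
  filter_upwards [h] with x hx
  simpa using hx

/-- A family of functions which is pointwise continuous in the parameter and dominated in `L²` is
continuous as a family in `L²`. -/
lemma continuous_toLp_of_dominated {α X : Type*} [MeasurableSpace α] {μ : Measure α}
    [TopologicalSpace X] [FirstCountableTopology X] {V : X → α → ℂ}
    (hV : ∀ t, AEStronglyMeasurable (V t) μ) {G : α → ℝ≥0∞} (hG : ∫⁻ x, G x ∂μ < ⊤)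
    (h : ∀ t, ∀ᵐ x ∂μ, ‖V t x‖ₑ ^ 2 ≤ G x) (hc : ∀ᵐ x ∂μ, Continuous fun t => V t x) :
    Continuous fun t => (memLp_two_of_sq_le (hV t) hG (h t)).toLp := by
  refine continuous_iff_continuousAt.2 fun t => ?_
  rw [ContinuousAt, Lp.tendsto_Lp_iff_tendsto_eLpNorm']
  have e : ∀ s, eLpNorm (⇑(memLp_two_of_sq_le (hV s) hG (h s)).toLp -
      ⇑(memLp_two_of_sq_le (hV t) hG (h t)).toLp) 2 μ =
      (∫⁻ x, ‖V s x - V t x‖ₑ ^ 2 ∂μ) ^ (1 / 2 : ℝ) := fun s => by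
    rw [eLpNorm_congr_ae ((MemLp.coeFn_toLp _).sub (MemLp.coeFn_toLp _)),
      eLpNorm_eq_lintegral_rpow_enorm_toReal (by norm_num) (by norm_num)]
    simp
  simp only [e]
  have h0 : Tendsto (fun s => ∫⁻ x, ‖V s x - V t x‖ₑ ^ 2 ∂μ) (𝓝 t) (𝓝 (∫⁻ _, 0 ∂μ)) := by
    refine tendsto_lintegral_filter_of_dominated_convergence' (fun x => 4 * G x)
      (Eventually.of_forall fun s => ((hV s).sub (hV t)).enorm.pow_const 2)
      (Eventually.of_forall fun s => ?_) ?_ ?_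
    · filter_upwards [h s, h t] with x hs ht
      calc ‖V s x - V t x‖ₑ ^ 2 ≤ (‖V s x‖ₑ + ‖V t x‖ₑ) ^ 2 := by gcongr; exact enorm_sub_le
        _ ≤ 2 * (‖V s x‖ₑ ^ 2 + ‖V t x‖ₑ ^ 2) := ennreal_add_sq_le _ _
        _ ≤ 2 * (G x + G x) := by gcongr
        _ = 4 * G x := by ring
    · rw [lintegral_const_mul' _ _ (by norm_num)]
      exact ENNReal.mul_ne_top (by norm_num) hG.ne
    · filter_upwards [hc] with x hx
      have : Tendsto (fun s => ‖V s x - V t x‖ₑ ^ 2) (𝓝 t) (𝓝 (‖V t x - V t x‖ₑ ^ 2)) :=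
        ((ENNReal.continuous_pow 2).comp (hx.sub continuous_const).enorm).tendsto t
      simpa using this
  rw [lintegral_zero] at h0
  simpa using h0.ennrpow_const (1 / 2 : ℝ)

lemma ae_freq_ne_zero (hd : 1 ≤ d) : ∀ᵐ η : Space d, freq η ≠ 0 := by
  have : Nontrivial (Space d) := by
    have : Nonempty (Fin d) := ⟨⟨0, hd⟩⟩
    infer_instance
  filter_upwards [Measure.ae_ne volume (0 : Space d)] with η hη
  simp [freq, hη, Real.pi_ne_zero]

/-- The mild solution in Fourier variables, with its analytic and square integrable bounds. -/
lemma exists_bounded_mild_solution {F₀ : Lp ℂ 2 (volume : Measure (Space d))}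
    (hF₀ : HermitianAE F₀) {y : ℝ} (hy0 : 0 ≤ y) (hy : y ≤ 1 / 16)
    (hF₀y : ∫⁻ η, ENNReal.ofReal (freq η ^ 2) * ‖F₀ η‖ₑ ≤ ENNReal.ofReal y) :
    ∃ (k₀ : Lp ℂ 1 (volume : Measure (Space d))) (k : Lp Path 1 (volume : Measure (Space d)))
      (G : Space d → ℝ≥0∞), (∀ᵐ η, k₀ η = (freq η : ℂ) ^ 2 * F₀ η) ∧ mildMap k₀ k = k ∧
      HermitianAE k ∧
      (∀ t : I, ∫⁻ η, gevrey t η * ‖k η t‖ₑ ≤ ENNReal.ofReal (Real.exp (1 / 16) * y)) ∧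
      ∫⁻ η, G η < ⊤ ∧ ∀ᵐ η, ∀ t : I, ‖k η t‖ₑ ^ 2 ≤ quartic η * G η := by
  have hmF : Measurable fun η => ‖F₀ η‖ₑ := (Lp.stronglyMeasurable F₀).enorm
  have hcq : Continuous fun η : Space d => freq η ^ 2 := by fun_prop
  have he : ∀ η, ‖(freq η : ℂ) ^ 2 * F₀ η‖ₑ = ENNReal.ofReal (freq η ^ 2) * ‖F₀ η‖ₑ := fun η => by
    rw [enorm_mul, ← Complex.ofReal_pow, ← ofReal_norm, Complex.norm_real,
      Real.norm_of_nonneg (by positivity)]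
  have hi : Integrable fun η => (freq η : ℂ) ^ 2 * F₀ η := by
    refine ⟨?_, ?_⟩
    · refine AEStronglyMeasurable.mul ?_ (Lp.aestronglyMeasurable F₀)
      exact (by fun_prop : Continuous fun η : Space d => (freq η : ℂ) ^ 2).aestronglyMeasurable
    · simp only [HasFiniteIntegral, he]
      exact hF₀y.trans_lt ENNReal.ofReal_lt_top
  set k₀ := hi.toL1 with hk₀
  have hk₀' : ∀ᵐ η, k₀ η = (freq η : ℂ) ^ 2 * F₀ η := hi.coeFn_toL1
  have hnorm : ‖k₀‖ ≤ 1 / 8 := by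
    rw [← ENNReal.ofReal_le_ofReal_iff (by norm_num), ofReal_norm_L1]
    calc ∫⁻ η, ‖k₀ η‖ₑ = ∫⁻ η, ENNReal.ofReal (freq η ^ 2) * ‖F₀ η‖ₑ := by
          refine lintegral_congr_ae ?_
          filter_upwards [hk₀'] with η hη
          rw [hη, he]
      _ ≤ ENNReal.ofReal y := hF₀y
      _ ≤ _ := ENNReal.ofReal_le_ofReal (by linarith)
  obtain ⟨k, -, hk, hlim⟩ := exists_mild_solution hnorm
  have hH : HermitianAE k := by
    refine hermitianAE_of_tendsto_iterate ?_ hlim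
    have h : HermitianAE fun η => (freq η : ℂ) ^ 2 * F₀ η := by
      filter_upwards [hF₀] with η hη
      simp [hη, freq_neg]
    exact h.congr (ae_eq_symm hk₀')
  -- the data of the majorant system: the analytic weight at time zero is `exp (1 / 16)`
  set E := ENNReal.ofReal (Real.exp (1 / 16)) with hE
  set f : Space d → ℝ≥0∞ := fun η => E * ‖F₀ η‖ₑ with hf
  set a : Space d → ℝ≥0∞ := fun η => ENNReal.ofReal (freq η ^ 2) * f η with ha
  have hma : Measurable a := hcq.measurable.ennreal_ofReal.mul (measurable_const.mul hmF)
  have hea : ∀ᵐ η, E * ‖k₀ η‖ₑ ≤ a η := by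
    filter_upwards [hk₀'] with η hη
    rw [hη, he, ha, hf, mul_left_comm]
  have hY : 0 ≤ Real.exp (1 / 16) * y := by positivity
  -- the exponent is at most `exp (1 / 16) / 2 < 0.535`, and `exp 0.535 < 7 / 4`
  have hsmall : Real.exp (8 * (Real.exp (1 / 16) * y)) - 1 ≤ 3 / 4 := by
    have h1 : Real.exp (1 / 16) ≤ 107 / 100 := by
      have h2 : Real.exp (1 / 16) ^ 16 = Real.exp 1 := by rw [← Real.exp_nat_mul]; norm_num
      by_contra! h
      have h3 := pow_lt_pow_left₀ h (by norm_num) (n := 16) (by norm_num)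
      have := Real.exp_one_lt_d9
      rw [h2] at h3
      norm_num at h3
      linarith
    have h2 : 8 * (Real.exp (1 / 16) * y) ≤ 107 / 200 := by nlinarith
    have h3 : Real.exp (107 / 200) ≤ 7 / 4 := by
      have h4 : Real.exp (107 / 200) ^ 2 = Real.exp 1 * Real.exp (7 / 100) := by
        rw [← Real.exp_nat_mul, ← Real.exp_add]; norm_num
      have h5 : Real.exp (7 / 100) ≤ 100 / 93 := by
        have := Real.one_sub_le_exp_neg (7 / 100)
        rw [Real.exp_neg] at this
        rw [← inv_inv (Real.exp (7 / 100))]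
        exact (inv_anti₀ (by norm_num) this).trans (by norm_num)
      have := Real.exp_one_lt_d9
      refine le_of_sq_le_sq ?_ (by norm_num)
      rw [h4]
      nlinarith [Real.exp_pos (7 / 100), Real.exp_pos 1]
    linarith [Real.exp_le_exp.2 h2]
  have haY : ∫⁻ η, a η ≤ ENNReal.ofReal (Real.exp (1 / 16) * y) := by
    have : ∀ η, a η = E * (ENNReal.ofReal (freq η ^ 2) * ‖F₀ η‖ₑ) := fun η => mul_left_comm _ _ _
    simp only [this]
    rw [lintegral_const_mul' _ _ ENNReal.ofReal_ne_top, ENNReal.ofReal_mul (Real.exp_pos _).le]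
    gcongr
  have haf : ∀ η, a η ^ 2 ≤ quartic η * f η ^ 2 := fun η => by
    rw [ha, mul_pow, quartic, ← ENNReal.ofReal_pow (by positivity), ← pow_mul]
  have hfl : ∫⁻ η, f η ^ 2 < ⊤ := by
    have h := (Lp.memLp F₀).2
    rw [eLpNorm_lt_top_iff_lintegral_rpow_enorm_lt_top (by norm_num) (by norm_num)] at h
    simp only [hf, mul_pow]
    rw [lintegral_const_mul' _ _ (by simp [hE])]
    refine ENNReal.mul_lt_top (by simp [hE]) ?_
    simpa using h
  have hgk := gevrey_mul_le hea hlim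
  have hle : ∀ᵐ η, ∀ t : I, ‖k η t‖ₑ ≤ majorantLim a t η := by
    filter_upwards [hgk] with η hη t
    refine le_trans ?_ (hη t)
    exact le_mul_of_one_le_left (by simp) (one_le_gevrey t.2.1 t.2.2 η)
  have hint : ∀ t : I, ∫⁻ η, gevrey t η * ‖k η t‖ₑ ≤ ENNReal.ofReal (Real.exp (1 / 16) * y) :=
    fun t => (lintegral_mono_ae (hgk.mono fun η hη => hη t)).trans
      (lintegral_majorantLim_le hma hY hsmall haY t.2.1)
  have hkY : ∀ t : I, ∫⁻ η, ‖k η t‖ₑ ≤ ENNReal.ofReal (Real.exp (1 / 16) * y) :=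
    fun t => (lintegral_mono_ae (hle.mono fun η hη => hη t)).trans
      (lintegral_majorantLim_le hma hY hsmall haY t.2.1)
  have hk2 : ∫⁻ η, ∫⁻ s in Ioc 0 1, ‖(k η).ext s‖ₑ ^ 2 < ⊤ := by
    refine lt_of_le_of_lt (lintegral_mono_ae ?_)
      ((lintegral_sq_majorantLim_le hma hY hsmall haY haf 1).trans_lt
        (ENNReal.mul_lt_top (by norm_num) hfl))
    filter_upwards [hle] with η hη
    refine setLIntegral_mono' measurableSet_Ioc fun s hs => ?_
    have hs' : s ∈ Icc (0 : ℝ) 1 := Ioc_subset_Icc_self hs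
    have := hη ⟨s, hs'⟩
    rw [← Path.ext_coe] at this
    gcongr
  refine ⟨k₀, k, _, hk₀', hk, hH, hint, ?_, sq_mild_solution_le hk (f := f) ?_⟩
  · rw [lintegral_add_left (by fun_prop), lintegral_const_mul' _ _ (by norm_num),
      lintegral_const_mul' _ _ (by norm_num)]
    exact ENNReal.add_lt_top.2 ⟨ENNReal.mul_lt_top (by norm_num) hfl,
      ENNReal.mul_lt_top (by norm_num) (lintegral_sq_convExpTail_lt_top hY hkY hk2)⟩
  · filter_upwards [hea] with η hη
    refine le_trans (le_mul_of_one_le_left (by simp) ?_) hη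
    rw [hE, ENNReal.one_le_ofReal]
    exact Real.one_le_exp (by norm_num)

/-- The mild solution solves the equation integrated in time, at almost every frequency and for all
times. -/
lemma mild_solution_integral {k₀ : Lp ℂ 1 (volume : Measure (Space d))}
    {k : Lp Path 1 (volume : Measure (Space d))} (hk : mildMap k₀ k = k) :
    ∀ᵐ η, ∀ t : I, k η t = k₀ η - ((freq η ^ 4 : ℝ) : ℂ) *
      ∫ s in (0 : ℝ)..t, ((k + convExpTail k : Lp Path 1 volume) η).ext s := by
  have h3 := Lp.coeFn_sub (freeEvol k₀) (duhamelL1 (convExpTail k))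
  rw [← mildMap, hk] at h3
  filter_upwards [h3, coeFn_freeEvol k₀, coeFn_duhamelL1 (convExpTail k),
    Lp.coeFn_add k (convExpTail k)] with η h3 h1 h2 h4 t
  have h := decay_sub_duhamel_integral (freq η ^ 4) (k₀ η) (convExpTail k η) t
  have h5 : k η = k₀ η • decay (freq η ^ 4) - duhamel (freq η ^ 4) (convExpTail k η) := by
    rw [h3, Pi.sub_apply, h1, h2]
  rw [h4, Pi.add_apply]
  rw [← h5] at h
  rw [← h, h5]
  rfl

end

/-! ### Solutions of the equation -/

section

open scoped unitInterval SchwartzMap Convolution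

variable {d : ℕ}

/-- A Hermitian function in `L²` is the Fourier transform of a real function. -/
lemma ofReal_re_fourierInv {F : Lp ℂ 2 (volume : Measure (Space d))} (hF : HermitianAE F) :
    fourierR (Complex.reCLM.compLp (𝓕⁻ F)) = F := by
  have h : Complex.ofRealCLM.compLp (Complex.reCLM.compLp (𝓕⁻ F)) =
      (𝓕⁻ F : Lp ℂ 2 (volume : Measure (Space d))) := by
    refine Lp.ext ?_
    filter_upwards [im_fourierInv_L2 hF, Complex.reCLM.coeFn_compLp (𝓕⁻ F),
      Complex.ofRealCLM.coeFn_compLp (Complex.reCLM.compLp (𝓕⁻ F))] with x h1 h2 h3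
    rw [h3, h2]
    apply Complex.ext <;> simp [h1]
  rw [fourierR, h, fourier_fourierInv_eq]

lemma re_fourierInv_fourierR (f : F02 d) :
    Complex.reCLM.compLp (𝓕⁻ (fourierR f)) = f := by
  rw [fourierR, fourierInv_fourier_eq]
  refine Lp.ext ?_
  filter_upwards [Complex.ofRealCLM.coeFn_compLp f,
    Complex.reCLM.coeFn_compLp (Complex.ofRealCLM.compLp f)] with x h1 h2
  rw [h2, h1]
  simp

/-- The time integral of a path up to the time `t`, as a linear functional. -/
def timeIntegral (t : I) : Path →L[ℂ] ℂ :=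
  LinearMap.mkContinuous
    { toFun := fun g => ∫ s in (0 : ℝ)..t, g.ext s
      map_add' := fun g g' => by
        rw [← intervalIntegral.integral_add (g.continuous_ext.intervalIntegrable _ _)
          (g'.continuous_ext.intervalIntegrable _ _)]
        rfl
      map_smul' := fun c g => by
        rw [RingHom.id_apply, ← intervalIntegral.integral_smul]
        rfl } 1 fun g => by
    rw [one_mul]
    refine (intervalIntegral.norm_integral_le_of_norm_le_const fun s _ => g.norm_ext_le s).trans ?_
    rw [sub_zero, abs_of_nonneg t.2.1]
    exact mul_le_of_le_one_right (norm_nonneg _) t.2.2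

lemma timeIntegral_apply (t : I) (g : Path) : timeIntegral t g = ∫ s in (0 : ℝ)..t, g.ext s := rfl

/-- The pairing of the exponential nonlinearity with a Schwartz function, as a path. -/
lemma pairing_exp {k : Lp Path 1 (volume : Measure (Space d))} (ψ : 𝓢(Space d, ℂ)) (t : I) :
    (∫ η, 𝓕⁻ ψ η • (k + convExpTail k : Lp Path 1 (volume : Measure (Space d))) η : Path) t =
      ∫ x, (Complex.exp (𝓕⁻ (fun η => k η t) x) - 1) * ψ x := by
  set Q : Lp Path 1 (volume : Measure (Space d)) := k + convExpTail k with hQ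
  have hQi := L1.integrable_coeFn Q
  have hi : Integrable fun η => 𝓕⁻ ψ η • Q η := by
    refine hQi.bdd_smul (SchwartzMap.seminorm ℂ 0 0 (𝓕⁻ ψ))
      (𝓕⁻ ψ).continuous.aestronglyMeasurable (Eventually.of_forall fun η => ?_)
    exact SchwartzMap.norm_le_seminorm ℂ _ η
  have h := (ContinuousMap.evalCLM ℂ t : Path →L[ℂ] ℂ).integral_comp_comm hi
  have hQt : Integrable fun η => Q η t :=
    (ContinuousMap.evalCLM ℂ t : Path →L[ℂ] ℂ).integrable_comp hQi
  have h2 := integral_fourierInv_mul hQt ψ.integrable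
  rw [ContinuousMap.evalCLM_apply] at h
  rw [← h]
  simp only [← evalInv_apply_apply] at h2 ⊢
  simp only [hQ, evalInv_add_convExpTail] at h2
  rw [h2]
  refine integral_congr_ae (Eventually.of_forall fun η => ?_)
  simp [SchwartzMap.fourierInv_coe, mul_comm, hQ]

/-- A mild solution in Fourier variables gives a solution of the equation. -/
theorem exists_solution (hd : 1 ≤ d) {h₀ : F02 d} {y : ℝ} (hy0 : 0 ≤ y) (hy : y ≤ 1 / 16)
    (hh₀ : moment 0 h₀ ≤ ENNReal.ofReal y) :
    ∃ h : ℝ → F02 d, IsSolution 1 h₀ h ∧ ∀ t ∈ Icc (0 : ℝ) 1,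
      moment (1 / 16 * t) (h t) ≤ ENNReal.ofReal (Real.exp (1 / 16) * y) := by
  obtain ⟨k₀, k, G, hk₀, hk, hH, hint, hG, hkG⟩ := exists_bounded_mild_solution
    (hermitianAE_fourierR h₀) hy0 hy (by simpa [moment] using hh₀)
  -- the Fourier transform of the solution
  set V : I → Space d → ℂ := fun t η => ((freq η : ℂ) ^ 2)⁻¹ * k η t with hV
  have hkt : ∀ t : I, Integrable fun η => k η t := fun t =>
    (ContinuousMap.evalCLM ℂ t : Path →L[ℂ] ℂ).integrable_comp (L1.integrable_coeFn k)
  have hVm : ∀ t, AEStronglyMeasurable (V t) volume := fun t => by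
    refine AEStronglyMeasurable.mul ?_ (hkt t).1
    exact (by fun_prop : Continuous fun η : Space d =>
      (freq η : ℂ) ^ 2).measurable.inv.aestronglyMeasurable
  have hVG : ∀ t, ∀ᵐ η, ‖V t η‖ₑ ^ 2 ≤ G η := fun t => by
    filter_upwards [ae_freq_ne_zero hd, hkG] with η h1 h2
    have hpos : 0 < freq η := lt_of_le_of_ne (freq_nonneg η) h1.symm
    have e : ‖((freq η : ℂ) ^ 2)⁻¹‖ₑ ^ 2 = (quartic η)⁻¹ := by
      rw [quartic, ← ENNReal.ofReal_inv_of_pos (by positivity), ← ofReal_norm,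
        ← ENNReal.ofReal_pow (norm_nonneg _), norm_inv, norm_pow, Complex.norm_real,
        Real.norm_of_nonneg hpos.le, inv_pow, ← pow_mul]
    rw [hV, enorm_mul, mul_pow, e]
    calc (quartic η)⁻¹ * ‖k η t‖ₑ ^ 2 ≤ (quartic η)⁻¹ * (quartic η * G η) := by
          gcongr; exact h2 t
      _ = G η := by
          rw [← mul_assoc, ENNReal.inv_mul_cancel, one_mul]
          · simpa [quartic] using pow_pos hpos 4
          · simp [quartic]
  have hcont := continuous_toLp_of_dominated hVm hG hVG
    (Eventually.of_forall fun η => continuous_const.mul (k η).continuous)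
  set F : I → Lp ℂ 2 (volume : Measure (Space d)) := fun t =>
    (memLp_two_of_sq_le (hVm t) hG (hVG t)).toLp with hF
  have hFV : ∀ t, F t =ᵐ[volume] V t := fun t => MemLp.coeFn_toLp _
  have hFk : ∀ t, ∀ᵐ η, k η t = (freq η : ℂ) ^ 2 * F t η := fun t => by
    filter_upwards [hFV t, ae_freq_ne_zero hd] with η h1 h2
    rw [h1, hV, mul_inv_cancel_left₀]
    exact pow_ne_zero _ (by exact_mod_cast h2)
  have hFH : ∀ t, HermitianAE (F t) := fun t => by
    have h : HermitianAE (V t) := by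
      filter_upwards [hH] with η hη
      simp [hV, hη, freq_neg]
    exact h.congr (hFV t).symm
  set g : I → F02 d := fun t => Complex.reCLM.compLp (𝓕⁻ (F t)) with hg
  have hgF : ∀ t, fourierR (g t) = F t := fun t => ofReal_re_fourierInv (hFH t)
  have hgcont : Continuous g :=
    (Complex.reCLM.compLpL 2 (volume : Measure (Space d))).continuous.comp
      (ContinuousFourierInv.continuous_fourierInv.comp hcont)
  have hmild := mild_solution_integral hk
  have hFF : ∀ t : I, ∀ᵐ η, F t η = fourierR h₀ η - (freq η : ℂ) ^ 2 *
      timeIntegral t ((k + convExpTail k : Lp Path 1 volume) η) := fun t => by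
    filter_upwards [hFk t, hk₀, hmild, ae_freq_ne_zero hd] with η h1 h2 h3 h4
    have h4' : (freq η : ℂ) ^ 2 ≠ 0 := pow_ne_zero _ (by exact_mod_cast h4)
    refine mul_left_cancel₀ h4' ?_
    rw [← h1, h3, h2, timeIntegral_apply]
    push_cast
    ring
  have hg0 : g 0 = h₀ := by
    have h : F 0 = fourierR h₀ := by
      refine Lp.ext ?_
      filter_upwards [hFF 0] with η hη
      rw [hη, timeIntegral_apply]
      simp
    rw [hg]
    simp only [h]
    exact re_fourierInv_fourierR h₀
  have hmom : ∀ t : I, moment (1 / 16 * t) (g t) ≤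
      ENNReal.ofReal (Real.exp (1 / 16) * y) := fun t => by
    refine le_trans (lintegral_mono_ae ?_) (hint t)
    filter_upwards [hFk t] with η hη
    have h1 : ‖(freq η : ℂ) ^ 2‖ₑ = ENNReal.ofReal (freq η ^ 2) := by
      rw [← ofReal_norm, norm_pow, Complex.norm_real, Real.norm_of_nonneg (freq_nonneg η)]
    rw [hgF, hη, enorm_mul, h1, ← mul_assoc, gevrey, ← ENNReal.ofReal_mul (Real.exp_pos _).le]
    refine mul_le_mul_left (ENNReal.ofReal_le_ofReal ?_) _
    rw [mul_comm]
    refine mul_le_mul_of_nonneg_right (Real.exp_le_exp.2 ?_) (by positivity)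
    linarith [t.2.2]
  -- outside `[0, 1]` the solution is continued by constants
  set h : ℝ → F02 d := fun s => g (projIcc 0 1 zero_le_one s) with hh
  have hht : ∀ t : I, h t = g t := fun t => by simp [hh]
  have hmom' : ∀ t ∈ Icc (0 : ℝ) 1,
      moment (1 / 16 * t) (h t) ≤ ENNReal.ofReal (Real.exp (1 / 16) * y) := fun t ht => by
    have := hmom ⟨t, ht⟩
    rwa [← hht] at this
  refine ⟨h, ⟨(hgcont.comp continuous_projIcc).continuousOn, ?_, ?_, ?_⟩, hmom'⟩
  · exact (hht 0).trans hg0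
  · refine ⟨(2 * Real.pi) ^ ((d : ℝ) / 2) * (Real.exp (1 / 16) * y), fun t ht => ?_⟩
    rw [sNorm_eq, ENNReal.ofReal_mul (by positivity)]
    gcongr
    refine le_trans (lintegral_mono fun η => ?_) (hmom' t ht)
    have := mul_nonneg ht.1 (freq_nonneg η)
    refine mul_le_mul_left (ENNReal.ofReal_le_ofReal (mul_le_mul_of_nonneg_left
      (Real.exp_le_exp.2 ?_) (by positivity))) _
    linarith
  set u : ℝ → Space d → ℝ := fun s x =>
    -(𝓕⁻ (fun η => k η (projIcc 0 1 zero_le_one s)) x).re with hu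
  have hucont : ∀ s, Continuous (u s) := fun s => by
    set r := projIcc (0 : ℝ) 1 zero_le_one s
    have := (Real.Lp.fourierTransformInv ((hkt r).toL1 _)).continuous
    rw [Real.Lp.coe_fourierTransformInv] at this
    exact (Complex.continuous_re.comp (this.congr fun x =>
      Real.fourierInv_congr_ae (hkt r).coeFn_toL1 x)).neg
  have huexp : ∀ s x, Complex.exp (𝓕⁻ (fun η => k η (projIcc 0 1 zero_le_one s)) x) =
      (Real.exp (-(u s x)) : ℝ) := fun s x => by
    have hs : HermitianAE fun η => k η (projIcc 0 1 zero_le_one s) := by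
      filter_upwards [hH] with η hη
      simp [hη]
    have h1 := star_fourierInv hs x
    have h2 := Complex.conj_eq_iff_re.1 h1
    rw [Complex.ofReal_exp, hu, neg_neg, h2]
  refine ⟨u, fun t ht => ?_, fun φ hφ => ?_⟩
  · refine isWeakLaplacian_of_fourier (hkt _) ?_
    rw [hh]
    simp only [hgF]
    exact hFk _
  set ψ : 𝓢(Space d, ℂ) := Δ hφ.toSchwartz with hψ
  set Q : Lp Path 1 (volume : Measure (Space d)) := k + convExpTail k with hQ
  set Z : Path := ∫ η, 𝓕⁻ ψ η • Q η with hZ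
  have hi : Integrable fun η => 𝓕⁻ ψ η • Q η := by
    refine (L1.integrable_coeFn Q).bdd_smul (SchwartzMap.seminorm ℂ 0 0 (𝓕⁻ ψ))
      (𝓕⁻ ψ).continuous.aestronglyMeasurable (Eventually.of_forall fun η => ?_)
    exact SchwartzMap.norm_le_seminorm ℂ _ η
  -- `k + N(k)` is the transform of `exp (-u) - 1`, and the constant `1` is orthogonal to `Δ φ`
  have hZu : ∀ s, Z.ext s = ((∫ x, Real.exp (-(u s x)) * Δ φ x : ℝ) : ℂ) := fun s => by
    rw [Path.ext, hZ, hQ, pairing_exp]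
    have h1 : ∀ x, (Complex.exp (𝓕⁻ (fun η => k η (projIcc 0 1 zero_le_one s)) x) - 1) * ψ x =
        ((Real.exp (-(u s x)) * Δ φ x - Δ φ x : ℝ) : ℂ) := fun x => by
      rw [huexp, hψ, hφ.laplacian_toSchwartz_apply]
      push_cast
      ring
    simp only [h1]
    have hΔi : Integrable (Δ φ) :=
      hφ.laplacian.1.continuous.integrable_of_hasCompactSupport hφ.laplacian.2
    have hΔe : Integrable fun x => Real.exp (-(u s x)) * Δ φ x :=
      ((Real.continuous_exp.comp (hucont s).neg).mul
        hφ.laplacian.1.continuous).integrable_of_hasCompactSupport hφ.laplacian.2.mul_left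
    rw [integral_complex_ofReal, integral_sub hΔe hΔi, integral_laplacian_eq_zero hφ, sub_zero]
  have hZre : ∀ s, ∫ x, Real.exp (-(u s x)) * Δ φ x = (Z.ext s).re := fun s => by
    rw [hZu, Complex.ofReal_re]
  simp only [hZre]
  refine ⟨(Complex.continuous_re.comp Z.continuous_ext).intervalIntegrable _ _, fun t ht => ?_⟩
  lift t to I using ht
  have hpair : ∀ f : F02 d, ((∫ x, f x * φ x : ℝ) : ℂ) =
      ∫ η, fourierR f η * 𝓕⁻ hφ.toSchwartz η := fun f => by
    rw [← integral_ofReal_mul_test, ← integral_fourierInv_L2_mul, fourierR,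
      fourierInv_fourier_eq]
    rfl
  have hint' : ∀ f : F02 d, Integrable fun η => fourierR f η * 𝓕⁻ hφ.toSchwartz η := fun f =>
    (Lp.memLp (fourierR f)).integrable_mul ((𝓕⁻ hφ.toSchwartz).memLp 2)
  have hmain : ((∫ x, h t x * φ x : ℝ) : ℂ) - ((∫ x, h₀ x * φ x : ℝ) : ℂ) =
      timeIntegral t Z := by
    rw [hpair, hpair, ← integral_sub (hint' _) (hint' _), hZ,
      ← (timeIntegral t).integral_comp_comm hi]
    refine integral_congr_ae ?_
    filter_upwards [hFF t] with η hη
    rw [hht, hgF, hη, hψ, fourierInv_laplacian, map_smul, smul_eq_mul]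
    ring
  have hre := congrArg Complex.re hmain
  rw [← Complex.ofReal_sub, Complex.ofReal_re, timeIntegral_apply] at hre
  rw [hre]
  exact (Complex.reCLM.intervalIntegral_comp_comm
    (Z.continuous_ext.intervalIntegrable 0 t)).symm

end

/-! ### A weighted energy inequality -/

section

variable {d : ℕ}

/-- Smooth functions which are bounded together with the derivatives that enter the Laplacian. -/
structure BoundedSmooth (f : Space d → ℝ) : Prop where
  smooth : ContDiff ℝ ∞ f
  bounded : ∃ C, ∀ x, |f x| ≤ C
  bounded_pderiv : ∀ i, ∃ C, ∀ x, |pderiv i f x| ≤ C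
  bounded_pderiv_pderiv : ∀ i, ∃ C, ∀ x, |pderiv i (pderiv i f) x| ≤ C

/-- Integrable weights with values in `[0, 1]` which vary slowly, in the sense that the coordinate
derivatives entering the gradient and the Laplacian are at most `κ` times the weight. -/
structure IsSlowWeight (κ : ℝ) (χ : Space d → ℝ) : Prop where
  smooth : ContDiff ℝ ∞ χ
  integrable : Integrable χ
  nonneg : ∀ x, 0 ≤ χ x
  le_one : ∀ x, χ x ≤ 1
  abs_pderiv_le : ∀ i x, |pderiv i χ x| ≤ κ * χ x
  abs_pderiv_pderiv_le : ∀ i x, |pderiv i (pderiv i χ) x| ≤ κ * χ x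

lemma integral_mul_pderiv {F G : Space d → ℝ} {i : Fin d} (hF : ContDiff ℝ ∞ F)
    (hG : ContDiff ℝ ∞ G) (h1 : Integrable fun x => pderiv i F x * G x)
    (h2 : Integrable fun x => F x * pderiv i G x) (h3 : Integrable fun x => F x * G x) :
    ∫ x, F x * pderiv i G x = -∫ x, pderiv i F x * G x :=
  integral_mul_fderiv_eq_neg_fderiv_mul_of_integrable h1 h2 h3
    (fun x _ => differentiable_of_smooth hF x) (fun x _ => differentiable_of_smooth hG x)

variable {χ : Space d → ℝ} {κ : ℝ}

/-- Products of a function controlled by the weight with a bounded function are integrable. -/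
lemma IsSlowWeight.integrable_mul (hχ : IsSlowWeight κ χ) {p q : Space d → ℝ}
    (hp : Continuous p) {K : ℝ} (hpχ : ∀ x, |p x| ≤ K * χ x) (hq : Continuous q)
    (hqb : ∃ C, ∀ x, |q x| ≤ C) : Integrable fun x => p x * q x := by
  obtain ⟨C, hC⟩ := hqb
  refine (hχ.integrable.const_mul (K * C)).mono' (hp.mul hq).aestronglyMeasurable
    (Eventually.of_forall fun x => ?_)
  rw [Real.norm_eq_abs, abs_mul]
  calc |p x| * |q x| ≤ (K * χ x) * C :=
        mul_le_mul (hpχ x) (hC x) (abs_nonneg _) ((abs_nonneg _).trans (hpχ x))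
    _ = K * C * χ x := by ring

lemma bounded_mul {p q : Space d → ℝ} (hp : ∃ C, ∀ x, |p x| ≤ C) (hq : ∃ C, ∀ x, |q x| ≤ C) :
    ∃ C, ∀ x, |p x * q x| ≤ C := by
  obtain ⟨C, hC⟩ := hp
  obtain ⟨D, hD⟩ := hq
  refine ⟨C * D, fun x => ?_⟩
  rw [abs_mul]
  exact mul_le_mul (hC x) (hD x) (abs_nonneg _) ((abs_nonneg _).trans (hC x))

lemma IsSlowWeight.integrable_mul_mul (hχ : IsSlowWeight κ χ) {p q : Space d → ℝ}
    (hp : Continuous p) (hq : Continuous q) (hpb : ∃ C, ∀ x, |p x| ≤ C)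
    (hqb : ∃ C, ∀ x, |q x| ≤ C) : Integrable fun x => χ x * (p x * q x) :=
  hχ.integrable_mul hχ.smooth.continuous (K := 1)
    (fun x => by rw [abs_of_nonneg (hχ.nonneg x), one_mul]) (hp.mul hq) (bounded_mul hpb hqb)

section

variable {f a : Space d → ℝ} (i : Fin d)

/-- Two integrations by parts against a slowly varying weight. -/
lemma integral_weight_mul_pderiv_pderiv (hχ : IsSlowWeight κ χ) (hf : BoundedSmooth f)
    (ha : BoundedSmooth a) :
    ∫ x, χ x * (f x * pderiv i (pderiv i a) x) =
      ∫ x, (χ x * (a x * pderiv i (pderiv i f) x) + pderiv i χ x * (2 * (a x * pderiv i f x)) +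
        pderiv i (pderiv i χ) x * (a x * f x)) := by
  have cχ := hχ.smooth
  have cf := hf.smooth
  have ca := ha.smooth
  have k0 : ∀ x, |χ x| ≤ 1 * χ x := fun x => by rw [abs_of_nonneg (hχ.nonneg x), one_mul]
  have k1 := hχ.abs_pderiv_le i
  have k2 := hχ.abs_pderiv_pderiv_le i
  have e1 : pderiv i (fun x => χ x * f x) = fun x => χ x * pderiv i f x + pderiv i χ x * f x :=
    pderiv_mul cχ cf
  have e2 : pderiv i (fun x => χ x * pderiv i f x + pderiv i χ x * f x) = fun x =>
      (χ x * pderiv i (pderiv i f) x + pderiv i χ x * pderiv i f x) +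
        (pderiv i χ x * pderiv i f x + pderiv i (pderiv i χ) x * f x) := by
    rw [pderiv_add (cχ.mul (contDiff_pderiv cf)) ((contDiff_pderiv cχ).mul cf),
      pderiv_mul cχ (contDiff_pderiv cf), pderiv_mul (contDiff_pderiv cχ) cf]
  have cF : ContDiff ℝ ∞ fun x => χ x * f x := cχ.mul cf
  have cF' : ContDiff ℝ ∞ fun x => χ x * pderiv i f x + pderiv i χ x * f x :=
    (cχ.mul (contDiff_pderiv cf)).add ((contDiff_pderiv cχ).mul cf)
  have b := fun {p q : Space d → ℝ} (hp : Continuous p) (hq : Continuous q)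
    (hpb : ∃ C, ∀ x, |p x| ≤ C) (hqb : ∃ C, ∀ x, |q x| ≤ C) =>
    And.intro (hχ.integrable_mul cχ.continuous k0 (hp.mul hq) (bounded_mul hpb hqb))
      (And.intro (hχ.integrable_mul (contDiff_pderiv (i := i) cχ).continuous k1 (hp.mul hq)
        (bounded_mul hpb hqb)) (hχ.integrable_mul
          (contDiff_pderiv (i := i) (contDiff_pderiv (i := i) cχ)).continuous k2 (hp.mul hq)
          (bounded_mul hpb hqb)))
  have cf0 := cf.continuous
  have cf1 := (contDiff_pderiv (i := i) cf).continuous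
  have cf2 := (contDiff_pderiv (i := i) (contDiff_pderiv (i := i) cf)).continuous
  have ca0 := ca.continuous
  have ca1 := (contDiff_pderiv (i := i) ca).continuous
  have ca2 := (contDiff_pderiv (i := i) (contDiff_pderiv (i := i) ca)).continuous
  have bf0 := hf.bounded
  have bf1 := hf.bounded_pderiv i
  have bf2 := hf.bounded_pderiv_pderiv i
  have ba0 := ha.bounded
  have ba1 := ha.bounded_pderiv i
  have ba2 := ha.bounded_pderiv_pderiv i
  have i1 : ∫ x, χ x * f x * pderiv i (pderiv i a) x =
      -∫ x, pderiv i (fun x => χ x * f x) x * pderiv i a x := by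
    refine integral_mul_pderiv cF (contDiff_pderiv ca) ?_ ?_ ?_
    · rw [e1]
      refine ((b cf1 ca1 bf1 ba1).1.add (b cf0 ca1 bf0 ba1).2.1).congr
        (Eventually.of_forall fun x => ?_)
      simp only [Pi.add_apply, Pi.mul_apply]; ring
    · exact (b cf0 ca2 bf0 ba2).1.congr
        (Eventually.of_forall fun x => by simp only [Pi.mul_apply]; ring)
    · exact (b cf0 ca1 bf0 ba1).1.congr
        (Eventually.of_forall fun x => by simp only [Pi.mul_apply]; ring)
  have i2 : ∫ x, (χ x * pderiv i f x + pderiv i χ x * f x) * pderiv i a x =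
      -∫ x, pderiv i (fun x => χ x * pderiv i f x + pderiv i χ x * f x) x * a x := by
    refine integral_mul_pderiv cF' ca ?_ ?_ ?_
    · rw [e2]
      refine (((b cf2 ca0 bf2 ba0).1.add (b cf1 ca0 bf1 ba0).2.1).add
        ((b cf1 ca0 bf1 ba0).2.1.add (b cf0 ca0 bf0 ba0).2.2)).congr
        (Eventually.of_forall fun x => ?_)
      simp only [Pi.add_apply, Pi.mul_apply]; ring
    · refine ((b cf1 ca1 bf1 ba1).1.add (b cf0 ca1 bf0 ba1).2.1).congr
        (Eventually.of_forall fun x => ?_)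
      simp only [Pi.add_apply, Pi.mul_apply]; ring
    · refine ((b cf1 ca0 bf1 ba0).1.add (b cf0 ca0 bf0 ba0).2.1).congr
        (Eventually.of_forall fun x => ?_)
      simp only [Pi.add_apply, Pi.mul_apply]; ring
  rw [e1, i2, neg_neg, e2] at i1
  simp only [← mul_assoc] at i1 ⊢
  rw [i1]
  congr 1 with x
  ring

/-- The weighted norm of a first derivative is controlled by the function and its second
derivative. -/
lemma integral_weight_mul_sq_pderiv_le (hχ : IsSlowWeight κ χ) (hκ1 : κ ≤ 1)
    (hf : BoundedSmooth f) :
    ∫ x, χ x * (pderiv i f x * pderiv i f x) ≤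
      ∫ x, (χ x * (f x * f x) - 2 * (χ x * (f x * pderiv i (pderiv i f) x))) := by
  have cχ := hχ.smooth
  have cf := hf.smooth
  have k1 := hχ.abs_pderiv_le i
  have e1 : pderiv i (fun x => χ x * pderiv i f x) = fun x =>
      χ x * pderiv i (pderiv i f) x + pderiv i χ x * pderiv i f x :=
    pderiv_mul cχ (contDiff_pderiv cf)
  have cf0 := cf.continuous
  have cf1 := (contDiff_pderiv (i := i) cf).continuous
  have cf2 := (contDiff_pderiv (i := i) (contDiff_pderiv (i := i) cf)).continuous
  have bf0 := hf.bounded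
  have bf1 := hf.bounded_pderiv i
  have bf2 := hf.bounded_pderiv_pderiv i
  have j11 := hχ.integrable_mul_mul cf1 cf1 bf1 bf1
  have j01 := hχ.integrable_mul_mul cf0 cf1 bf0 bf1
  have j00 := hχ.integrable_mul_mul cf0 cf0 bf0 bf0
  have j02 := hχ.integrable_mul_mul cf0 cf2 bf0 bf2
  have j3 : Integrable fun x => χ x * (f x * f x) - 2 * (χ x * (f x * pderiv i (pderiv i f) x)) :=
    j00.sub (j02.const_mul 2)
  have j101 := hχ.integrable_mul (contDiff_pderiv (i := i) cχ).continuous k1 (cf0.mul cf1)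
    (bounded_mul bf0 bf1)
  have i1 : ∫ x, χ x * pderiv i f x * pderiv i f x =
      -∫ x, pderiv i (fun x => χ x * pderiv i f x) x * f x := by
    refine integral_mul_pderiv (cχ.mul (contDiff_pderiv cf)) cf ?_ ?_ ?_
    · rw [e1]
      refine (j02.add j101).congr (Eventually.of_forall fun x => ?_)
      simp only [Pi.add_apply, Pi.mul_apply]; ring
    · exact j11.congr (Eventually.of_forall fun x => by simp only; ring)
    · exact j01.congr (Eventually.of_forall fun x => by simp only; ring)
  rw [e1, ← integral_neg] at i1
  have i2 : ∫ x, χ x * (pderiv i f x * pderiv i f x) ≤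
      ∫ x, (1 / 2 * (χ x * (pderiv i f x * pderiv i f x)) +
        1 / 2 * (χ x * (f x * f x) - 2 * (χ x * (f x * pderiv i (pderiv i f) x)))) := by
    simp only [mul_assoc] at i1
    rw [i1]
    refine integral_mono ?_ ((j11.const_mul _).add (j3.const_mul _)) fun x => ?_
    · refine (j02.add j101).neg.congr (Eventually.of_forall fun x => ?_)
      simp only [Pi.add_apply, Pi.neg_apply, Pi.mul_apply]; ring
    · have h1 : |pderiv i χ x| ≤ χ x := (k1 x).trans (mul_le_of_le_one_left (hχ.nonneg x) hκ1)
      have h2 : -(pderiv i χ x * (f x * pderiv i f x)) ≤ χ x * |f x * pderiv i f x| := by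
        refine (neg_le_abs _).trans ?_
        rw [abs_mul]
        gcongr
      have h3 : |f x * pderiv i f x| ≤ 1 / 2 * (f x * f x) +
          1 / 2 * (pderiv i f x * pderiv i f x) := by
        rw [abs_le]
        constructor <;> nlinarith [sq_nonneg (f x + pderiv i f x), sq_nonneg (f x - pderiv i f x)]
      have h4 := mul_le_mul_of_nonneg_left h3 (hχ.nonneg x)
      simp only
      linarith
  rw [integral_add (j11.const_mul _) (j3.const_mul _),
    integral_const_mul, integral_const_mul] at i2
  linarith

lemma integral_weight_mul_pderiv_pderiv_le (hχ : IsSlowWeight κ χ) (hκ : 0 ≤ κ) (hκ1 : κ ≤ 1)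
    (hf : BoundedSmooth f) (ha : BoundedSmooth a) :
    ∫ x, χ x * (f x * pderiv i (pderiv i a) x) ≤
      ∫ x, (χ x * (a x * pderiv i (pderiv i f) x) + κ * (3 / 2 * (χ x * (a x * a x)) +
        3 / 2 * (χ x * (f x * f x)) - 2 * (χ x * (f x * pderiv i (pderiv i f) x)))) := by
  have cf0 := hf.smooth.continuous
  have cf1 := (contDiff_pderiv (i := i) hf.smooth).continuous
  have cf2 := (contDiff_pderiv (i := i) (contDiff_pderiv (i := i) hf.smooth)).continuous
  have ca0 := ha.smooth.continuous
  have bf0 := hf.bounded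
  have bf1 := hf.bounded_pderiv i
  have bf2 := hf.bounded_pderiv_pderiv i
  have ba0 := ha.bounded
  have jaf2 := hχ.integrable_mul_mul ca0 cf2 ba0 bf2
  have jaa := hχ.integrable_mul_mul ca0 ca0 ba0 ba0
  have jff := hχ.integrable_mul_mul cf0 cf0 bf0 bf0
  have j11 := hχ.integrable_mul_mul cf1 cf1 bf1 bf1
  have jff2 := hχ.integrable_mul_mul cf0 cf2 bf0 bf2
  have j1 : Integrable fun x => pderiv i χ x * (2 * (a x * pderiv i f x)) :=
    ((hχ.integrable_mul (contDiff_pderiv (i := i) hχ.smooth).continuous (hχ.abs_pderiv_le i)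
      (ca0.mul cf1) (bounded_mul ba0 bf1)).const_mul 2).congr
      (Eventually.of_forall fun x => by simp only [Pi.mul_apply]; ring)
  have j2 := hχ.integrable_mul (contDiff_pderiv (i := i) (contDiff_pderiv (i := i)
    hχ.smooth)).continuous (hχ.abs_pderiv_pderiv_le i) (ca0.mul cf0) (bounded_mul ba0 bf0)
  have hsq := mul_le_mul_of_nonneg_left (integral_weight_mul_sq_pderiv_le i hχ hκ1 hf) hκ
  have jm : Integrable fun x => 3 / 2 * (χ x * (a x * a x)) + 1 / 2 * (χ x * (f x * f x)) +
      χ x * (pderiv i f x * pderiv i f x) :=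
    ((jaa.const_mul _).add (jff.const_mul _)).add j11
  have h1 : ∫ x, χ x * (f x * pderiv i (pderiv i a) x) ≤
      ∫ x, (χ x * (a x * pderiv i (pderiv i f) x) + κ * (3 / 2 * (χ x * (a x * a x)) +
        1 / 2 * (χ x * (f x * f x)) + χ x * (pderiv i f x * pderiv i f x))) := by
    rw [integral_weight_mul_pderiv_pderiv i hχ hf ha]
    refine integral_mono ((jaf2.add j1).add j2) (jaf2.add (jm.const_mul κ)) fun x => ?_
    have hx := mul_nonneg hκ (hχ.nonneg x)
    have h2 : pderiv i χ x * (2 * (a x * pderiv i f x)) ≤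
        κ * χ x * (a x * a x + pderiv i f x * pderiv i f x) := by
      refine (le_abs_self _).trans ?_
      rw [abs_mul]
      refine mul_le_mul (hχ.abs_pderiv_le i x) ?_ (abs_nonneg _) hx
      rw [abs_le]
      constructor <;> nlinarith [sq_nonneg (a x + pderiv i f x), sq_nonneg (a x - pderiv i f x)]
    have h3 : pderiv i (pderiv i χ) x * (a x * f x) ≤
        κ * χ x * (1 / 2 * (a x * a x) + 1 / 2 * (f x * f x)) := by
      refine (le_abs_self _).trans ?_
      rw [abs_mul]
      refine mul_le_mul (hχ.abs_pderiv_pderiv_le i x) ?_ (abs_nonneg _) hx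
      rw [abs_le]
      constructor <;> nlinarith [sq_nonneg (a x + f x), sq_nonneg (a x - f x)]
    simp only
    linarith
  refine h1.trans ?_
  have jr : Integrable fun x => 3 / 2 * (χ x * (a x * a x)) + 3 / 2 * (χ x * (f x * f x)) -
      2 * (χ x * (f x * pderiv i (pderiv i f) x)) :=
    ((jaa.const_mul _).add (jff.const_mul _)).sub (jff2.const_mul _)
  rw [integral_add jaf2 (jm.const_mul κ), integral_add jaf2 (jr.const_mul κ),
    integral_const_mul, integral_const_mul]
  have e1 := integral_add ((jaa.const_mul (3 / 2)).add (jff.const_mul (1 / 2))) j11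
  have e2 := integral_add (jaa.const_mul (3 / 2)) (jff.const_mul (1 / 2))
  have e3 := integral_sub ((jaa.const_mul (3 / 2)).add (jff.const_mul (3 / 2)))
    (jff2.const_mul 2)
  have e4 := integral_add (jaa.const_mul (3 / 2)) (jff.const_mul (3 / 2))
  have e5 := integral_sub jff (jff2.const_mul 2)
  simp only [Pi.add_apply, integral_const_mul] at e1 e2 e3 e4 e5
  rw [e1, e2, e3, e4]
  rw [e5] at hsq
  linarith

end

/-- The weighted pairing of `f` with `Δ a` is the pairing of `a` with `Δ f` up to errors that are
small with the variation of the weight. -/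
lemma integral_weight_mul_laplacian_le {f a : Space d → ℝ} (hχ : IsSlowWeight κ χ) (hκ : 0 ≤ κ)
    (hκ1 : κ ≤ 1) (hf : BoundedSmooth f) (ha : BoundedSmooth a) :
    ∫ x, χ x * (f x * Δ a x) ≤
      (∫ x, χ x * (a x * Δ f x + 2 * (d + 1) * κ * (a x ^ 2 + Δ f x ^ 2))) +
        2 * (d + 1) * κ * ∫ x, χ x * f x ^ 2 := by
  have cf0 := hf.smooth.continuous
  have ca0 := ha.smooth.continuous
  have bf0 := hf.bounded
  have ba0 := ha.bounded
  have cf2 := fun i => (contDiff_pderiv (i := i) (contDiff_pderiv (i := i) hf.smooth)).continuous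
  have ca2 := fun i => (contDiff_pderiv (i := i) (contDiff_pderiv (i := i) ha.smooth)).continuous
  have jaf2 := fun i => hχ.integrable_mul_mul ca0 (cf2 i) ba0 (hf.bounded_pderiv_pderiv i)
  have jfa2 := fun i => hχ.integrable_mul_mul cf0 (ca2 i) bf0 (ha.bounded_pderiv_pderiv i)
  have jff2 := fun i => hχ.integrable_mul_mul cf0 (cf2 i) bf0 (hf.bounded_pderiv_pderiv i)
  have jaa := hχ.integrable_mul_mul ca0 ca0 ba0 ba0
  have jff := hχ.integrable_mul_mul cf0 cf0 bf0 bf0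
  have jr := fun i => (jaf2 i).add ((((jaa.const_mul (3 / 2)).add (jff.const_mul (3 / 2))).sub
    ((jff2 i).const_mul 2)).const_mul κ)
  have hΔ : Δ f = fun x => ∑ i, pderiv i (pderiv i f) x := laplacian_eq_sum_pderiv hf.smooth
  have cΔ : Continuous (Δ f) := (contDiff_laplacian hf.smooth).continuous
  have bΔ : ∃ C, ∀ x, |Δ f x| ≤ C := by
    choose C hC using hf.bounded_pderiv_pderiv
    refine ⟨∑ i, C i, fun x => ?_⟩
    rw [hΔ]
    exact (Finset.abs_sum_le_sum_abs _ _).trans (Finset.sum_le_sum fun i _ => hC i x)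
  have jaΔ := hχ.integrable_mul_mul ca0 cΔ ba0 bΔ
  have jΔΔ := hχ.integrable_mul_mul cΔ cΔ bΔ bΔ
  have jR : Integrable fun x => χ x * (a x * Δ f x + 2 * (d + 1) * κ * (a x ^ 2 + Δ f x ^ 2)) :=
    (jaΔ.add ((jaa.add jΔΔ).const_mul (2 * (d + 1) * κ))).congr (Eventually.of_forall fun x => by
      simp only [Pi.add_apply]; ring)
  have jF : Integrable fun x => χ x * f x ^ 2 :=
    jff.congr (Eventually.of_forall fun x => by simp only; ring)
  calc ∫ x, χ x * (f x * Δ a x)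
      = ∫ x, ∑ i, χ x * (f x * pderiv i (pderiv i a) x) := by
        congr 1 with x
        rw [laplacian_eq_sum_pderiv ha.smooth]
        simp only [Finset.mul_sum]
    _ = ∑ i, ∫ x, χ x * (f x * pderiv i (pderiv i a) x) := integral_finsetSum _ fun i _ => jfa2 i
    _ ≤ ∑ i, ∫ x, (χ x * (a x * pderiv i (pderiv i f) x) + κ * (3 / 2 * (χ x * (a x * a x)) +
        3 / 2 * (χ x * (f x * f x)) - 2 * (χ x * (f x * pderiv i (pderiv i f) x)))) :=
        Finset.sum_le_sum fun i _ => integral_weight_mul_pderiv_pderiv_le i hχ hκ hκ1 hf ha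
    _ = ∫ x, ∑ i, (χ x * (a x * pderiv i (pderiv i f) x) + κ * (3 / 2 * (χ x * (a x * a x)) +
        3 / 2 * (χ x * (f x * f x)) - 2 * (χ x * (f x * pderiv i (pderiv i f) x)))) :=
        (integral_finsetSum _ fun i _ => jr i).symm
    _ ≤ ∫ x, (χ x * (a x * Δ f x + 2 * (d + 1) * κ * (a x ^ 2 + Δ f x ^ 2)) +
        2 * (d + 1) * κ * (χ x * f x ^ 2)) := by
        refine integral_mono (integrable_finsetSum _ fun i _ => jr i) (jR.add (jF.const_mul _))
          fun x => ?_
        have e : ∑ i, (χ x * (a x * pderiv i (pderiv i f) x) + κ * (3 / 2 * (χ x * (a x * a x)) +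
            3 / 2 * (χ x * (f x * f x)) - 2 * (χ x * (f x * pderiv i (pderiv i f) x)))) =
            χ x * (a x * Δ f x) + κ * χ x * (d * (3 / 2 * a x ^ 2 + 3 / 2 * f x ^ 2) -
              2 * (f x * Δ f x)) := by
          rw [hΔ]
          simp only [Finset.sum_add_distrib, Finset.sum_sub_distrib, ← Finset.mul_sum,
            Finset.sum_const, Finset.card_univ, Fintype.card_fin, nsmul_eq_mul]
          ring
        simp only
        rw [e]
        have h1 : (d : ℝ) * (3 / 2 * a x ^ 2 + 3 / 2 * f x ^ 2) - 2 * (f x * Δ f x) ≤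
            2 * (d + 1) * (a x ^ 2 + Δ f x ^ 2) + 2 * (d + 1) * f x ^ 2 := by
          have h2 : (0 : ℝ) ≤ d := Nat.cast_nonneg d
          nlinarith [sq_nonneg (f x + Δ f x), mul_nonneg h2 (sq_nonneg (a x)),
            mul_nonneg h2 (sq_nonneg (f x)), mul_nonneg h2 (sq_nonneg (Δ f x)),
            sq_nonneg (a x), sq_nonneg (Δ f x), sq_nonneg (f x)]
        have h3 := mul_le_mul_of_nonneg_left h1 (mul_nonneg hκ (hχ.nonneg x))
        linarith
    _ = _ := by rw [integral_add jR (jF.const_mul _), integral_const_mul]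

end

/-! ### Slowly varying weights -/

section

open scoped Convolution

variable {d : ℕ}

/-- The weight `(1 + ε² |x|²)^(-(d + 1))`, which is integrable and tends to one as `ε` tends to
zero. -/
def weight (d : ℕ) (ε : ℝ) (x : Space d) : ℝ := (1 + ε ^ 2 * ‖x‖ ^ 2) ^ (-(d + 1 : ℤ))

lemma pderiv_comp_norm_sq {g : ℝ → ℝ} {g' ε : ℝ} {x : Space d}
    (hg : HasDerivAt g g' (1 + ε ^ 2 * ‖x‖ ^ 2)) (i : Fin d) :
    pderiv i (fun x => g (1 + ε ^ 2 * ‖x‖ ^ 2)) x = g' * (2 * ε ^ 2 * x i) := by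
  have h1 : HasFDerivAt (fun x : Space d => 1 + ε ^ 2 * ‖x‖ ^ 2)
      (ε ^ 2 • (2 • (innerSL ℝ x))) x :=
    (((hasStrictFDerivAt_norm_sq x).hasFDerivAt).const_mul (ε ^ 2)).const_add 1
  have h2 := hg.comp_hasFDerivAt x h1
  rw [pderiv, show (fun x : Space d => g (1 + ε ^ 2 * ‖x‖ ^ 2)) =
    g ∘ fun x : Space d => 1 + ε ^ 2 * ‖x‖ ^ 2 from rfl, h2.fderiv]
  simp only [_root_.smul_apply, innerSL_apply_apply, EuclideanSpace.inner_single_right, smul_eq_mul,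
    nsmul_eq_mul, Nat.cast_ofNat, conj_trivial, one_mul]
  ring

lemma pderiv_coord (i : Fin d) (x : Space d) : pderiv i (fun x : Space d => x i) x = 1 := by
  have h : HasFDerivAt (fun x : Space d => x i) (EuclideanSpace.proj i : Space d →L[ℝ] ℝ) x :=
    (EuclideanSpace.proj i : Space d →L[ℝ] ℝ).hasFDerivAt
  rw [pderiv, h.fderiv]
  simp

lemma isSlowWeight_weight {ε : ℝ} (hε : 0 < ε) (hε1 : ε ≤ 1) :
    IsSlowWeight ((d + 3) ^ 2 * ε) (weight d ε) := by
  set p : Space d → ℝ := fun x => 1 + ε ^ 2 * ‖x‖ ^ 2 with hp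
  set m : ℤ := -(d + 1 : ℤ) with hm
  have hp1 : ∀ x, 1 ≤ p x := fun x => by
    have : 0 ≤ ε ^ 2 * ‖x‖ ^ 2 := by positivity
    simp only [hp]; linarith
  have hp0 : ∀ x, 0 < p x := fun x => one_pos.trans_le (hp1 x)
  have hcp : ContDiff ℝ ∞ p := by
    simp only [hp]
    exact contDiff_const.add (contDiff_const.mul (contDiff_norm_sq ℝ))
  have hczpow : ∀ n : ℤ, ContDiff ℝ ∞ fun x => p x ^ n := fun n => by
    rcases n with n | n
    · simp only [Int.ofNat_eq_natCast, zpow_natCast]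
      exact hcp.pow n
    · simp only [zpow_negSucc]
      exact (hcp.pow _).inv fun x => (pow_pos (hp0 x) _).ne'
  have hd1 : ∀ (n : ℤ) (i : Fin d), pderiv i (fun x => p x ^ n) =
      fun x => (n * p x ^ (n - 1)) * (2 * ε ^ 2 * x i) := fun n i => by
    ext x
    exact pderiv_comp_norm_sq (hasDerivAt_zpow n (p x) (Or.inl (hp0 x).ne')) i
  have hx : ∀ x i, 2 * ε * |x i| ≤ p x := fun x i => by
    have h1 : |x i| ≤ ‖x‖ := PiLp.norm_apply_le x i
    have h2 : 2 * (ε * ‖x‖) ≤ p x := by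
      simp only [hp]; nlinarith [sq_nonneg (ε * ‖x‖ - 1)]
    nlinarith [mul_le_mul_of_nonneg_left h1 hε.le]
  have hz : ∀ (n : ℤ) x, p x ^ (n - 1) * p x = p x ^ n := fun n x => by
    rw [← zpow_add_one₀ (hp0 x).ne', sub_add_cancel]
  have hzp : ∀ (n : ℤ) x, 0 < p x ^ n := fun n x => zpow_pos (hp0 x) n
  have hmabs : |(m : ℝ)| = d + 1 := by
    rw [hm]; push_cast; rw [abs_neg, abs_of_nonneg (by positivity)]
  have hmabs' : |((m - 1 : ℤ) : ℝ)| = d + 2 := by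
    rw [hm]; push_cast
    rw [show -((d : ℝ) + 1) - 1 = -(d + 2) by ring, abs_neg, abs_of_nonneg (by positivity)]
  have hdn : (0 : ℝ) ≤ d := Nat.cast_nonneg d
  have hb1 : ∀ (n : ℤ) i x, |(n * p x ^ (n - 1)) * (2 * ε ^ 2 * x i)| ≤ |(n : ℝ)| * ε * p x ^ n :=
    fun n i x => by
    rw [abs_mul, abs_mul, abs_mul, abs_of_pos (hzp (n - 1) x),
      abs_of_pos (by positivity : 0 < 2 * ε ^ 2), ← hz n x]
    calc |(n : ℝ)| * p x ^ (n - 1) * (2 * ε ^ 2 * |x i|)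
        = |(n : ℝ)| * ε * p x ^ (n - 1) * (2 * ε * |x i|) := by ring
      _ ≤ |(n : ℝ)| * ε * p x ^ (n - 1) * p x := by
        have := hzp (n - 1) x
        gcongr
        exact hx x i
      _ = _ := by ring
  have hε2 : ε * ε ≤ ε := mul_le_of_le_one_right hε.le hε1
  refine ⟨hczpow m, ?_, fun x => (hzp m x).le, fun x => ?_, fun i x => ?_, fun i x => ?_⟩
  · have h1 := integrable_rpow_neg_one_add_norm_sq (E := Space d) (μ := volume)
      (r := 2 * (d + 1)) (by simp only [finrank_euclideanSpace, Fintype.card_fin]; linarith)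
    refine (h1.comp_smul hε.ne').congr (Eventually.of_forall fun x => ?_)
    simp only [weight, norm_smul, Real.norm_of_nonneg hε.le, mul_pow]
    rw [← Real.rpow_intCast]
    congr 1
    push_cast
    ring
  · change p x ^ m ≤ 1
    exact zpow_le_one_of_nonpos₀ (hp1 x) (by omega)
  · change |pderiv i (fun x => p x ^ m) x| ≤ _ * p x ^ m
    rw [hd1]
    refine (hb1 m i x).trans ?_
    rw [hmabs]
    have := hzp m x
    gcongr
    nlinarith
  · change |pderiv i (pderiv i (fun x => p x ^ m)) x| ≤ _ * p x ^ m
    have e : pderiv i (pderiv i (fun x => p x ^ m)) x =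
        (m * p x ^ (m - 1)) * (2 * ε ^ 2) +
          m * (((m - 1 : ℤ) * p x ^ (m - 1 - 1)) * (2 * ε ^ 2 * x i)) * (2 * ε ^ 2 * x i) := by
      have e1 : pderiv i (fun x => p x ^ m) =
          fun x => (m * (2 * ε ^ 2)) * (p x ^ (m - 1) * x i) := by
        rw [hd1]; ext x; ring
      have cx : ContDiff ℝ ∞ fun x : Space d => x i :=
        (EuclideanSpace.proj i : Space d →L[ℝ] ℝ).contDiff
      have e2 := pderiv_mul (i := i) (contDiff_const (c := m * (2 * ε ^ 2)) (E := Space d))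
        ((hczpow (m - 1)).mul cx)
      rw [e1, e2, pderiv_mul (hczpow (m - 1)) cx, hd1]
      have e3 : pderiv i (fun _ : Space d => m * (2 * ε ^ 2)) x = 0 := by
        simp [pderiv]
      simp only
      rw [e3, pderiv_coord]
      ring
    rw [e]
    have h1 := hb1 (m - 1) i x
    have h2 := hb1 m i x
    have h3 : |(m : ℝ) * (((m - 1 : ℤ) * p x ^ (m - 1 - 1)) * (2 * ε ^ 2 * x i)) *
        (2 * ε ^ 2 * x i)| ≤ (d + 1) * (d + 2) * ε * p x ^ m := by
      calc _ = |(m : ℝ)| * |((m - 1 : ℤ) * p x ^ (m - 1 - 1)) * (2 * ε ^ 2 * x i)| *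
            (ε * (2 * ε * |x i|)) := by
            rw [abs_mul, abs_mul, abs_mul (2 * ε ^ 2), abs_of_pos (by positivity : 0 < 2 * ε ^ 2)]
            ring
        _ ≤ |(m : ℝ)| * (|((m - 1 : ℤ) : ℝ)| * ε * p x ^ (m - 1)) * (1 * p x) := by
            have := hp0 x
            gcongr
            exact hx x i
        _ = (d + 1) * (d + 2) * ε * (p x ^ (m - 1) * p x) := by rw [hmabs, hmabs']; ring
        _ = _ := by rw [hz]
    have h4 : |(m * p x ^ (m - 1)) * (2 * ε ^ 2)| ≤ 2 * (d + 1) * ε * p x ^ m := by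
      rw [abs_mul, abs_mul, hmabs, abs_of_pos (hzp (m - 1) x),
        abs_of_pos (by positivity : 0 < 2 * ε ^ 2)]
      have h5 : p x ^ (m - 1) ≤ p x ^ m := zpow_le_zpow_right₀ (hp1 x) (by omega)
      calc (d + 1) * p x ^ (m - 1) * (2 * ε ^ 2) = 2 * (d + 1) * (ε * ε) * p x ^ (m - 1) := by ring
        _ ≤ 2 * (d + 1) * ε * p x ^ m := by
          have := hzp (m - 1) x
          gcongr
    refine (abs_add_le _ _).trans ((add_le_add h4 h3).trans ?_)
    have h6 : 0 ≤ ε * p x ^ m := (mul_pos hε (hzp m x)).le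
    nlinarith [mul_nonneg hdn h6]

lemma tendsto_weight (x : Space d) : Tendsto (fun ε : ℝ => weight d ε x) (𝓝 0) (𝓝 1) := by
  have h : ContinuousAt (fun ε : ℝ => weight d ε x) 0 := by
    unfold weight
    refine ContinuousAt.zpow₀ (by fun_prop) _ (Or.inl (by simp))
  simpa [ContinuousAt, weight] using h

/-! ### Mollification -/

/-- Convolution with a fixed kernel. -/
def moll (ρ f : Space d → ℝ) : Space d → ℝ := ρ ⋆[ContinuousLinearMap.lsmul ℝ ℝ] f

variable {ρ f : Space d → ℝ}

lemma moll_apply (ρ f : Space d → ℝ) (x : Space d) : moll ρ f x = ∫ y, f y * ρ (x - y) := by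
  rw [moll, convolution_eq_swap]
  simp [mul_comm]

lemma contDiff_moll (hρ : IsTest ρ) (hf : LocallyIntegrable f) : ContDiff ℝ ∞ (moll ρ f) :=
  hρ.2.contDiff_convolution_left _ hρ.1 hf

lemma pderiv_moll (hρ : IsTest ρ) (hf : LocallyIntegrable f) (i : Fin d) :
    pderiv i (moll ρ f) = moll (pderiv i ρ) f := by
  ext x
  have h := hρ.2.hasFDerivAt_convolution_left (ContinuousLinearMap.lsmul ℝ ℝ)
    (contDiff_infty.1 hρ.1 1) hf x
  rw [pderiv, moll, h.fderiv]
  have hex := (hρ.2.fderiv ℝ).convolutionExists_left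
    ((ContinuousLinearMap.lsmul ℝ ℝ : ℝ →L[ℝ] ℝ →L[ℝ] ℝ).precompL (Space d))
    (hρ.1.continuous_fderiv (by simp)) hf x
  rw [convolution_def, ContinuousLinearMap.integral_apply hex]
  rfl

lemma laplacian_moll (hρ : IsTest ρ) (hf : LocallyIntegrable f) :
    Δ (moll ρ f) = moll (Δ ρ) f := by
  rw [laplacian_eq_sum_pderiv (contDiff_moll hρ hf)]
  ext x
  have h1 : ∀ i, pderiv i (pderiv i (moll ρ f)) x = moll (pderiv i (pderiv i ρ)) f x := fun i => by
    rw [pderiv_moll hρ hf, pderiv_moll hρ.pderiv hf]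
  have h2 : ∀ i, Integrable fun y => f y * pderiv i (pderiv i ρ) (x - y) := fun i => by
    have h := (hρ.pderiv (i := i)).pderiv (i := i)
    have h3 : HasCompactSupport fun y => pderiv i (pderiv i ρ) (x - y) :=
      h.2.comp_homeomorph (Homeomorph.subLeft x)
    exact hf.integrable_smul_right_of_hasCompactSupport
      (h.1.continuous.comp (continuous_const.sub continuous_id)) h3
  simp only [h1, moll_apply]
  rw [← integral_finsetSum _ fun i _ => h2 i, laplacian_eq_sum_pderiv hρ.1]
  simp only [Finset.mul_sum]

lemma pderiv_comp_sub (hρ : ContDiff ℝ ∞ ρ) (x : Space d) (i : Fin d) :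
    pderiv i (fun y => ρ (x - y)) = fun y => -pderiv i ρ (x - y) := by
  ext y
  have h1 : HasFDerivAt (fun y : Space d => x - y) (-ContinuousLinearMap.id ℝ (Space d)) y :=
    (hasFDerivAt_id y).const_sub x
  have h2 := (differentiable_of_smooth hρ (x - y)).hasFDerivAt.comp y h1
  rw [pderiv, show (fun y => ρ (x - y)) = ρ ∘ fun y => x - y from rfl, h2.fderiv]
  simp [pderiv]

lemma IsTest.comp_sub (hρ : IsTest ρ) (x : Space d) : IsTest fun y => ρ (x - y) :=
  ⟨hρ.1.comp (contDiff_const.sub contDiff_id), hρ.2.comp_homeomorph (Homeomorph.subLeft x)⟩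

lemma laplacian_comp_sub (hρ : IsTest ρ) (x y : Space d) :
    Δ (fun y => ρ (x - y)) y = Δ ρ (x - y) := by
  rw [laplacian_eq_sum_pderiv (hρ.comp_sub x).1, laplacian_eq_sum_pderiv hρ.1]
  refine Finset.sum_congr rfl fun i _ => ?_
  have h1 : pderiv i (fun y => -pderiv i ρ (x - y)) =
      fun y => pderiv i (pderiv i ρ) (x - y) := by
    have h2 := pderiv_comp_sub (i := i) (contDiff_pderiv (i := i) hρ.1).neg x
    rw [h2]
    ext y
    simp [pderiv, fderiv_fun_neg]
    rfl
  rw [pderiv_comp_sub hρ.1, h1]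

lemma integrable_mul_comp_sub (hρ : IsTest ρ) (hf : LocallyIntegrable f) (x : Space d) :
    Integrable fun y => f y * ρ (x - y) :=
  hf.integrable_smul_right_of_hasCompactSupport (hρ.comp_sub x).1.continuous (hρ.comp_sub x).2

/-- Mollification commutes with weak Laplacians. -/
lemma moll_laplacian_of_isWeakLaplacian {u : Space d → ℝ} (h : IsWeakLaplacian f u)
    (hρ : IsTest ρ) : moll (Δ ρ) f = moll ρ u := by
  ext x
  rw [moll_apply, moll_apply, ← h.2 _ (hρ.comp_sub x)]
  simp only [laplacian_comp_sub hρ]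

lemma abs_moll_le_of_bounded {M : ℝ} (hM : ∀ᵐ y, |f y| ≤ M) (hρ : IsTest ρ)
    (x : Space d) : |moll ρ f x| ≤ M * ∫ y, |ρ y| := by
  have hρi : Integrable fun y => |ρ y| :=
    (hρ.1.continuous.integrable_of_hasCompactSupport hρ.2).abs
  rw [moll_apply, ← integral_sub_left_eq_self (fun y => |ρ y|) volume x, ← integral_const_mul,
    ← Real.norm_eq_abs]
  refine norm_integral_le_of_norm_le ((hρi.comp_sub_left x).const_mul M) ?_
  filter_upwards [hM] with y hy
  rw [Real.norm_eq_abs, abs_mul]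
  gcongr

lemma exists_abs_moll_L2_le (hρ : IsTest ρ) : ∃ C, ∀ (f : F02 d) (x : Space d),
    |moll ρ f x| ≤ C * ‖f‖ := by
  have hm : MemLp ρ 2 := hρ.1.continuous.memLp_of_hasCompactSupport hρ.2
  refine ⟨(eLpNorm ρ 2 volume).toReal, fun f x => ?_⟩
  have hm' : MemLp (fun y => ρ (x - y)) 2 :=
    (hρ.comp_sub x).1.continuous.memLp_of_hasCompactSupport (hρ.comp_sub x).2
  have h1 : moll ρ f x = inner ℝ (hm'.toLp _) f := by
    rw [moll_apply, L2.inner_def]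
    refine integral_congr_ae ?_
    filter_upwards [hm'.coeFn_toLp] with y hy
    rw [hy]
    rfl
  have h2 : ‖hm'.toLp _‖ = (eLpNorm ρ 2 volume).toReal := by
    rw [Lp.norm_toLp]
    congr 1
    exact eLpNorm_comp_measurePreserving hm.1 (Measure.measurePreserving_sub_left volume x)
  rw [h1, ← h2]
  exact abs_real_inner_le_norm _ _

end

section

open scoped Convolution

variable {d : ℕ}

/-- Bump functions shrinking to the origin. -/
def shrinkingBump (d n : ℕ) : ContDiffBump (0 : Space d) where
  rIn := 1 / (n + 1)
  rOut := 2 / (n + 1)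
  rIn_pos := by positivity
  rIn_lt_rOut := by gcongr; norm_num

/-- A sequence of smooth probability densities shrinking to the origin. -/
def mollifier (d n : ℕ) : Space d → ℝ := (shrinkingBump d n).normed volume

lemma isTest_mollifier (n : ℕ) : IsTest (mollifier d n) :=
  ⟨(shrinkingBump d n).contDiff_normed, (shrinkingBump d n).hasCompactSupport_normed⟩

lemma mollifier_nonneg (n : ℕ) (x : Space d) : 0 ≤ mollifier d n x :=
  (shrinkingBump d n).nonneg_normed x

lemma integral_abs_mollifier (n : ℕ) : ∫ x, |mollifier d n x| = 1 := by
  simp only [abs_of_nonneg (mollifier_nonneg n _)]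
  exact (shrinkingBump d n).integral_normed

lemma tendsto_moll_mollifier {f : Space d → ℝ} (hf : LocallyIntegrable f) :
    ∀ᵐ x, Tendsto (fun n => moll (mollifier d n) f x) atTop (𝓝 (f x)) := by
  refine ContDiffBump.ae_convolution_tendsto_right_of_locallyIntegrable (K := 2)
    (φ := fun n => shrinkingBump d n) ?_ (Eventually.of_forall fun n => ?_) hf
  · simpa [shrinkingBump, div_eq_mul_inv] using
      tendsto_one_div_add_atTop_nhds_zero_nat.const_mul (2 : ℝ)
  · simp only [shrinkingBump]
    exact le_of_eq (by ring)

lemma lintegral_sq_moll_mollifier_le (n : ℕ) (f : F02 d) :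
    ∫⁻ x, ‖moll (mollifier d n) f x‖ₑ ^ 2 ≤ ∫⁻ x, ‖f x‖ₑ ^ 2 := by
  have hm : Measurable fun x => ‖mollifier d n x‖ₑ :=
    (isTest_mollifier n).1.continuous.measurable.enorm
  have hf : Measurable fun x => ‖f x‖ₑ := (Lp.stronglyMeasurable f).enorm
  have h1 : ∫⁻ x, ‖mollifier d n x‖ₑ = 1 := by
    rw [← ofReal_integral_norm_eq_lintegral_enorm
      ((isTest_mollifier n).1.continuous.integrable_of_hasCompactSupport (isTest_mollifier n).2)]
    simp only [Real.norm_eq_abs, integral_abs_mollifier, ENNReal.ofReal_one]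
  have h2 := lintegral_lconvolution_sq_le hm hf
  rw [h1, one_pow, one_mul] at h2
  refine le_trans (lintegral_mono fun x => ?_) h2
  have h3 : ‖moll (mollifier d n) f x‖ₑ ≤
      ((fun x => ‖mollifier d n x‖ₑ) ⋆ₗ fun x => ‖f x‖ₑ) x := by
    refine (enorm_integral_le_lintegral_enorm _).trans (lintegral_mono fun y => ?_)
    simp [enorm_mul, show -y + x = x - y by abel]
  gcongr

/-! ### Measurability in time of the nonlinearity -/

lemma continuous_moll_L2 {ρ : Space d → ℝ} (hρ : IsTest ρ) (x : Space d) :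
    Continuous fun f : F02 d => moll ρ f x := by
  obtain ⟨C, hC⟩ := exists_abs_moll_L2_le hρ
  refine (LipschitzWith.of_dist_le_mul (K := C.toNNReal) fun f g => ?_).continuous
  have h := hC (f - g) x
  have e : moll ρ (f - g : F02 d) x = moll ρ f x - moll ρ g x := by
    simp only [moll_apply]
    rw [← integral_sub (integrable_mul_comp_sub hρ (locallyIntegrable_L2 f) x)
      (integrable_mul_comp_sub hρ (locallyIntegrable_L2 g) x)]
    refine integral_congr_ae ?_
    filter_upwards [Lp.coeFn_sub f g] with y hy
    rw [hy, Pi.sub_apply]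
    ring
  rw [e] at h
  rw [Real.dist_eq, dist_eq_norm]
  refine h.trans (mul_le_mul_of_nonneg_right (Real.le_coe_toNNReal C) (norm_nonneg _))

/-- A bounded curve of weak Laplacians of a continuous curve in `L²`. -/
structure IsLaplacianCurve (M : ℝ) (h : ℝ → F02 d) (u : ℝ → Space d → ℝ) : Prop where
  continuous : Continuous h
  isWeakLaplacian : ∀ s, IsWeakLaplacian (h s) (u s)
  bounded : ∀ s, ∀ᵐ x, |u s x| ≤ M

variable {M : ℝ} {h g : ℝ → F02 d} {u v : ℝ → Space d → ℝ}

lemma stronglyMeasurable_moll_L2 (hh : Continuous h) {ρ : Space d → ℝ} (hρ : IsTest ρ) :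
    StronglyMeasurable fun p : Space d × ℝ => moll ρ (h p.2) p.1 :=
  stronglyMeasurable_uncurry_of_continuous_of_stronglyMeasurable
    (u := fun x s => moll ρ (h s) x)
    (fun s => (contDiff_moll hρ (locallyIntegrable_L2 (h s))).continuous)
    fun x => ((continuous_moll_L2 hρ x).comp hh).stronglyMeasurable

lemma IsLaplacianCurve.aestronglyMeasurable (hu : IsLaplacianCurve M h u) (s : ℝ) :
    AEStronglyMeasurable (u s) volume :=
  (hu.isWeakLaplacian s).1.aestronglyMeasurable

lemma IsLaplacianCurve.ae_exp_le (hu : IsLaplacianCurve M h u) (s : ℝ) :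
    ∀ᵐ x, |Real.exp (-(u s x))| ≤ Real.exp M := by
  filter_upwards [hu.bounded s] with x hx
  rw [abs_of_pos (Real.exp_pos _)]
  exact Real.exp_le_exp.2 ((neg_le_abs _).trans hx)

lemma IsLaplacianCurve.locallyIntegrable_exp (hu : IsLaplacianCurve M h u) (s : ℝ) :
    LocallyIntegrable fun x => Real.exp (-(u s x)) := by
  have h1 : MemLp (fun x => Real.exp (-(u s x))) ⊤ volume :=
    memLp_top_of_bound (Real.continuous_exp.comp_aestronglyMeasurable
      (hu.aestronglyMeasurable s).neg) _ (hu.ae_exp_le s)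
  exact h1.locallyIntegrable le_top

/-- The curve of Laplacians is only weakly continuous in time, but the mollified exponentials are
measurable in time, as limits of continuous functions of mollified Laplacians. -/
lemma IsLaplacianCurve.measurable_moll_exp (hu : IsLaplacianCurve M h u) {ρ : Space d → ℝ}
    (hρ : IsTest ρ) (x : Space d) :
    StronglyMeasurable fun s => moll ρ (fun y => Real.exp (-(u s y))) x := by
  set U : ℕ → ℝ → Space d → ℝ := fun n s y => moll (mollifier d n) (u s) y with hU
  have hUm : ∀ n, StronglyMeasurable fun p : ℝ × Space d => U n p.1 p.2 := fun n => by
    have h1 := (stronglyMeasurable_moll_L2 hu.continuous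
      (isTest_mollifier n).laplacian).comp_measurable
      (measurable_swap : Measurable (Prod.swap : ℝ × Space d → Space d × ℝ))
    have e : (fun p : ℝ × Space d => U n p.1 p.2) =
        fun p => moll (Δ (mollifier d n)) (h p.1) p.2 := by
      ext p
      rw [moll_laplacian_of_isWeakLaplacian (hu.isWeakLaplacian p.1) (isTest_mollifier n)]
    rw [e]
    exact h1
  have hm : ∀ n, StronglyMeasurable fun s => ∫ y, Real.exp (-(U n s y)) * ρ (x - y) := fun n => by
    refine StronglyMeasurable.integral_prod_right'
      (f := fun p : ℝ × Space d => Real.exp (-(U n p.1 p.2)) * ρ (x - p.2)) ?_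
    refine (Real.continuous_exp.comp_stronglyMeasurable (hUm n).neg).mul ?_
    have : Continuous fun p : ℝ × Space d => ρ (x - p.2) :=
      hρ.1.continuous.comp (continuous_const.sub continuous_snd)
    exact this.stronglyMeasurable
  refine stronglyMeasurable_of_tendsto atTop hm (tendsto_pi_nhds.2 fun s => ?_)
  rw [moll_apply]
  refine tendsto_integral_of_dominated_convergence (fun y => Real.exp M * |ρ (x - y)|)
    (fun n => ?_) ?_ (fun n => Eventually.of_forall fun y => ?_) ?_
  · have h1 := (contDiff_moll (isTest_mollifier n) (hu.isWeakLaplacian s).1).continuous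
    exact ((Real.continuous_exp.comp h1.neg).mul
      (hρ.comp_sub x).1.continuous).aestronglyMeasurable
  · exact (((hρ.comp_sub x).1.continuous.integrable_of_hasCompactSupport
      (hρ.comp_sub x).2).abs.const_mul _)
  · rw [Real.norm_eq_abs, abs_mul]
    gcongr
    rw [abs_of_pos (Real.exp_pos _)]
    refine Real.exp_le_exp.2 ((neg_le_abs _).trans ?_)
    have h1 := abs_moll_le_of_bounded (hu.bounded s) (isTest_mollifier n) y
    rwa [integral_abs_mollifier, mul_one] at h1
  · filter_upwards [tendsto_moll_mollifier (hu.isWeakLaplacian s).1] with y hy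
    exact ((Real.continuous_exp.tendsto _).comp hy.neg).mul_const _

end

/-! ### The energy of the difference of two solutions -/

section

open scoped Convolution

variable {d : ℕ}

/-- The identity `(f²)' = 2 f f'` for a primitive of a merely integrable function. -/
lemma sq_eq_integral_of_primitive {B f : ℝ → ℝ} {t : ℝ} (ht : 0 ≤ t)
    (hB : IntervalIntegrable B volume 0 t) (hf : ∀ s ∈ Icc 0 t, f s = ∫ r in (0 : ℝ)..s, B r) :
    f t ^ 2 = ∫ s in (0 : ℝ)..t, 2 * (f s * B s) := by
  set F : ℝ → ℝ := fun s => ∫ r in (0 : ℝ)..s, B r with hF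
  have hac : AbsolutelyContinuousOnInterval F 0 t :=
    hB.absolutelyContinuousOnInterval_intervalIntegral (by simp)
  have h := hac.integral_deriv_mul_eq_sub hac
  have h0 : F 0 = 0 := by simp [hF]
  rw [h0, mul_zero, sub_zero, ← sq] at h
  rw [hf t ⟨ht, le_rfl⟩, ← h]
  refine intervalIntegral.integral_congr_ae ?_
  filter_upwards [hB.ae_hasDerivAt_integral] with s hs hs'
  have hs'' : s ∈ uIcc 0 t := uIoc_subset_uIcc hs'
  rw [(hs hs'' 0 (by simp)).deriv, hf s (by rwa [uIcc_of_le ht] at hs'')]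
  ring

variable {χ : Space d → ℝ} {κ : ℝ}

lemma IsSlowWeight.integrable_prod (hχ : IsSlowWeight κ χ) {ν : Measure ℝ} [IsFiniteMeasure ν]
    {P : Space d × ℝ → ℝ} (hP : StronglyMeasurable P) {C : ℝ} (hC : ∀ p, |P p| ≤ C) :
    Integrable (fun p => χ p.1 * P p) ((volume : Measure (Space d)).prod ν) := by
  have h1 : Integrable (fun p : Space d × ℝ => χ p.1 * C) ((volume : Measure (Space d)).prod ν) :=
    hχ.integrable.mul_prod (integrable_const C)
  refine h1.mono' ?_ (Eventually.of_forall fun p => ?_)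
  · exact ((hχ.smooth.continuous.comp continuous_fst).stronglyMeasurable.mul
      hP).aestronglyMeasurable
  · rw [Real.norm_eq_abs, abs_mul, abs_of_nonneg (hχ.nonneg _)]
    exact mul_le_mul_of_nonneg_left (hC p) (hχ.nonneg _)

lemma boundedSmooth_moll {ρ f : Space d → ℝ} (hρ : IsTest ρ) (hf : LocallyIntegrable f)
    (hb : ∀ ρ : Space d → ℝ, IsTest ρ → ∃ C, ∀ x, |moll ρ f x| ≤ C) :
    BoundedSmooth (moll ρ f) where
  smooth := contDiff_moll hρ hf
  bounded := hb ρ hρ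
  bounded_pderiv i := by
    rw [pderiv_moll hρ hf]
    exact hb _ hρ.pderiv
  bounded_pderiv_pderiv i := by
    rw [pderiv_moll hρ hf, pderiv_moll hρ.pderiv hf]
    exact hb _ hρ.pderiv.pderiv

variable {M : ℝ} {h g : ℝ → F02 d} {u v : ℝ → Space d → ℝ}

lemma IsLaplacianCurve.sub (hu : IsLaplacianCurve M h u) (hv : IsLaplacianCurve M g v) :
    IsLaplacianCurve (2 * M) (fun s => h s - g s) (fun s x => u s x - v s x) where
  continuous := hu.continuous.sub hv.continuous
  isWeakLaplacian s := by
    have h1 := hu.isWeakLaplacian s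
    have h2 := hv.isWeakLaplacian s
    refine ⟨h1.1.sub h2.1, fun φ hφ => ?_⟩
    have i1 : ∀ {f p : Space d → ℝ}, LocallyIntegrable f → IsTest p →
        Integrable fun x => f x * p x := fun hf hp =>
      hf.integrable_smul_right_of_hasCompactSupport hp.1.continuous hp.2
    have e1 : ∫ x, (h s - g s : F02 d) x * Δ φ x = (∫ x, h s x * Δ φ x) - ∫ x, g s x * Δ φ x := by
      rw [← integral_sub (i1 (locallyIntegrable_L2 _) hφ.laplacian)
        (i1 (locallyIntegrable_L2 _) hφ.laplacian)]
      refine integral_congr_ae ?_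
      filter_upwards [Lp.coeFn_sub (h s) (g s)] with x hx
      rw [hx, Pi.sub_apply, sub_mul]
    rw [e1, h1.2 φ hφ, h2.2 φ hφ, ← integral_sub (i1 h1.1 hφ) (i1 h2.1 hφ)]
    simp only [sub_mul]
  bounded s := by
    filter_upwards [hu.bounded s, hv.bounded s] with x h1 h2
    exact (abs_sub _ _).trans (by linarith)

/-- The difference of the nonlinearities of two solutions. -/
def expDiff (u v : ℝ → Space d → ℝ) (s : ℝ) (x : Space d) : ℝ :=
  Real.exp (-(u s x)) - Real.exp (-(v s x))

lemma locallyIntegrable_expDiff (hu : IsLaplacianCurve M h u) (hv : IsLaplacianCurve M g v)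
    (s : ℝ) : LocallyIntegrable (expDiff u v s) :=
  (hu.locallyIntegrable_exp s).sub (hv.locallyIntegrable_exp s)

lemma abs_expDiff_le (hu : IsLaplacianCurve M h u) (hv : IsLaplacianCurve M g v) (s : ℝ) :
    ∀ᵐ x, |expDiff u v s x| ≤ 2 * Real.exp M := by
  filter_upwards [hu.ae_exp_le s, hv.ae_exp_le s] with x h1 h2
  exact (abs_sub _ _).trans (by linarith)

lemma moll_expDiff (hu : IsLaplacianCurve M h u) (hv : IsLaplacianCurve M g v)
    {ρ : Space d → ℝ} (hρ : IsTest ρ) (s : ℝ) (x : Space d) :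
    moll ρ (expDiff u v s) x = moll ρ (fun y => Real.exp (-(u s y))) x -
      moll ρ (fun y => Real.exp (-(v s y))) x := by
  simp only [moll_apply]
  rw [← integral_sub (integrable_mul_comp_sub hρ (hu.locallyIntegrable_exp s) x)
    (integrable_mul_comp_sub hρ (hv.locallyIntegrable_exp s) x)]
  simp only [expDiff, sub_mul]

lemma stronglyMeasurable_moll_expDiff (hu : IsLaplacianCurve M h u)
    (hv : IsLaplacianCurve M g v) {ρ : Space d → ℝ} (hρ : IsTest ρ) :
    StronglyMeasurable fun p : Space d × ℝ => moll ρ (expDiff u v p.2) p.1 := by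
  refine stronglyMeasurable_uncurry_of_continuous_of_stronglyMeasurable
    (u := fun x s => moll ρ (expDiff u v s) x)
    (fun s => (contDiff_moll hρ (locallyIntegrable_expDiff hu hv s)).continuous) fun x => ?_
  simp only [moll_expDiff hu hv hρ]
  exact (hu.measurable_moll_exp hρ x).sub (hv.measurable_moll_exp hρ x)

/-- The time derivative of the weighted energy `∫ χ w²` is at most `2 ∫ χ a z` plus errors due to
the weight, where `a` is the difference of the nonlinearities and `z = Δ w`. This is the density
`a z` together with the part of the errors that is quadratic in `a` and `z`. -/
def dissipation (κ a z : ℝ) (d : ℕ) : ℝ := a * z + 2 * (d + 1) * κ * (a ^ 2 + z ^ 2)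

lemma abs_dissipation_le {κ a z C : ℝ} (hκ : 0 ≤ κ) (ha : |a| ≤ C) (hz : |z| ≤ C) :
    |dissipation κ a z d| ≤ (1 + 4 * (d + 1) * κ) * C ^ 2 := by
  have h1 : a ^ 2 ≤ C ^ 2 := by rw [← sq_abs a]; gcongr
  have h2 : z ^ 2 ≤ C ^ 2 := by rw [← sq_abs z]; gcongr
  have h3 : |a * z| ≤ C ^ 2 := by
    rw [abs_mul, sq]
    exact mul_le_mul ha hz (abs_nonneg _) ((abs_nonneg _).trans ha)
  have h4 : |2 * (d + 1) * κ * (a ^ 2 + z ^ 2)| ≤ 2 * (d + 1) * κ * (C ^ 2 + C ^ 2) := by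
    rw [abs_of_nonneg (by positivity)]
    gcongr
  refine (abs_add_le _ _).trans ((add_le_add h3 h4).trans (le_of_eq ?_))
  ring

lemma stronglyMeasurable_moll_sub (hu : IsLaplacianCurve M h u) (hv : IsLaplacianCurve M g v)
    {ρ : Space d → ℝ} (hρ : IsTest ρ) :
    StronglyMeasurable fun p : Space d × ℝ => moll ρ (fun y => u p.2 y - v p.2 y) p.1 := by
  have hz := hu.sub hv
  have e : (fun p : Space d × ℝ => moll ρ (fun y => u p.2 y - v p.2 y) p.1) =
      fun p => moll (Δ ρ) (h p.2 - g p.2 : F02 d) p.1 := by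
    ext p
    rw [moll_laplacian_of_isWeakLaplacian (hz.isWeakLaplacian p.2) hρ]
  rw [e]
  exact stronglyMeasurable_moll_L2 hz.continuous hρ.laplacian

/-- A common bound of the mollified nonlinearities and Laplacians. -/
lemma abs_dissipation_moll_le (hκ : 0 ≤ κ) (hu : IsLaplacianCurve M h u)
    (hv : IsLaplacianCurve M g v) {ρ : Space d → ℝ} (hρ : IsTest ρ) (s : ℝ) (x : Space d) :
    |dissipation κ (moll ρ (expDiff u v s) x) (moll ρ (fun y => u s y - v s y) x) d| ≤
      (1 + 4 * (d + 1) * κ) *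
        (max (2 * Real.exp M * ∫ y, |ρ y|) (2 * M * ∫ y, |ρ y|)) ^ 2 :=
  abs_dissipation_le hκ
    ((abs_moll_le_of_bounded (abs_expDiff_le hu hv s) hρ x).trans (le_max_left _ _))
    ((abs_moll_le_of_bounded ((hu.sub hv).bounded s) hρ x).trans (le_max_right _ _))

lemma integrable_dissipation_moll (hχ : IsSlowWeight κ χ) (hκ : 0 ≤ κ)
    (hu : IsLaplacianCurve M h u) (hv : IsLaplacianCurve M g v) {ρ : Space d → ℝ}
    (hρ : IsTest ρ) (ν : Measure ℝ) [IsFiniteMeasure ν] :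
    Integrable (fun p : Space d × ℝ => χ p.1 * dissipation κ (moll ρ (expDiff u v p.2) p.1)
      (moll ρ (fun y => u p.2 y - v p.2 y) p.1) d) ((volume : Measure (Space d)).prod ν) := by
  refine hχ.integrable_prod ?_ fun p => abs_dissipation_moll_le hκ hu hv hρ p.2 p.1
  have ham := stronglyMeasurable_moll_expDiff hu hv hρ
  have hzm := stronglyMeasurable_moll_sub hu hv hρ
  exact (ham.mul hzm).add (((ham.pow 2).add (hzm.pow 2)).const_mul _)

/-- The weighted energy of the mollified difference of two solutions. -/
lemma energy_le (hχ : IsSlowWeight κ χ) (hκ : 0 ≤ κ) (hκ1 : κ ≤ 1)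
    (hu : IsLaplacianCurve M h u) (hv : IsLaplacianCurve M g v) {W : ℝ}
    (hW : ∀ s, ‖h s - g s‖ ≤ W) {t : ℝ} (ht : 0 ≤ t) (ht1 : t ≤ 1)
    (heq : ∀ φ : Space d → ℝ, IsTest φ → ∀ r ∈ Icc 0 t,
      ∫ x, (h r - g r : F02 d) x * φ x = ∫ s in (0 : ℝ)..r, ∫ x, expDiff u v s x * Δ φ x)
    {ρ : Space d → ℝ} (hρ : IsTest ρ) {N : ℝ}
    (hN : ∀ s, ∫ x, χ x * moll ρ (h s - g s : F02 d) x ^ 2 ≤ N) :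
    ∫ x, χ x * moll ρ (h t - g t : F02 d) x ^ 2 ≤
      2 * (∫ s in (0 : ℝ)..t, ∫ x, χ x * dissipation κ (moll ρ (expDiff u v s) x)
        (moll ρ (fun y => u s y - v s y) x) d) + 4 * (d + 1) * κ * N := by
  have hz := hu.sub hv
  set w : ℝ → F02 d := fun s => h s - g s with hw
  set z : ℝ → Space d → ℝ := fun s y => u s y - v s y with hzdef
  set A := expDiff u v with hA
  have hAl := locallyIntegrable_expDiff hu hv
  have hAb := abs_expDiff_le hu hv
  obtain ⟨C, hC⟩ := exists_abs_moll_L2_le hρ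
  have hfb : ∀ s x, |moll ρ (w s) x| ≤ |C| * W := fun s x =>
    (hC (w s) x).trans (mul_le_mul (le_abs_self C) (hW s) (norm_nonneg _) (abs_nonneg _))
  have hBb := fun s => abs_moll_le_of_bounded (hAb s) hρ.laplacian
  set KB := 2 * Real.exp M * ∫ y, |Δ ρ y|
  have hfm : StronglyMeasurable fun p : Space d × ℝ => moll ρ (w p.2) p.1 :=
    stronglyMeasurable_moll_L2 hz.continuous hρ
  have hBm := stronglyMeasurable_moll_expDiff hu hv hρ.laplacian
  set ν : Measure ℝ := volume.restrict (Ioc 0 t) with hν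
  have hBi : ∀ x, IntervalIntegrable (fun s => moll (Δ ρ) (A s) x) volume 0 t := fun x => by
    refine (intervalIntegrable_const (c := KB)).mono_fun ?_ (Eventually.of_forall fun s => ?_)
    · exact (hBm.comp_measurable measurable_prodMk_left).aestronglyMeasurable
    · exact (hBb s x).trans (le_abs_self _)
  -- the equation tested with translates of the kernel
  have hprim : ∀ x, ∀ r ∈ Icc 0 t, moll ρ (w r) x = ∫ s in (0 : ℝ)..r, moll (Δ ρ) (A s) x :=
    fun x r hr => by
    rw [moll_apply, heq _ (hρ.comp_sub x) r hr]
    simp only [moll_apply, laplacian_comp_sub hρ]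
  have hsq : ∀ x, moll ρ (w t) x ^ 2 =
      ∫ s in (0 : ℝ)..t, 2 * (moll ρ (w s) x * moll (Δ ρ) (A s) x) := fun x =>
    sq_eq_integral_of_primitive ht (hBi x) (hprim x)
  set P : Space d × ℝ → ℝ := fun p => 2 * (moll ρ (w p.2) p.1 * moll (Δ ρ) (A p.2) p.1) with hP
  have hPi : Integrable (fun p => χ p.1 * P p) ((volume : Measure (Space d)).prod ν) := by
    refine hχ.integrable_prod ((hfm.mul hBm).const_mul 2) (C := 2 * (|C| * W * KB)) fun p => ?_
    rw [abs_mul, abs_mul, abs_of_pos (two_pos : (0 : ℝ) < 2)]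
    gcongr
    · exact (abs_nonneg _).trans (hfb p.2 p.1)
    · exact hfb p.2 p.1
    · exact hBb p.2 p.1
  set Q : Space d × ℝ → ℝ := fun p => dissipation κ (moll ρ (A p.2) p.1) (moll ρ (z p.2) p.1) d
  have hQi : Integrable (fun p => χ p.1 * Q p) ((volume : Measure (Space d)).prod ν) :=
    integrable_dissipation_moll hχ hκ hu hv hρ ν
  have hstep : ∀ s, ∫ x, χ x * P (x, s) ≤
      2 * (∫ x, χ x * Q (x, s)) + 4 * (d + 1) * κ * N := fun s => by
    have hfs : BoundedSmooth (moll ρ (w s)) := boundedSmooth_moll hρ (locallyIntegrable_L2 _)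
      fun ρ' hρ' => by
        obtain ⟨C', hC'⟩ := exists_abs_moll_L2_le hρ'
        exact ⟨_, hC' (w s)⟩
    have has : BoundedSmooth (moll ρ (A s)) := boundedSmooth_moll hρ (hAl s)
      fun ρ' hρ' => ⟨_, abs_moll_le_of_bounded (hAb s) hρ'⟩
    have h1 := integral_weight_mul_laplacian_le hχ hκ hκ1 hfs has
    rw [laplacian_moll hρ (hAl s), laplacian_moll hρ (locallyIntegrable_L2 _),
      moll_laplacian_of_isWeakLaplacian (hz.isWeakLaplacian s) hρ] at h1
    have h2 : ∫ x, χ x * P (x, s) =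
        2 * ∫ x, χ x * (moll ρ (w s) x * moll (Δ ρ) (A s) x) := by
      rw [← integral_const_mul]
      congr 1 with x
      simp only [hP]
      ring
    have h3 : 2 * (d + 1) * κ * ∫ x, χ x * moll ρ (w s) x ^ 2 ≤ 2 * (d + 1) * κ * N :=
      mul_le_mul_of_nonneg_left (hN s) (by positivity)
    rw [h2]
    have h4 : ∫ x, χ x * Q (x, s) = ∫ x, χ x * (moll ρ (A s) x * moll ρ (z s) x +
        2 * (d + 1) * κ * (moll ρ (A s) x ^ 2 + moll ρ (z s) x ^ 2)) := rfl
    rw [h4]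
    linarith
  have hN0 : 0 ≤ N := (integral_nonneg fun x => mul_nonneg (hχ.nonneg x) (sq_nonneg _)).trans (hN 0)
  calc ∫ x, χ x * moll ρ (w t) x ^ 2 = ∫ x, (∫ s, χ x * P (x, s) ∂ν) := by
        congr 1 with x
        rw [hsq x, intervalIntegral.integral_of_le ht, ← integral_const_mul]
    _ = ∫ s, (∫ x, χ x * P (x, s)) ∂ν := integral_integral_swap hPi
    _ ≤ ∫ s, (2 * (∫ x, χ x * Q (x, s)) + 4 * (d + 1) * κ * N) ∂ν := by
        refine integral_mono hPi.integral_prod_right ?_ hstep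
        exact (hQi.integral_prod_right.const_mul 2).add (integrable_const _)
    _ = 2 * (∫ s, (∫ x, χ x * Q (x, s)) ∂ν) + t * (4 * (d + 1) * κ * N) := by
        rw [integral_add (hQi.integral_prod_right.const_mul 2) (integrable_const _),
          integral_const_mul, integral_const]
        simp [hν, ht]
    _ ≤ 2 * (∫ s, (∫ x, χ x * Q (x, s)) ∂ν) + 4 * (d + 1) * κ * N := by
        have : 0 ≤ 4 * (d + 1) * κ * N := by positivity
        exact add_le_add le_rfl (mul_le_of_le_one_left this ht1)
    _ = _ := by rw [intervalIntegral.integral_of_le ht]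

end

/-! ### Uniqueness -/

section

open scoped Convolution

variable {d : ℕ}

lemma exp_diff_bounds_of_le {u v M : ℝ} (hu : |u| ≤ M) (hv : |v| ≤ M) (huv : v ≤ u) :
    Real.exp (-M) * (u - v) ≤ Real.exp (-v) - Real.exp (-u) ∧
      Real.exp (-v) - Real.exp (-u) ≤ Real.exp M * (u - v) := by
  have h1 := abs_le.1 hu
  have h2 := abs_le.1 hv
  have h0 : 0 ≤ u - v := sub_nonneg.2 huv
  constructor
  · have e : Real.exp (-v) = Real.exp (-u) * Real.exp (u - v) := by
      rw [← Real.exp_add]; ring_nf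
    have h3 := mul_le_mul_of_nonneg_left (Real.add_one_le_exp (u - v)) (Real.exp_pos (-u)).le
    have h4 := mul_le_mul_of_nonneg_right (Real.exp_le_exp.2 (by linarith : -M ≤ -u)) h0
    rw [e]
    linarith
  · have e : Real.exp (-u) = Real.exp (-v) * Real.exp (-(u - v)) := by
      rw [← Real.exp_add]; ring_nf
    have h3 := mul_le_mul_of_nonneg_left (Real.one_sub_le_exp_neg (u - v)) (Real.exp_pos (-v)).le
    have h4 := mul_le_mul_of_nonneg_right (Real.exp_le_exp.2 (by linarith : -v ≤ M)) h0
    rw [e]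
    linarith

/-- The nonlinearity `u ↦ exp (-u)` is strictly monotone, uniformly on bounded sets, so that its
contribution dominates the errors due to a weight of sufficiently small variation. -/
lemma dissipation_nonpos {κ u v M : ℝ} (hκ : 0 ≤ κ) (hu : |u| ≤ M) (hv : |v| ≤ M)
    (hκM : 2 * (d + 1) * κ * (Real.exp M ^ 2 + 1) ≤ Real.exp (-M)) :
    dissipation κ (Real.exp (-u) - Real.exp (-v)) (u - v) d ≤ 0 := by
  wlog huv : v ≤ u generalizing u v with H
  · have h := H hv hu (le_of_not_ge huv)
    refine le_of_eq_of_le ?_ h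
    unfold dissipation
    ring
  obtain ⟨h1, h2⟩ := exp_diff_bounds_of_le hu hv huv
  have h0 : 0 ≤ u - v := sub_nonneg.2 huv
  have hE := Real.exp_pos (-M)
  set A := Real.exp (-v) - Real.exp (-u)
  set z := u - v
  have hA0 : 0 ≤ A := (mul_nonneg hE.le h0).trans h1
  have h3 : A ^ 2 ≤ Real.exp M ^ 2 * z ^ 2 := by
    rw [← mul_pow]; gcongr
  have h4 : Real.exp (-M) * z ^ 2 ≤ A * z := by
    rw [sq, ← mul_assoc]; gcongr
  have h5 : 2 * (d + 1) * κ * (A ^ 2 + z ^ 2) ≤ Real.exp (-M) * z ^ 2 := by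
    calc 2 * (d + 1) * κ * (A ^ 2 + z ^ 2)
        ≤ 2 * (d + 1) * κ * (Real.exp M ^ 2 * z ^ 2 + z ^ 2) := by gcongr
      _ = 2 * (d + 1) * κ * (Real.exp M ^ 2 + 1) * z ^ 2 := by ring
      _ ≤ _ := by gcongr
  have e : Real.exp (-u) - Real.exp (-v) = -A := by ring
  rw [dissipation, e]
  nlinarith

lemma lintegral_sq_enorm_eq (f : F02 d) : ∫⁻ x, ‖f x‖ₑ ^ 2 = ‖f‖ₑ ^ 2 := by
  rw [Lp.enorm_def, eLpNorm_eq_lintegral_rpow_enorm_toReal (by norm_num) (by norm_num),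
    ← ENNReal.rpow_natCast (_ ^ _), ← ENNReal.rpow_mul]
  norm_num

variable {χ : Space d → ℝ} {κ : ℝ} {M : ℝ} {h g : ℝ → F02 d} {u v : ℝ → Space d → ℝ}

/-- The weighted energy of the difference of two solutions, after removing the mollification. -/
lemma lintegral_weight_mul_sq_le (hχ : IsSlowWeight κ χ) (hκ : 0 ≤ κ) (hκ1 : κ ≤ 1)
    (hκM : 2 * (d + 1) * κ * (Real.exp M ^ 2 + 1) ≤ Real.exp (-M))
    (hu : IsLaplacianCurve M h u) (hv : IsLaplacianCurve M g v) {W : ℝ}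
    (hW : ∀ s, ‖h s - g s‖ ≤ W) {t : ℝ} (ht : 0 ≤ t) (ht1 : t ≤ 1)
    (heq : ∀ φ : Space d → ℝ, IsTest φ → ∀ r ∈ Icc 0 t,
      ∫ x, (h r - g r : F02 d) x * φ x = ∫ s in (0 : ℝ)..r, ∫ x, expDiff u v s x * Δ φ x) :
    ∫⁻ x, ENNReal.ofReal (χ x) * ‖(h t - g t : F02 d) x‖ₑ ^ 2 ≤
      ENNReal.ofReal (4 * (d + 1) * κ * W ^ 2) := by
  have hW0 : 0 ≤ W := (norm_nonneg _).trans (hW 0)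
  set m := fun n => mollifier d n
  have hm := fun n => isTest_mollifier (d := d) n
  set w : ℝ → F02 d := fun s => h s - g s with hw
  -- the weighted energies of the mollifications, as lower integrals
  have henergy : ∀ n s, ENNReal.ofReal (∫ x, χ x * moll (m n) (w s) x ^ 2) =
      ∫⁻ x, ENNReal.ofReal (χ x) * ‖moll (m n) (w s) x‖ₑ ^ 2 := fun n s => by
    obtain ⟨C, hC⟩ := exists_abs_moll_L2_le (hm n)
    have hc := (contDiff_moll (hm n) (locallyIntegrable_L2 (w s))).continuous
    have hi := hχ.integrable_mul_mul hc hc ⟨_, hC (w s)⟩ ⟨_, hC (w s)⟩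
    simp only [← sq] at hi
    rw [ofReal_integral_eq_lintegral_ofReal hi
      (Eventually.of_forall fun x => mul_nonneg (hχ.nonneg x) (sq_nonneg _))]
    refine lintegral_congr fun x => ?_
    rw [ENNReal.ofReal_mul (hχ.nonneg x), ← sq_abs, ENNReal.ofReal_pow (abs_nonneg _),
      ← Real.norm_eq_abs, ofReal_norm]
  have hN : ∀ n s, ∫ x, χ x * moll (m n) (w s) x ^ 2 ≤ W ^ 2 := fun n s => by
    rw [← ENNReal.ofReal_le_ofReal_iff (by positivity), henergy]
    calc ∫⁻ x, ENNReal.ofReal (χ x) * ‖moll (m n) (w s) x‖ₑ ^ 2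
        ≤ ∫⁻ x, ‖moll (m n) (w s) x‖ₑ ^ 2 := by
          refine lintegral_mono fun x => mul_le_of_le_one_left (by simp) ?_
          rw [← ENNReal.ofReal_one]
          exact ENNReal.ofReal_le_ofReal (hχ.le_one x)
      _ ≤ ∫⁻ x, ‖w s x‖ₑ ^ 2 := lintegral_sq_moll_mollifier_le n (w s)
      _ = ENNReal.ofReal (‖w s‖ ^ 2) := by
          rw [lintegral_sq_enorm_eq, ← ofReal_norm, ENNReal.ofReal_pow (norm_nonneg _)]
      _ ≤ _ := by
          refine ENNReal.ofReal_le_ofReal ?_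
          have := hW s
          gcongr
  set Φ : ℕ → ℝ → ℝ := fun n s => ∫ x, χ x * dissipation κ (moll (m n) (expDiff u v s) x)
    (moll (m n) (fun y => u s y - v s y) x) d with hΦ
  set C := (1 + 4 * (d + 1) * κ) * (max (2 * Real.exp M) (2 * M)) ^ 2 with hC
  have hb : ∀ n s x, |dissipation κ (moll (m n) (expDiff u v s) x)
      (moll (m n) (fun y => u s y - v s y) x) d| ≤ C := fun n s x => by
    have h1 := abs_dissipation_moll_le hκ hu hv (hm n) s x
    rwa [integral_abs_mollifier, mul_one, mul_one] at h1
  have hb' : ∀ n s x, ‖χ x * dissipation κ (moll (m n) (expDiff u v s) x)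
      (moll (m n) (fun y => u s y - v s y) x) d‖ ≤ χ x * C := fun n s x => by
    rw [Real.norm_eq_abs, abs_mul, abs_of_nonneg (hχ.nonneg x)]
    exact mul_le_mul_of_nonneg_left (hb n s x) (hχ.nonneg x)
  have hdcont : Continuous fun p : ℝ × ℝ => dissipation κ p.1 p.2 d := by
    unfold dissipation
    fun_prop
  have hΦlim : ∀ s, Tendsto (fun n => Φ n s) atTop
      (𝓝 (∫ x, χ x * dissipation κ (expDiff u v s x) (u s x - v s x) d)) := fun s => by
    have hAl := locallyIntegrable_expDiff hu hv s
    have hzl := ((hu.sub hv).isWeakLaplacian s).1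
    refine tendsto_integral_of_dominated_convergence (fun x => χ x * C) (fun n => ?_)
      (hχ.integrable.mul_const C) (fun n => Eventually.of_forall (hb' n s)) ?_
    · exact (hχ.smooth.continuous.mul (hdcont.comp ((contDiff_moll (hm n) hAl).continuous.prodMk
        (contDiff_moll (hm n) hzl).continuous))).aestronglyMeasurable
    · filter_upwards [tendsto_moll_mollifier hAl, tendsto_moll_mollifier hzl] with x h1 h2
      exact ((hdcont.tendsto _).comp (h1.prodMk_nhds h2)).const_mul _
  have hΦint : Tendsto (fun n => ∫ s in (0 : ℝ)..t, Φ n s) atTop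
      (𝓝 (∫ s in (0 : ℝ)..t, ∫ x, χ x * dissipation κ (expDiff u v s x) (u s x - v s x) d)) := by
    simp only [intervalIntegral.integral_of_le ht]
    refine tendsto_integral_of_dominated_convergence (fun _ => ∫ x, χ x * C) (fun n => ?_)
      (integrable_const _) (fun n => Eventually.of_forall fun s => ?_)
      (Eventually.of_forall hΦlim)
    · exact (integrable_dissipation_moll hχ hκ hu hv (hm n) _).integral_prod_right.1
    · exact norm_integral_le_of_norm_le (hχ.integrable.mul_const C)
        (Eventually.of_forall (hb' n s))
  have hneg : ∫ s in (0 : ℝ)..t, ∫ x, χ x * dissipation κ (expDiff u v s x) (u s x - v s x) d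
      ≤ 0 := by
    rw [intervalIntegral.integral_of_le ht]
    refine integral_nonpos fun s => integral_nonpos_of_ae ?_
    filter_upwards [hu.bounded s, hv.bounded s] with x h1 h2
    exact mul_nonpos_of_nonneg_of_nonpos (hχ.nonneg x) (dissipation_nonpos hκ h1 h2 hκM)
  have hle : ∀ n, ∫⁻ x, ENNReal.ofReal (χ x) * ‖moll (m n) (w t) x‖ₑ ^ 2 ≤
      ENNReal.ofReal (2 * (∫ s in (0 : ℝ)..t, Φ n s) + 4 * (d + 1) * κ * W ^ 2) := fun n => by
    rw [← henergy]
    exact ENNReal.ofReal_le_ofReal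
      (energy_le hχ hκ hκ1 hu hv hW ht ht1 heq (hm n) (hN n))
  have hlim : Tendsto (fun n => ENNReal.ofReal (2 * (∫ s in (0 : ℝ)..t, Φ n s) +
      4 * (d + 1) * κ * W ^ 2)) atTop (𝓝 (ENNReal.ofReal (2 * (∫ s in (0 : ℝ)..t,
        ∫ x, χ x * dissipation κ (expDiff u v s x) (u s x - v s x) d) +
          4 * (d + 1) * κ * W ^ 2))) :=
    (ENNReal.continuous_ofReal.tendsto _).comp ((hΦint.const_mul 2).add_const _)
  calc ∫⁻ x, ENNReal.ofReal (χ x) * ‖w t x‖ₑ ^ 2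
      ≤ ∫⁻ x, liminf (fun n => ENNReal.ofReal (χ x) * ‖moll (m n) (w t) x‖ₑ ^ 2) atTop := by
        refine lintegral_mono_ae ?_
        filter_upwards [tendsto_moll_mollifier (locallyIntegrable_L2 (w t))] with x hx
        refine le_of_eq (Tendsto.liminf_eq ?_).symm
        exact ENNReal.Tendsto.const_mul (((ENNReal.continuous_pow 2).tendsto _).comp hx.enorm)
          (Or.inr ENNReal.ofReal_ne_top)
    _ ≤ liminf (fun n => ∫⁻ x, ENNReal.ofReal (χ x) * ‖moll (m n) (w t) x‖ₑ ^ 2) atTop := by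
        refine lintegral_liminf_le fun n => ?_
        exact hχ.smooth.continuous.measurable.ennreal_ofReal.mul
          ((contDiff_moll (hm n)
            (locallyIntegrable_L2 (w t))).continuous.measurable.enorm.pow_const 2)
    _ ≤ liminf (fun n => ENNReal.ofReal (2 * (∫ s in (0 : ℝ)..t, Φ n s) +
          4 * (d + 1) * κ * W ^ 2)) atTop := liminf_le_liminf (Eventually.of_forall hle)
    _ = _ := hlim.liminf_eq
    _ ≤ _ := ENNReal.ofReal_le_ofReal (by linarith)

/-- Letting the weight tend to one shows that the difference of two solutions vanishes. -/
lemma eq_of_laplacianCurve (hu : IsLaplacianCurve M h u) (hv : IsLaplacianCurve M g v) {W : ℝ}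
    (hW : ∀ s, ‖h s - g s‖ ≤ W) {t : ℝ} (ht : 0 ≤ t) (ht1 : t ≤ 1)
    (heq : ∀ φ : Space d → ℝ, IsTest φ → ∀ r ∈ Icc 0 t,
      ∫ x, (h r - g r : F02 d) x * φ x = ∫ s in (0 : ℝ)..r, ∫ x, expDiff u v s x * Δ φ x) :
    h t = g t := by
  set ε : ℕ → ℝ := fun n => 1 / ((n : ℝ) + 1) with hε
  have hεlim : Tendsto ε atTop (𝓝 0) := tendsto_one_div_add_atTop_nhds_zero_nat
  have hκlim : Tendsto (fun n => ((d : ℝ) + 3) ^ 2 * ε n) atTop (𝓝 0) := by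
    simpa using hεlim.const_mul (((d : ℝ) + 3) ^ 2)
  have hev1 : ∀ᶠ n in atTop, ((d : ℝ) + 3) ^ 2 * ε n ≤ 1 :=
    (hκlim.eventually_lt_const one_pos).mono fun n hn => hn.le
  have hev2 : ∀ᶠ n in atTop, 2 * ((d : ℝ) + 1) * (((d : ℝ) + 3) ^ 2 * ε n) *
      (Real.exp M ^ 2 + 1) ≤ Real.exp (-M) := by
    have h1 : Tendsto (fun n => 2 * ((d : ℝ) + 1) * (((d : ℝ) + 3) ^ 2 * ε n) *
        (Real.exp M ^ 2 + 1)) atTop (𝓝 0) := by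
      simpa using (hκlim.const_mul (2 * ((d : ℝ) + 1))).mul_const (Real.exp M ^ 2 + 1)
    exact (h1.eventually_lt_const (Real.exp_pos (-M))).mono fun n hn => hn.le
  have hle : ∀ᶠ n in atTop, ∫⁻ x, ENNReal.ofReal (weight d (ε n) x) *
      ‖(h t - g t : F02 d) x‖ₑ ^ 2 ≤
        ENNReal.ofReal (4 * (d + 1) * (((d : ℝ) + 3) ^ 2 * ε n) * W ^ 2) := by
    filter_upwards [hev1, hev2] with n h1 h2
    have hεpos : 0 < ε n := by simp only [hε]; positivity
    have hε1 : ε n ≤ 1 := by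
      simp only [hε]
      exact div_le_one_of_le₀ (by linarith [n.cast_nonneg (α := ℝ)]) (by positivity)
    exact lintegral_weight_mul_sq_le (isSlowWeight_weight hεpos hε1) (by positivity) h1 h2 hu hv
      hW ht ht1 heq
  have hlim : Tendsto (fun n => ENNReal.ofReal (4 * (d + 1) * (((d : ℝ) + 3) ^ 2 * ε n) * W ^ 2))
      atTop (𝓝 0) := by
    have h1 := (hκlim.const_mul (4 * ((d : ℝ) + 1))).mul_const (W ^ 2)
    rw [mul_zero, zero_mul] at h1
    rw [← ENNReal.ofReal_zero]
    exact (ENNReal.continuous_ofReal.tendsto _).comp h1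
  have hzero : ∫⁻ x, ‖(h t - g t : F02 d) x‖ₑ ^ 2 = 0 := by
    refine le_antisymm ?_ (by simp)
    have hwm : Measurable fun x => ‖(h t - g t : F02 d) x‖ₑ ^ 2 :=
      (Lp.stronglyMeasurable (h t - g t)).enorm.pow_const 2
    calc ∫⁻ x, ‖(h t - g t : F02 d) x‖ₑ ^ 2
        = ∫⁻ x, liminf (fun n => ENNReal.ofReal (weight d (ε n) x) *
            ‖(h t - g t : F02 d) x‖ₑ ^ 2) atTop := by
          refine lintegral_congr fun x => (Tendsto.liminf_eq ?_).symm
          have h1 := (ENNReal.continuous_ofReal.tendsto _).comp ((tendsto_weight x).comp hεlim)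
          have h2 := ENNReal.Tendsto.mul_const (b := ‖(h t - g t : F02 d) x‖ₑ ^ 2) h1
            (Or.inl (by simp))
          simpa using h2
      _ ≤ liminf (fun n => ∫⁻ x, ENNReal.ofReal (weight d (ε n) x) *
            ‖(h t - g t : F02 d) x‖ₑ ^ 2) atTop := by
          refine lintegral_liminf_le fun n => ?_
          have hεpos : 0 < ε n := by simp only [hε]; positivity
          have hε1 : ε n ≤ 1 := by
            simp only [hε]
            exact div_le_one_of_le₀ (by linarith [n.cast_nonneg (α := ℝ)]) (by positivity)
          exact (isSlowWeight_weight hεpos hε1).smooth.continuous.measurable.ennreal_ofReal.mul hwm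
      _ ≤ liminf (fun n => ENNReal.ofReal (4 * (d + 1) * (((d : ℝ) + 3) ^ 2 * ε n) * W ^ 2))
            atTop := liminf_le_liminf hle
      _ = 0 := hlim.liminf_eq
  rw [lintegral_sq_enorm_eq] at hzero
  simpa [sub_eq_zero] using hzero

end

section

open scoped Convolution

variable {d : ℕ}

/-- A weak Laplacian of a function with finite `2`-norm is bounded by that norm. -/
lemma ae_abs_le_of_isWeakLaplacian (hd : 1 ≤ d) {f : F02 d} {u : Space d → ℝ}
    (hu : IsWeakLaplacian f u) {M : ℝ} (hM : 0 ≤ M) (hf : sNorm 2 f ≤ ENNReal.ofReal M) :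
    ∀ᵐ x, |u x| ≤ M := by
  have hmom : moment 0 f ≤ ENNReal.ofReal M := by
    refine le_trans ?_ hf
    rw [sNorm_eq]
    refine le_mul_of_one_le_left (by simp) ?_
    rw [ENNReal.one_le_ofReal]
    linarith [two_le_rpow hd]
  set k : Space d → ℂ := fun η => (freq η : ℂ) ^ 2 * fourierR f η with hk
  have hke : ∫⁻ η, ‖k η‖ₑ = moment 0 f := by
    refine lintegral_congr fun η => ?_
    have h1 : ‖(freq η : ℂ) ^ 2‖ₑ = ENNReal.ofReal (freq η ^ 2) := by
      rw [← ofReal_norm, norm_pow, Complex.norm_real, Real.norm_of_nonneg (freq_nonneg η)]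
    rw [hk, enorm_mul, h1]
    simp
  have hki : Integrable k := by
    refine ⟨AEStronglyMeasurable.mul ?_ (Lp.aestronglyMeasurable _), ?_⟩
    · exact (by fun_prop : Continuous fun η : Space d => (freq η : ℂ) ^ 2).aestronglyMeasurable
    · rw [HasFiniteIntegral, hke]
      exact hmom.trans_lt ENNReal.ofReal_lt_top
  have hu' := isWeakLaplacian_of_fourier hki (Eventually.of_forall fun η => rfl)
  have hae : ∀ᵐ x, u x = -(𝓕⁻ k x).re := by
    refine ae_eq_of_integral_contDiff_smul_eq hu.1 hu'.1 fun φ h1 h2 => ?_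
    have e1 := hu.2 φ ⟨h1, h2⟩
    have e2 := hu'.2 φ ⟨h1, h2⟩
    simp only [smul_eq_mul, mul_comm (φ _)]
    rw [← e1, ← e2]
  filter_upwards [hae] with x hx
  rw [hx, abs_neg]
  refine (Complex.abs_re_le_norm _).trans ?_
  rw [Real.fourierInv_eq]
  refine (norm_integral_le_integral_norm _).trans ?_
  simp only [Circle.norm_smul]
  rw [← ENNReal.ofReal_le_ofReal_iff hM, ofReal_integral_norm_eq_lintegral_enorm hki, hke]
  exact hmom

lemma IsLaplacianCurve.mono {M M' : ℝ} {h : ℝ → F02 d} {u : ℝ → Space d → ℝ}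
    (hu : IsLaplacianCurve M h u) (hM : M ≤ M') : IsLaplacianCurve M' h u where
  continuous := hu.continuous
  isWeakLaplacian := hu.isWeakLaplacian
  bounded s := (hu.bounded s).mono fun _ hx => hx.trans hM

/-- Extension of a curve on `[0, 1]` to the real line, constant outside `[0, 1]`. -/
def clamp {α : Type*} (h : ℝ → α) (s : ℝ) : α := h (projIcc (0 : ℝ) 1 zero_le_one s)

lemma clamp_of_mem {α : Type*} (h : ℝ → α) {s : ℝ} (hs : s ∈ Icc (0 : ℝ) 1) :
    clamp h s = h s := by
  rw [clamp, projIcc_of_mem _ hs]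

lemma IsSolution.isLaplacianCurve (hd : 1 ≤ d) {h₀ : F02 d} {h : ℝ → F02 d}
    (hh : IsSolution 1 h₀ h) {u : ℝ → Space d → ℝ}
    (hu : ∀ t ∈ Icc (0 : ℝ) 1, IsWeakLaplacian (h t) (u t)) :
    ∃ M, IsLaplacianCurve M (clamp h) (clamp u) := by
  obtain ⟨M, hM⟩ := hh.bounded
  refine ⟨max M 0, ⟨?_, fun s => hu _ (Subtype.coe_prop _), fun s => ?_⟩⟩
  · exact hh.continuousOn.domRestrict.comp continuous_projIcc
  · refine ae_abs_le_of_isWeakLaplacian hd (hu _ (Subtype.coe_prop _)) (le_max_right _ _) ?_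
    exact (hM _ (Subtype.coe_prop _)).trans (ENNReal.ofReal_le_ofReal (le_max_left _ _))

/-- Solutions are determined by their initial datum. -/
theorem IsSolution.unique (hd : 1 ≤ d) {h₀ : F02 d} {h g : ℝ → F02 d} (hh : IsSolution 1 h₀ h)
    (hg : IsSolution 1 h₀ g) {t : ℝ} (ht : t ∈ Icc (0 : ℝ) 1) : h t = g t := by
  obtain ⟨u, hu, hue⟩ := hh.equation
  obtain ⟨v, hv, hve⟩ := hg.equation
  obtain ⟨M₁, h1⟩ := hh.isLaplacianCurve hd hu
  obtain ⟨M₂, h2⟩ := hg.isLaplacianCurve hd hv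
  have hu' := h1.mono (le_max_left M₁ M₂)
  have hv' := h2.mono (le_max_right M₁ M₂)
  obtain ⟨W, hW⟩ := isCompact_Icc.exists_bound_of_continuousOn
    (hh.continuousOn.sub hg.continuousOn)
  rw [← clamp_of_mem h ht, ← clamp_of_mem g ht]
  refine eq_of_laplacianCurve hu' hv' (W := W) (fun s => hW _ (Subtype.coe_prop _)) ht.1 ht.2
    fun φ hφ r hr => ?_
  have hr1 : r ∈ Icc (0 : ℝ) 1 := ⟨hr.1, hr.2.trans ht.2⟩
  have hint : ∀ f : F02 d, Integrable fun x => f x * φ x := fun f =>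
    (locallyIntegrable_L2 f).integrable_smul_right_of_hasCompactSupport hφ.1.continuous hφ.2
  have hsub : uIcc 0 r ⊆ uIcc (0 : ℝ) 1 := by
    rw [uIcc_of_le hr.1, uIcc_of_le zero_le_one]
    exact Icc_subset_Icc_right hr1.2
  have e1 := (hue φ hφ).2 r hr1
  have e2 := (hve φ hφ).2 r hr1
  have i1 := (hue φ hφ).1.mono_set hsub
  have i2 := (hve φ hφ).1.mono_set hsub
  have e3 : ∫ x, (h r - g r : F02 d) x * φ x = (∫ x, h r x * φ x) - ∫ x, g r x * φ x := by
    rw [← integral_sub (hint _) (hint _)]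
    refine integral_congr_ae ?_
    filter_upwards [Lp.coeFn_sub (h r) (g r)] with x hx
    rw [hx, Pi.sub_apply, sub_mul]
  rw [clamp_of_mem h hr1, clamp_of_mem g hr1, e3]
  have e4 : (∫ x, h r x * φ x) - ∫ x, g r x * φ x =
      (∫ s in (0 : ℝ)..r, ∫ x, Real.exp (-(u s x)) * Δ φ x) -
        ∫ s in (0 : ℝ)..r, ∫ x, Real.exp (-(v s x)) * Δ φ x := by
    rw [← e1, ← e2]; ring
  rw [e4, ← intervalIntegral.integral_sub i1 i2]
  refine intervalIntegral.integral_congr fun s hs => ?_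
  have hs1 : s ∈ Icc (0 : ℝ) 1 := by
    rw [← uIcc_of_le (zero_le_one (α := ℝ))]
    exact hsub hs
  have i3 := hu'.locallyIntegrable_exp s
  have i4 := hv'.locallyIntegrable_exp s
  have hΔ := hφ.laplacian
  simp only [expDiff]
  rw [clamp_of_mem u hs1] at i3 ⊢
  rw [clamp_of_mem v hs1] at i4 ⊢
  have j1 : Integrable fun x => Real.exp (-(u s x)) * Δ φ x :=
    i3.integrable_smul_right_of_hasCompactSupport hΔ.1.continuous hΔ.2
  have j2 : Integrable fun x => Real.exp (-(v s x)) * Δ φ x :=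
    i4.integrable_smul_right_of_hasCompactSupport hΔ.1.continuous hΔ.2
  rw [← integral_sub j1 j2]
  simp only [sub_mul]

end

end ExpPDE

end

theorem proposition6p1 (d : ℕ) (hd : 1 ≤ d) :
    ∃ b : ℝ → ℝ, (∀ r, 0 < b r ∧ b r < 1) ∧
      ∀ ystar : ℝ, 0 < ystar → ExpPDE.fTwo ystar ≤ 1 →
      ∀ h₀ : ExpPDE.F02 d, ExpPDE.sNorm 2 h₀ < ENNReal.ofReal ystar →
      ∃ T : ℝ, 0 < T ∧ ∃ h : ℝ → ExpPDE.F02 d,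
        ExpPDE.IsSolution T h₀ h ∧
        (∀ g : ℝ → ExpPDE.F02 d, ExpPDE.IsSolution T h₀ g →
          ∀ t ∈ Set.Icc 0 T, g t = h t) ∧
        ∀ t ∈ Set.Icc 0 T,
          ExpPDE.analyticNorm 2 1 (b (ExpPDE.sNorm 2 h₀).toReal * t) (h t) ≤
            ExpPDE.sNorm 2 h₀ *
              ENNReal.ofReal (Real.exp (b (ExpPDE.sNorm 2 h₀).toReal * T)) := by
  -- the smallness of the data allows the same rate and the same time for all of them
  refine ⟨fun _ => 1 / 16, fun _ => by norm_num, fun ystar hy hfy h₀ hh₀ => ?_⟩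
  have hle := ExpPDE.moment_le_of_sNorm_lt hd hy hfy hh₀
  have hfin : ExpPDE.moment 0 h₀ ≠ ⊤ := (hle.trans_lt ENNReal.ofReal_lt_top).ne
  have hmom : ENNReal.ofReal (ExpPDE.moment 0 h₀).toReal = ExpPDE.moment 0 h₀ :=
    ENNReal.ofReal_toReal hfin
  have hy16 : (ExpPDE.moment 0 h₀).toReal ≤ 1 / 16 :=
    ENNReal.toReal_le_of_le_ofReal (by norm_num) hle
  obtain ⟨h, hsol, hbd⟩ := ExpPDE.exists_solution hd ENNReal.toReal_nonneg hy16 hmom.ge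
  refine ⟨1, one_pos, h, hsol, fun g hg t ht => hg.unique hd hsol ht, fun t ht => ?_⟩
  rw [ExpPDE.analyticNorm_eq, ExpPDE.sNorm_eq, mul_assoc, mul_one, ← hmom,
    ← ENNReal.ofReal_mul ENNReal.toReal_nonneg, mul_comm (ExpPDE.moment 0 h₀).toReal]
  exact mul_le_mul_right (hbd t ht) _
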